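/- For a set $\Phi$ of real functions on $\mathbb{R}^d$ put $\mathrm{D}_\Phi(\nu,\nu')=\sup_{f\in\Phi}\bigl|\int f\,\mathrm{d}\nu-\int f\,\mathrm{d}\nu'\bigr|$. Write $\sigma(z)=\max\{z,0\}$, and for $x\in C([0,T];\mathbb{R}^d)$ let $\Delta(x,h)=\sup\{\|x_t-x_s\| : t,s\in[0,T],\ |t-s|\le h\}$, where $\|\cdot\|$ is the Euclidean norm. **Proposition.** Let $\alpha,\beta>0$. There is a constant $C>0$ depending only on $\alpha$ and $\beta$ such that the following holds for all integers $d\ge 0$, $n\ge 1$ and all $T,Q>0$. Let $\mu$ be a Borel probability measure on $C([0,T];\mathbb{R}^d)$ with $$\int\sup_{0\le t\le T}\|x_t\|^2\,\mathrm{d}\mu(x)<\infty,\qquad \int \Delta(x,h)^2\,\mathrm{d}\mu(x)\le Q\,h^{\alpha}\log^{\beta}\!\Bigl(\frac{2T}{h}\Bigr)\quad\text{for all } 0<h\le T.$$ Let $X^1,\dots,X^n$ be i.i.d. processes with law $\mu$, let $\mu_t$ be the law of $X^1_t$, and let $\bar\mu^n_t=\frac1n\sum_{i=1}^n\delta_{X^i_t}$.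 1. (RKHS) Let $\mathcal{H}_k$ be the reproducing kernel Hilbert space on $\mathbb{R}^d$ with kernel $k$, and suppose that there are $K_1,K_2>0$ with $k(x,x)+k(y,y)-2k(x,y)\le K_1^2\|x-y\|^2$ for all $x,y\in\mathbb{R}^d$ and $K_2=\sqrt{k(0,0)}$. If $\Phi$ is the closed unit ball of $\mathcal{H}_k$, then $$\mathbb{E}\sup_{0\le t\le T}\mathrm{D}_\Phi(\mu_t,\bar\mu^n_t)\le 2\sqrt{\frac2n\Bigl[K_1^2\int\sup_{0\le t\le T}\|x_t\|^2\,\mathrm{d}\mu(x)+K_2^2\Bigr]}+C K_1\sqrt{\frac{QT^\alpha}{n}}.$$ 2. (Barron space) Let $\mathcal{B}$ be the set of functions $f(x)=\int_{\mathbb{S}^d}\sigma(\omega\cdot x+b)\,\mathrm{d}\rho(\omega,b)$, where $\rho$ is a finite signed measure on $\mathbb{S}^d=\{(\omega,b)\in\mathbb{R}^d\times\mathbb{R}:\|\omega\|^2+|b|^2=1\}$, and let $\|f\|_{\mathcal{B}}$ be the infimum of $\|\rho\|_{TV}$ over all such $\rho$. If $\Phi=\{f\in\mathcal{B}:\|f\|_{\mathcal{B}}\le1\}$,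 then $$\mathbb{E}\sup_{0\le t\le T}\mathrm{D}_\Phi(\mu_t,\bar\mu^n_t)\le 4\sqrt{\frac2n\int\sup_{0\le t\le T}\bigl[\|x_t\|^2+1\bigr]\,\mathrm{d}\mu(x)}+C\sqrt{\frac{QT^\alpha}{n}}.$$ 3. (Flow-induced function space) Let $D\ge d+1$ be an integer. Let $\Psi$ be the set of families $\rho=\{\rho_\tau\}_{0\le\tau\le1}$ of $\mathbb{R}^D$-valued measures $\rho_\tau=(\rho_\tau^1,\dots,\rho_\tau^D)$ on $\mathbb{S}^{D-1}=\{\omega\in\mathbb{R}^D:\|\omega\|=1\}$ such that $\Lambda(\rho,\tau)=\bigl(\sum_{i=1}^D\|\rho_\tau^i\|_{TV}^2\bigr)^{1/2}$ is continuous in $\tau\in[0,1]$ and such that the equation $$\frac{\mathrm{d}Z_\tau}{\mathrm{d}\tau}=\int_{\mathbb{S}^{D-1}}\sigma(\omega\cdot Z_\tau)\,\mathrm{d}\rho_\tau(\omega),\quad 0\le\tau\le1,\qquad Z_0=z_0,$$ has, for every $z_0\in\mathbb{R}^D$, a unique solution, which depends continuously on $z_0$. For $\rho\in\Psi$ let $Z_\rho(\cdot,x)$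 be the solution with $z_0=(x,1,0,\dots,0)$, and for $a\in\mathbb{R}^D$ put $f_{\rho,a}(x)=a^{\mathrm T}Z_\rho(1,x)$. Let $\|f\|_{\mathcal{D}}=\inf\bigl\{\|a\|\exp\bigl(\int_0^1\Lambda(\rho,\tau)\,\mathrm{d}\tau\bigr):\rho\in\Psi,\ a\in\mathbb{R}^D,\ f=f_{\rho,a}\text{ on }\mathbb{R}^d\bigr\}$ (with $\inf\emptyset=\infty$) and $\mathcal{D}=\{f\in C(\mathbb{R}^d):\|f\|_{\mathcal{D}}<\infty\}$. If $\Phi=\{f\in\mathcal{D}:\|f\|_{\mathcal{D}}\le1\}$, then $$\mathbb{E}\sup_{0\le t\le T}\mathrm{D}_\Phi(\mu_t,\bar\mu^n_t)\le 2e^2\sqrt{\frac2n\int\sup_{0\le t\le T}\bigl[\|x_t\|^2+1\bigr]\,\mathrm{d}\mu(x)}+C\sqrt{\frac{QT^\alpha}{n}}.$$ -/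

import Mathlib

open MeasureTheory ProbabilityTheory Set
open scoped ENNReal

noncomputable section

/-- The state space `ℝ^d` with its Euclidean norm. -/
abbrev Eucl (d : ℕ) : Type := EuclideanSpace ℝ (Fin d)

/-! ### Path space -/

/-- The path space `C([0,T]; ℝ^d)` with the topology of uniform convergence. -/
abbrev PathSpace (d : ℕ) (T : ℝ) : Type := C(Set.Icc (0 : ℝ) T, Eucl d)

instance PathSpace.measurableSpace (d : ℕ) (T : ℝ) : MeasurableSpace (PathSpace d T) := borel _

instance PathSpace.borelSpace (d : ℕ) (T : ℝ) : BorelSpace (PathSpace d T) := ⟨rfl⟩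

/-- The modulus of continuity
`Δ(x, h) = sup {‖x_t - x_s‖ : t, s ∈ [0,T], |t - s| ≤ h}`. -/
def pathModulus {d : ℕ} {T : ℝ} (x : PathSpace d T) (h : ℝ) : ℝ :=
  ⨆ p : {p : Set.Icc (0 : ℝ) T × Set.Icc (0 : ℝ) T // |(p.1 : ℝ) - (p.2 : ℝ)| ≤ h},
    ‖x p.1.1 - x p.1.2‖

/-- The marginal `μ_t` of a law `μ` on path space. -/
def marginal {d : ℕ} {T : ℝ} (μ : Measure (PathSpace d T)) (t : Set.Icc (0 : ℝ) T) :
    Measure (Eucl d) :=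
  μ.map (fun x => x t)

/-! ### Generalized maximum mean discrepancy -/

/-- The empirical measure `(1/n) ∑ᵢ δ_{xᵢ}` of the points `x₁, …, xₙ`. -/
def empiricalMeasure {d n : ℕ} (x : Fin n → Eucl d) : Measure (Eucl d) :=
  (n : ℝ≥0∞)⁻¹ • ∑ i, Measure.dirac (x i)

/-- The generalized maximum mean discrepancy
`D_Φ(μ, ν) = sup_{f ∈ Φ} |∫ f d(μ - ν)|`, as an element of `[0, ∞]`. -/
def gmmd {d : ℕ} (Φ : Set (Eucl d → ℝ)) (μ ν : Measure (Eucl d)) : ℝ≥0∞ :=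
  ⨆ f ∈ Φ, ENNReal.ofReal |(∫ x, f x ∂μ) - ∫ x, f x ∂ν|

/-- `sup_{t ∈ [0,T]} D_Φ(μ_t, μ̄_tⁿ)`, where `μ̄_tⁿ` is the empirical measure at time `t` of the
paths `x₁, …, xₙ`. -/
def supGmmd {d n : ℕ} {T : ℝ} (Φ : Set (Eucl d → ℝ)) (μ : Measure (PathSpace d T))
    (x : Fin n → PathSpace d T) : ℝ≥0∞ :=
  ⨆ t : Set.Icc (0 : ℝ) T, gmmd Φ (marginal μ t) (empiricalMeasure (fun i => x i t))

/-! ### Reproducing kernel Hilbert spaces -/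

/-- `k` is the reproducing kernel of the Hilbert space of functions `H`:
`k(x, ·) ∈ H` and `f(x) = ⟨f, k(x, ·)⟩` for all `x` and all `f ∈ H`. -/
def IsReproducingKernel {d : ℕ} (H : Type*) [NormedAddCommGroup H] [InnerProductSpace ℝ H]
    [RKHS ℝ H (Eucl d) ℝ] (k : Eucl d → Eucl d → ℝ) : Prop :=
  ∀ x : Eucl d, ∃ g : H, (∀ y, g y = k x y) ∧ ∀ f : H, f x = inner ℝ f g

/-- The closed unit ball of the Hilbert space of functions `H`, as a set of functions. -/
def rkhsUnitBall {d : ℕ} (H : Type*) [NormedAddCommGroup H] [InnerProductSpace ℝ H]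
    [RKHS ℝ H (Eucl d) ℝ] : Set (Eucl d → ℝ) :=
  {f | ∃ g : H, ‖g‖ ≤ 1 ∧ ∀ x, f x = g x}

/-! ### Signed measures and the ReLU function -/

/-- The ReLU function `σ(x) = max{x, 0}`. -/
def relu (x : ℝ) : ℝ := max x 0

/-- The integral of a real function against a (finite) signed measure. -/
def signedIntegral {S : Type*} [MeasurableSpace S] (ρ : SignedMeasure S) (g : S → ℝ) : ℝ :=
  VectorMeasure.integral ρ g (ContinuousLinearMap.lsmul ℝ ℝ)

/-- The total variation norm of a (finite) signed measure. -/
def tvNorm {S : Type*} [MeasurableSpace S] (ρ : SignedMeasure S) : ℝ :=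
  (ρ.totalVariation Set.univ).toReal

/-! ### The Barron space -/

/-- The unit sphere `𝕊^d = {(ω, b) ∈ ℝ^d × ℝ : ‖ω‖² + |b|² = 1}`. -/
abbrev BarronSphere (d : ℕ) : Type :=
  Metric.sphere (0 : WithLp 2 (Eucl d × ℝ)) 1

/-- `f(x) = ∫ σ(ω · x + b) dρ(ω, b)` for all `x`. -/
def IsBarronRepr {d : ℕ} (ρ : SignedMeasure (BarronSphere d)) (f : Eucl d → ℝ) : Prop :=
  ∀ x, f x = signedIntegral ρ
    (fun p => relu (inner ℝ (p : WithLp 2 (Eucl d × ℝ)).fst x + (p : WithLp 2 (Eucl d × ℝ)).snd))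

/-- The Barron space: the functions which have such a representation. -/
def barronSpace (d : ℕ) : Set (Eucl d → ℝ) := {f | ∃ ρ, IsBarronRepr ρ f}

/-- The Barron norm: the infimum of the total variations of the representing signed measures. -/
def barronNorm {d : ℕ} (f : Eucl d → ℝ) : ℝ :=
  ⨅ ρ : {ρ : SignedMeasure (BarronSphere d) // IsBarronRepr ρ f}, tvNorm ρ.1

/-- The unit ball `{f ∈ 𝓑 : ‖f‖_𝓑 ≤ 1}` of the Barron space. -/
def barronUnitBall (d : ℕ) : Set (Eucl d → ℝ) := {f | f ∈ barronSpace d ∧ barronNorm f ≤ 1}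

/-! ### Flow-induced function spaces -/

/-- The unit sphere `𝕊^{D-1}` of `ℝ^D`. -/
abbrev FlowSphere (D : ℕ) : Type := Metric.sphere (0 : Eucl D) 1

/-- A family `{ρ_τ}` of `ℝ^D`-valued measures on `𝕊^{D-1}`, given through their `D` components;
only the values for `τ ∈ [0,1]` matter. -/
abbrev FlowField (D : ℕ) : Type := ℝ → Fin D → SignedMeasure (FlowSphere D)

/-- The vector `∫ σ(ω · z) dρ_τ(ω)` of `ℝ^D`. -/
def FlowField.velocity {D : ℕ} (ρ : FlowField D) (τ : ℝ) (z : Eucl D) : Eucl D :=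
  WithLp.toLp 2 fun i => signedIntegral (ρ τ i) (fun ω => relu (inner ℝ (ω : Eucl D) z))

/-- `Z` solves `dZ_τ/dτ = ∫ σ(ω · Z_τ) dρ_τ(ω)` on `[0,1]` with `Z_0 = z₀`. -/
def FlowField.IsSolution {D : ℕ} (ρ : FlowField D) (z₀ : Eucl D) (Z : ℝ → Eucl D) : Prop :=
  Z 0 = z₀ ∧ ∀ τ ∈ Set.Icc (0 : ℝ) 1,
    HasDerivWithinAt Z (ρ.velocity τ (Z τ)) (Set.Icc 0 1) τ

/-- Well-posedness: for every initial condition the solution on `[0,1]` exists, is unique, and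
depends continuously on the initial condition. -/
def FlowField.WellPosed {D : ℕ} (ρ : FlowField D) : Prop :=
  ∃ S : Eucl D → ℝ → Eucl D,
    (∀ z₀, ρ.IsSolution z₀ (S z₀)) ∧
    (∀ z₀ Z, ρ.IsSolution z₀ Z → Set.EqOn Z (S z₀) (Set.Icc 0 1)) ∧
    ∀ τ ∈ Set.Icc (0 : ℝ) 1, Continuous fun z₀ => S z₀ τ

/-- `Λ(ρ, τ) = (∑ᵢ ‖ρ_τⁱ‖_TV²)^{1/2}`. -/
def FlowField.speed {D : ℕ} (ρ : FlowField D) (τ : ℝ) : ℝ :=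
  √(∑ i, tvNorm (ρ τ i) ^ 2)

/-- The admissible class `Ψ`: the problem is well-posed and `τ ↦ Λ(ρ, τ)` is continuous. -/
def FlowField.Admissible {D : ℕ} (ρ : FlowField D) : Prop :=
  ρ.WellPosed ∧ ContinuousOn ρ.speed (Set.Icc 0 1)

/-- The initial condition `(x, 1, 0, …, 0) ∈ ℝ^D` (used for `D ≥ d + 1`). -/
def flowEmbed {d : ℕ} (D : ℕ) (x : Eucl d) : Eucl D :=
  WithLp.toLp 2 fun j => if h : (j : ℕ) < d then x ⟨j, h⟩ else if (j : ℕ) = d then 1 else 0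

/-- `f = f_{ρ,a}` with `ρ ∈ Ψ`: `f(x) = aᵀ Z_ρ(1, x)` for all `x`, where `Z_ρ(·, x)` is the
(unique) solution with initial condition `(x, 1, 0, …, 0)`. -/
def IsFlowRepr {d D : ℕ} (ρ : FlowField D) (a : Eucl D) (f : Eucl d → ℝ) : Prop :=
  ρ.Admissible ∧ ∀ x, ∃ Z, ρ.IsSolution (flowEmbed D x) Z ∧ f x = inner ℝ a (Z 1)

/-- The norm `‖f‖_𝓓`, the infimum of `‖a‖ exp(∫₀¹ Λ(ρ,τ) dτ)` over all representations
`f = f_{ρ,a}`, as an element of `[0, ∞]` (it is `∞` if there is none). -/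
def flowNorm {d : ℕ} (D : ℕ) (f : Eucl d → ℝ) : ℝ≥0∞ :=
  ⨅ (ρ : FlowField D) (a : Eucl D) (_ : IsFlowRepr ρ a f),
    ENNReal.ofReal (‖a‖ * Real.exp (∫ τ in (0 : ℝ)..1, ρ.speed τ))

/-- The flow-induced function space `𝓓`. -/
def flowSpace (d D : ℕ) : Set (Eucl d → ℝ) := {f | Continuous f ∧ flowNorm D f < ∞}

/-- The unit ball `{f ∈ 𝓓 : ‖f‖_𝓓 ≤ 1}`. -/
def flowUnitBall (d D : ℕ) : Set (Eucl d → ℝ) := {f | f ∈ flowSpace d D ∧ flowNorm D f ≤ 1}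

end

/-! Symmetrization with a ghost sample (`two_pow_mul_lintegral_supGmmd_le`) reduces each estimate to
fixed paths x_i: the sum over all 2^n sign vectors of sup_t sup_f |∑ ±f(x_i(t))| has to be at most
2^n times √(∑ b(x_i)) plus a chaining term in the moduli of continuity. Jensen's inequality then
gives the rate n^(-1/2) (`lintegral_supGmmd_le`).

For curves in a Hilbert space this is chaining along dyadic grids in time
(`sum_iSup_norm_sum_sgn_smul_le`), with a dimension-free maximal inequality that comes from
cosh‖u+v‖ + cosh‖u-v‖ ≤ 2 cosh‖u‖ cosh‖v‖. Through the feature map it settles the RKHS case. It also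
controls the embedded curves (x,1) and (x,1,0,…,0) of the other two classes. There the nonlinearity
σ is removed at an additive cost of order √(∑ζ_i²), where |y_i| ≤ ζ_i, and the chaining term is not
multiplied.

The tool is `sum_max_signSup_abs_le`: if y_i ≥ -Dζ_i, the absolute values |y_i| can be replaced by
y_i inside a Rademacher supremum at the mean cost √(D(1+D))·√(∑ζ_i²). One coordinate is treated at a
time by pairing ξ with its flip. Once the maximum is smoothed at scale e, removing one absolute
value costs only D(1+D)ζ_k²/e. For the Barron space σ(v) = (v+|v|)/2 and D = 1 suffice.

For flows, trajectories are divided by e^ℓ, where ℓ = ∫Λ is the accumulated speed. Since half of σ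
is linear, the normalized signed sum m satisfies m' ≤ (B-m)/2 in the variable ℓ, where B bounds the
signed sums of the absolute values (`FlowField.norm_signSum_le`). Moreover the functional
(‖g‖‖g'‖)²(‖g‖‖g'‖ - ⟨g,g'⟩) grows at rate at most 9Λ/2, so ‖g‖‖g'‖ - ⟨g,g'⟩ is O(e^(3ℓ/2)), while
‖g‖‖g'‖ may reach order e^(2ℓ). Hence trajectories of nearly maximal growth align, and up to a
global sign a normalized profile satisfies y_i ≥ -Dζ_i with D = e^(-ℓ/4)
(`FlowField.one_signed_of_mem_profiles`). The absolute values then cost about e^(-ℓ/8) per unit of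
ℓ, which is integrable. So the supremum over all ℓ ≥ 0 exceeds the one at ℓ = 0 by at most
9.41·√(∑ζ_i²) in the mean (`IsDecayingFamily.sum_signSup_iUnion_le`), and 1 + 9.41 < √2·e². -/

noncomputable section

/-! ### Sign vectors -/

/-- The sign `±1` encoded by a Boolean. -/
def sgn (b : Bool) : ℝ := if b then 1 else -1

lemma sgn_not (b : Bool) : sgn (!b) = -sgn b := by cases b <;> simp [sgn]

lemma abs_sgn (b : Bool) : |sgn b| = 1 := by cases b <;> simp [sgn]

section Signs

variable {ι : Type*}

/-- Flip the sign of the coordinate `k`. -/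
def flipAt [DecidableEq ι] (k : ι) (ξ : ι → Bool) : ι → Bool := Function.update ξ k (!ξ k)

lemma flipAt_involutive [DecidableEq ι] (k : ι) : Function.Involutive (flipAt k) := by
  intro ξ; simp [flipAt]

variable [Fintype ι]

/-- The signed sum `∑ᵢ ±yᵢ`. -/
def signSum (ξ : ι → Bool) (y : ι → ℝ) : ℝ := ∑ i, sgn (ξ i) * y i

lemma signSum_neg (ξ : ι → Bool) (y : ι → ℝ) : signSum ξ (-y) = -signSum ξ y := by
  simp [signSum]

lemma signSum_not (ξ : ι → Bool) (y : ι → ℝ) : signSum (fun i => !ξ i) y = -signSum ξ y := by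
  simp [signSum, sgn_not]

lemma abs_signSum_le (ξ : ι → Bool) {y ζ : ι → ℝ} (h : ∀ i, |y i| ≤ ζ i) :
    |signSum ξ y| ≤ ∑ i, ζ i := by
  refine (Finset.abs_sum_le_sum_abs _ _).trans (Finset.sum_le_sum fun i _ => ?_)
  rw [abs_mul, abs_sgn, one_mul]; exact h i

/-- The supremum of the signed sums of the vectors in `A`. -/
def signSup (A : Set (ι → ℝ)) (ξ : ι → Bool) : ℝ := sSup (signSum ξ '' A)

lemma bddAbove_signSum {A : Set (ι → ℝ)} {ζ : ι → ℝ} (h : ∀ y ∈ A, ∀ i, |y i| ≤ ζ i)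
    (ξ : ι → Bool) : BddAbove (signSum ξ '' A) := by
  refine ⟨∑ i, ζ i, ?_⟩
  rintro _ ⟨y, hy, rfl⟩
  exact (le_abs_self _).trans (abs_signSum_le ξ (h y hy))

lemma le_signSup {A : Set (ι → ℝ)} {ζ : ι → ℝ} (h : ∀ y ∈ A, ∀ i, |y i| ≤ ζ i)
    (ξ : ι → Bool) {y : ι → ℝ} (hy : y ∈ A) : signSum ξ y ≤ signSup A ξ :=
  le_csSup (bddAbove_signSum h ξ) ⟨y, hy, rfl⟩

lemma signSup_le {A : Set (ι → ℝ)} (hA : A.Nonempty) {ξ : ι → Bool} {c : ℝ}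
    (h : ∀ y ∈ A, signSum ξ y ≤ c) : signSup A ξ ≤ c := by
  refine csSup_le (hA.image _) ?_
  rintro _ ⟨y, hy, rfl⟩
  exact h y hy

lemma signSup_mono {A B : Set (ι → ℝ)} (hA : A.Nonempty) {ζ : ι → ℝ}
    (h : ∀ y ∈ B, ∀ i, |y i| ≤ ζ i) (hAB : A ⊆ B) (ξ : ι → Bool) :
    signSup A ξ ≤ signSup B ξ :=
  signSup_le hA fun _ hy => le_signSup h ξ (hAB hy)

lemma signSup_not {A : Set (ι → ℝ)} (hA : ∀ y ∈ A, -y ∈ A) (ξ : ι → Bool) :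
    signSup A (fun i => !ξ i) = signSup A ξ := by
  unfold signSup
  congr 1
  ext c
  constructor
  · rintro ⟨y, hy, rfl⟩
    exact ⟨-y, hA y hy, by rw [signSum_neg, signSum_not]⟩
  · rintro ⟨y, hy, rfl⟩
    exact ⟨-y, hA y hy, by rw [signSum_neg, signSum_not, neg_neg]⟩

variable [DecidableEq ι]

lemma sum_flipAt (k : ι) (f : (ι → Bool) → ℝ) : ∑ ξ, f (flipAt k ξ) = ∑ ξ, f ξ :=
  Equiv.sum_comp (flipAt_involutive k).toPerm f

lemma sum_not (f : (ι → Bool) → ℝ) : ∑ ξ : ι → Bool, f (fun i => !ξ i) = ∑ ξ, f ξ :=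
  Equiv.sum_comp (Function.Involutive.toPerm (fun (ξ : ι → Bool) i => !ξ i)
    (fun ξ => by funext i; simp)) f

lemma signSum_eq_add (k : ι) (ξ : ι → Bool) (y : ι → ℝ) :
    signSum ξ y = sgn (ξ k) * y k + ∑ i ∈ Finset.univ.erase k, sgn (ξ i) * y i := by
  rw [signSum, ← Finset.add_sum_erase _ _ (Finset.mem_univ k)]

lemma signSum_flipAt (k : ι) (ξ : ι → Bool) (y : ι → ℝ) :
    signSum (flipAt k ξ) y
      = -(sgn (ξ k) * y k) + ∑ i ∈ Finset.univ.erase k, sgn (ξ i) * y i := by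
  rw [signSum_eq_add k]
  congr 1
  · simp [flipAt, sgn_not]
  · refine Finset.sum_congr rfl fun i hi => ?_
    simp [flipAt, Finset.ne_of_mem_erase hi]

end Signs

/-! ### A smooth maximum -/

/-- The clamped slope of `softPos`. -/
def softSlope (e v : ℝ) : ℝ := max 0 (min 1 ((v + e) / (2 * e)))

/-- A `C¹` approximation of `max v 0` from above. -/
def softPos (e v : ℝ) : ℝ := softSlope e v * v + e * (softSlope e v * (1 - softSlope e v))

lemma softSlope_nonneg (e v : ℝ) : 0 ≤ softSlope e v := le_max_left _ _

lemma softSlope_le_one (e v : ℝ) : softSlope e v ≤ 1 :=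
  max_le zero_le_one (min_le_left _ _)

/-- `softSlope` is the maximizer of p·v + e·p(1-p) over p in [0,1]. So `softPos` is a maximum of
affine functions of v, hence convex with slope `softSlope`. -/
lemma le_softPos {e : ℝ} (he : 0 < e) (v : ℝ) {p : ℝ} (h0 : 0 ≤ p) (h1 : p ≤ 1) :
    p * v + e * (p * (1 - p)) ≤ softPos e v := by
  -- x is the unclamped maximizer; for x in [0,1] the gap is e(x-p)².
  have key : ∀ x : ℝ, v = x * (2 * e) - e →
      p * v + e * (p * (1 - p)) ≤
        max 0 (min 1 x) * v + e * (max 0 (min 1 x) * (1 - max 0 (min 1 x))) := by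
    intro x hv
    subst hv
    rcases le_total x 0 with hx | hx
    · rw [min_eq_right (hx.trans zero_le_one), max_eq_left hx]
      nlinarith [mul_nonneg he.le (mul_nonneg h0 h0), mul_nonneg he.le (mul_nonneg h0 (neg_nonneg.2 hx))]
    · rcases le_total x 1 with hx1 | hx1
      · rw [min_eq_right hx1, max_eq_right hx]
        nlinarith [mul_nonneg he.le (sq_nonneg (x - p))]
      · rw [min_eq_left hx1, max_eq_right zero_le_one]
        nlinarith [mul_nonneg he.le (mul_nonneg (sub_nonneg.2 h1) (sub_nonneg.2 h1)),
          mul_nonneg he.le (mul_nonneg (sub_nonneg.2 h1) (sub_nonneg.2 hx1))]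
  exact key ((v + e) / (2 * e)) (by field_simp; ring)

lemma max_zero_le_softPos {e : ℝ} (he : 0 < e) (v : ℝ) : max 0 v ≤ softPos e v := by
  refine max_le ?_ ?_
  · simpa using le_softPos he v le_rfl zero_le_one
  · simpa using le_softPos he v zero_le_one le_rfl

lemma softPos_le {e : ℝ} (he : 0 < e) (v : ℝ) : softPos e v ≤ max 0 v + e / 4 := by
  have h0 := softSlope_nonneg e v
  have h1 := softSlope_le_one e v
  unfold softPos
  generalize softSlope e v = p at *
  have : p * v ≤ max 0 v := by
    rcases le_total 0 v with hv | hv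
    · rw [max_eq_right hv]; nlinarith
    · rw [max_eq_left hv]; nlinarith
  nlinarith [mul_nonneg he.le (sq_nonneg (p - 1 / 2))]

/-- The maximizer for v is a competitor at v - h; this is the tangent line inequality of a convex
function. -/
lemma softPos_sub_le {e : ℝ} (he : 0 < e) (v : ℝ) (h : ℝ) :
    softPos e v - softPos e (v - h) ≤ softSlope e v * h := by
  have := le_softPos he (v - h) (softSlope_nonneg e v) (softSlope_le_one e v)
  rw [softPos]
  linarith

lemma softPos_mono {e : ℝ} (he : 0 < e) {v w : ℝ} (h : v ≤ w) : softPos e v ≤ softPos e w := by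
  have h1 := softPos_sub_le he v (v - w)
  have h2 := mul_nonneg (softSlope_nonneg e v) (sub_nonneg.2 h)
  rw [sub_sub_cancel] at h1
  linarith

lemma softSlope_sub_le {e : ℝ} (he : 0 < e) (v w : ℝ) :
    softSlope e v - softSlope e w ≤ max 0 (v - w) / (2 * e) := by
  have key : ∀ x y c : ℝ, 0 ≤ c → x - y ≤ c → max 0 (min 1 x) - max 0 (min 1 y) ≤ c := by
    intro x y c hc hxy
    rcases max_cases 0 (min 1 x) with ⟨h1, _⟩ | ⟨h1, _⟩ <;>
    rcases max_cases 0 (min 1 y) with ⟨h2, _⟩ | ⟨h2, _⟩ <;>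
    rcases min_cases 1 x with ⟨h3, _⟩ | ⟨h3, _⟩ <;>
    rcases min_cases 1 y with ⟨h4, _⟩ | ⟨h4, _⟩ <;> linarith
  refine key _ _ _ (by positivity) ?_
  rw [← sub_div]
  gcongr
  rw [show v + e - (w + e) = v - w by ring]
  exact le_max_right _ _

/-- Moving the amount h from one argument to the other costs only h times the difference of the
slopes, and the slope is 1/(2e)-Lipschitz. This second-order cost is the purpose of the smoothing.
-/
lemma softPos_four_point {e : ℝ} (he : 0 < e) (v w : ℝ) {h : ℝ} (hh : 0 ≤ h) :
    softPos e v - softPos e (v - h) + (softPos e w - softPos e (w + h))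
      ≤ h * (max 0 (v - w) / (2 * e)) := by
  have h1 := softPos_sub_le he v h
  have h2 := softPos_sub_le he w (-h)
  rw [sub_neg_eq_add] at h2
  have h3 := mul_le_mul_of_nonneg_left (softSlope_sub_le he v w) hh
  linarith

/-! ### Linearization of absolute values under random signs -/

/-- P and R stand for the suprema with and without the absolute value at one coordinate, and the
suffixes p, m for its two signs. If Pp exceeds Rp, then by `h3` the excess, at most 2d, is regained
in Rm - Pm, and the four-point estimate applies with an argument gap of at most 2(d+z). -/
lemma softPos_swap {e : ℝ} (he : 0 < e) {Ip Im Pp Pm Rp Rm d z : ℝ} (hd : 0 ≤ d) (hz : 0 ≤ z)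
    (h1 : Pm ≤ Rm) (h2 : Pp ≤ Rp + 2 * d) (h3 : Pp + Pm ≤ Rp + Rm)
    (h4 : Pp ≤ max Rp (Pm + 2 * d)) (h5 : Im - Ip ≤ 2 * z) :
    Ip + softPos e (Pp - Ip) + (Im + softPos e (Pm - Im)) ≤
      Ip + softPos e (Rp - Ip) + (Im + softPos e (Rm - Im)) + 2 * (d * (d + z) / e) := by
  rcases le_or_gt Pp Rp with h | h
  · have h6 := softPos_mono he (sub_le_sub_right h Ip)
    have h7 := softPos_mono he (sub_le_sub_right h1 Im)
    have : 0 ≤ d * (d + z) / e := by positivity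
    linarith
  · have h4' : Pp ≤ Pm + 2 * d := by
      rcases le_max_iff.1 h4 with h' | h'
      · exact absurd h (not_lt.2 h')
      · exact h'
    have h6 := softPos_four_point he (Pp - Ip) (Pm - Im) (sub_nonneg.2 h.le)
    have h7 : softPos e (Pm - Im + (Pp - Rp)) ≤ softPos e (Rm - Im) :=
      softPos_mono he (by linarith)
    rw [show Pp - Ip - (Pp - Rp) = Rp - Ip by ring] at h6
    have h8 : max 0 (Pp - Ip - (Pm - Im)) ≤ 2 * (d + z) :=
      max_le (by positivity) (by linarith)
    have h9 : (Pp - Rp) * (max 0 (Pp - Ip - (Pm - Im)) / (2 * e)) ≤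
        (2 * d) * (2 * (d + z) / (2 * e)) := by
      gcongr
      linarith
    have h10 : (2 * d) * (2 * (d + z) / (2 * e)) = 2 * (d * (d + z) / e) := by
      field_simp
    linarith

section Contraction

variable {ι : Type*} [DecidableEq ι]

/-- The vector `y` with the coordinates outside `K` replaced by their absolute values. -/
def absOutside (K : Finset ι) (y : ι → ℝ) : ι → ℝ := fun i => if i ∈ K then y i else |y i|

lemma abs_absOutside (K : Finset ι) (y : ι → ℝ) (i : ι) : |absOutside K y i| = |y i| := by
  unfold absOutside; split_ifs <;> simp

variable [Fintype ι]

/-- Only negative entries y_k feel the absolute value, and these are at most Dζ_k in size. The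
excess to be moved and the gap between the two arguments are therefore both of order ζ_k, and the
error is quadratic in ζ_k. -/
lemma softPos_pair_le {I J : Set (ι → ℝ)} (hI : I.Nonempty) (hJ : J.Nonempty) {ζ : ι → ℝ}
    {D e : ℝ} (hD : 0 ≤ D) (he : 0 < e) (hζ : ∀ i, 0 ≤ ζ i)
    (hIζ : ∀ z ∈ I, ∀ i, |z i| ≤ ζ i) (hJζ : ∀ y ∈ J, ∀ i, |y i| ≤ ζ i)
    (hJD : ∀ y ∈ J, ∀ i, -(D * ζ i) ≤ y i) (K : Finset ι) {k : ι} (hk : k ∉ K)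
    (ξ : ι → Bool) (hξ : ξ k = true) :
    (signSup I ξ + softPos e (signSup (absOutside K '' J) ξ - signSup I ξ)) +
      (signSup I (flipAt k ξ) +
        softPos e (signSup (absOutside K '' J) (flipAt k ξ) - signSup I (flipAt k ξ))) ≤
    (signSup I ξ + softPos e (signSup (absOutside (insert k K) '' J) ξ - signSup I ξ)) +
      (signSup I (flipAt k ξ) +
        softPos e (signSup (absOutside (insert k K) '' J) (flipAt k ξ) - signSup I (flipAt k ξ)))
      + 2 * (D * (1 + D) * ζ k ^ 2 / e) := by
  have hb : ∀ K : Finset ι, ∀ y ∈ absOutside K '' J, ∀ i, |y i| ≤ ζ i := by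
    rintro K _ ⟨y, hy, rfl⟩ i
    rw [abs_absOutside]; exact hJζ y hy i
  set b : (ι → ℝ) → ℝ := fun y => ∑ i ∈ Finset.univ.erase k, sgn (ξ i) * absOutside K y i with hbdef
  have hs : sgn (ξ k) = 1 := by simp [hξ, sgn]
  have hPp : ∀ y, signSum ξ (absOutside K y) = b y + |y k| := by
    intro y
    rw [signSum_eq_add k, hs, one_mul, add_comm]
    simp [absOutside, hk, hbdef]
  have hPm : ∀ y, signSum (flipAt k ξ) (absOutside K y) = b y - |y k| := by
    intro y
    rw [signSum_flipAt k, hs, one_mul, add_comm]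
    simp [absOutside, hk, hbdef, sub_eq_add_neg]
  have hb' : ∀ y, ∑ i ∈ Finset.univ.erase k, sgn (ξ i) * absOutside (insert k K) y i = b y := by
    intro y
    refine Finset.sum_congr rfl fun i hi => ?_
    simp [absOutside, Finset.ne_of_mem_erase hi]
  have hRp : ∀ y, signSum ξ (absOutside (insert k K) y) = b y + y k := by
    intro y
    rw [signSum_eq_add k, hs, one_mul, add_comm, hb']
    simp [absOutside]
  have hRm : ∀ y, signSum (flipAt k ξ) (absOutside (insert k K) y) = b y - y k := by
    intro y
    rw [signSum_flipAt k, hs, one_mul, add_comm, hb']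
    simp [absOutside, sub_eq_add_neg]
  have lPm : ∀ y ∈ J, b y - |y k| ≤ signSup (absOutside K '' J) (flipAt k ξ) := fun y hy => by
    rw [← hPm]; exact le_signSup (hb K) _ ⟨y, hy, rfl⟩
  have lRp : ∀ y ∈ J, b y + y k ≤ signSup (absOutside (insert k K) '' J) ξ := fun y hy => by
    rw [← hRp]; exact le_signSup (hb _) _ ⟨y, hy, rfl⟩
  have lRm : ∀ y ∈ J, b y - y k ≤ signSup (absOutside (insert k K) '' J) (flipAt k ξ) :=
    fun y hy => by rw [← hRm]; exact le_signSup (hb _) _ ⟨y, hy, rfl⟩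
  have uP : ∀ c, (∀ y ∈ J, b y + |y k| ≤ c) → signSup (absOutside K '' J) ξ ≤ c := by
    intro c hc
    refine signSup_le (hJ.image _) ?_
    rintro _ ⟨y, hy, rfl⟩
    rw [hPp]; exact hc y hy
  have uM : ∀ c, (∀ y ∈ J, b y - |y k| ≤ c) → signSup (absOutside K '' J) (flipAt k ξ) ≤ c := by
    intro c hc
    refine signSup_le (hJ.image _) ?_
    rintro _ ⟨y, hy, rfl⟩
    rw [hPm]; exact hc y hy
  have hd : 0 ≤ D * ζ k := mul_nonneg hD (hζ k)
  have := softPos_swap he (Ip := signSup I ξ) (Im := signSup I (flipAt k ξ)) hd (hζ k)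
    (Pm := signSup (absOutside K '' J) (flipAt k ξ))
    (Rm := signSup (absOutside (insert k K) '' J) (flipAt k ξ))
    (Pp := signSup (absOutside K '' J) ξ) (Rp := signSup (absOutside (insert k K) '' J) ξ)
    (uM _ fun y hy => (sub_le_sub_left (le_abs_self _) _).trans (lRm y hy))
    (uP _ fun y hy => by
      have h1 := lRp y hy
      have h2 := hJD y hy k
      have : |y k| ≤ y k + 2 * (D * ζ k) := abs_le.2 ⟨by linarith, by linarith⟩
      linarith)
    (by
      rw [← le_sub_iff_add_le]
      -- The exchange argument of contraction: if y_k ≥ 0, then y is used with the sign + and y'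
      -- with -; otherwise the roles are swapped.
      refine uP _ fun y hy => ?_
      rw [le_sub_comm]
      refine uM _ fun y' hy' => ?_
      rw [le_sub_iff_add_le]
      have a1 := lRp y hy
      have a2 := lRm y hy
      have a3 := lRp y' hy'
      have a4 := lRm y' hy'
      have a5 := le_abs_self (y' k)
      have a6 := neg_abs_le (y' k)
      rcases abs_cases (y k) with ⟨h, _⟩ | ⟨h, _⟩ <;> rw [h] <;> linarith)
    (uP _ fun y hy => by
      -- If y_k is negative, then |y_k| ≤ Dζ_k, so the values under the two signs differ by at most
      -- 2Dζ_k.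
      rcases abs_cases (y k) with ⟨h, _⟩ | ⟨h, h'⟩
      · rw [h]; exact (lRp y hy).trans (le_max_left _ _)
      · refine le_trans ?_ (le_max_right _ _)
        have h1 := lPm y hy
        have h2 := hJD y hy k
        rw [h] at h1 ⊢
        linarith)
    (by
      rw [sub_le_iff_le_add]
      refine signSup_le hI fun z hz => ?_
      have h1 := le_signSup hIζ ξ hz
      rw [signSum_eq_add k, hs] at h1
      rw [signSum_flipAt k, hs]
      have h2 := abs_le.1 (hIζ z hz k)
      linarith [h2.1])
  refine this.trans (le_of_eq ?_)
  ring

/-- Removing the absolute value from one coordinate at a time. -/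
lemma sum_softPos_insert_le {I J : Set (ι → ℝ)} (hI : I.Nonempty) (hJ : J.Nonempty) {ζ : ι → ℝ}
    {D e : ℝ} (hD : 0 ≤ D) (he : 0 < e) (hζ : ∀ i, 0 ≤ ζ i)
    (hIζ : ∀ z ∈ I, ∀ i, |z i| ≤ ζ i) (hJζ : ∀ y ∈ J, ∀ i, |y i| ≤ ζ i)
    (hJD : ∀ y ∈ J, ∀ i, -(D * ζ i) ≤ y i) (K : Finset ι) {k : ι} (hk : k ∉ K) :
    ∑ ξ, (signSup I ξ + softPos e (signSup (absOutside K '' J) ξ - signSup I ξ)) ≤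
    ∑ ξ, (signSup I ξ + softPos e (signSup (absOutside (insert k K) '' J) ξ - signSup I ξ))
      + 2 ^ Fintype.card ι * (D * (1 + D) * ζ k ^ 2 / e) := by
  -- The pair inequality is symmetric under the flip. Summed over all sign vectors it counts every
  -- pair twice.
  have hpair : ∀ (F G : (ι → Bool) → ℝ) (c : ℝ),
      (∀ ξ, ξ k = true → F ξ + F (flipAt k ξ) ≤ G ξ + G (flipAt k ξ) + 2 * c) →
      ∑ ξ, F ξ ≤ ∑ ξ, G ξ + 2 ^ Fintype.card ι * c := by
    intro F G c h
    have h' : ∀ ξ, F ξ + F (flipAt k ξ) ≤ G ξ + G (flipAt k ξ) + 2 * c := by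
      intro ξ
      rcases hξ : ξ k with _ | _
      · have h1 := h (flipAt k ξ) (by simp [flipAt, hξ])
        rw [flipAt_involutive k ξ] at h1
        linarith
      · exact h ξ hξ
    have h2 := Finset.sum_le_sum fun ξ (_ : ξ ∈ Finset.univ) => h' ξ
    simp only [Finset.sum_add_distrib, sum_flipAt, Finset.sum_const, Finset.card_univ,
      Fintype.card_fun, Fintype.card_bool, nsmul_eq_mul, Nat.cast_pow, Nat.cast_ofNat] at h2
    linarith
  exact hpair _ _ _ fun ξ hξ => softPos_pair_le hI hJ hD he hζ hIζ hJζ hJD K hk ξ hξ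

/-- The errors ζ_k² add up over the coordinates; e/4 is the price of returning from `softPos` to the
maximum. -/
lemma sum_max_signSup_abs_le_aux {I J : Set (ι → ℝ)} (hI : I.Nonempty) (hJ : J.Nonempty)
    {ζ : ι → ℝ} {D e : ℝ} (hD : 0 ≤ D) (he : 0 < e) (hζ : ∀ i, 0 ≤ ζ i)
    (hIζ : ∀ z ∈ I, ∀ i, |z i| ≤ ζ i) (hJζ : ∀ y ∈ J, ∀ i, |y i| ≤ ζ i)
    (hJD : ∀ y ∈ J, ∀ i, -(D * ζ i) ≤ y i) :
    ∑ ξ, max (signSup I ξ) (signSup ((fun y i => |y i|) '' J) ξ) ≤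
      ∑ ξ, max (signSup I ξ) (signSup J ξ)
        + 2 ^ Fintype.card ι * (D * (1 + D) * (∑ i, ζ i ^ 2) / e + e / 4) := by
  have key : ∀ K : Finset ι,
      ∑ ξ, (signSup I ξ + softPos e (signSup (absOutside ∅ '' J) ξ - signSup I ξ)) ≤
      ∑ ξ, (signSup I ξ + softPos e (signSup (absOutside K '' J) ξ - signSup I ξ))
        + 2 ^ Fintype.card ι * (D * (1 + D) * (∑ i ∈ K, ζ i ^ 2) / e) := by
    intro K
    induction K using Finset.induction_on with
    | empty => simp
    | insert k K hk ih =>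
      refine ih.trans ?_
      have := sum_softPos_insert_le hI hJ hD he hζ hIζ hJζ hJD K hk
      rw [Finset.sum_insert hk]
      refine (add_le_add_left this _).trans (le_of_eq ?_)
      ring
  have h0 : absOutside ∅ '' J = (fun y i => |y i|) '' J := by
    refine Set.image_congr fun y _ => ?_
    funext i; simp [absOutside]
  have h1 : absOutside Finset.univ '' J = J := by
    convert Set.image_id J using 1
    refine Set.image_congr fun y _ => ?_
    funext i; simp [absOutside]
  have hk := key Finset.univ
  rw [h0, h1] at hk
  have hl : ∑ ξ, max (signSup I ξ) (signSup ((fun y i => |y i|) '' J) ξ) ≤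
      ∑ ξ, (signSup I ξ + softPos e (signSup ((fun y i => |y i|) '' J) ξ - signSup I ξ)) := by
    refine Finset.sum_le_sum fun ξ _ => ?_
    have := max_zero_le_softPos he (signSup ((fun y i => |y i|) '' J) ξ - signSup I ξ)
    rw [max_le_iff] at this
    exact max_le (by linarith) (by linarith)
  have hr : ∑ ξ, (signSup I ξ + softPos e (signSup J ξ - signSup I ξ)) ≤
      ∑ ξ, (max (signSup I ξ) (signSup J ξ) + e / 4) := by
    refine Finset.sum_le_sum fun ξ _ => ?_
    have := softPos_le he (signSup J ξ - signSup I ξ)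
    have h2 : signSup I ξ + max 0 (signSup J ξ - signSup I ξ) = max (signSup I ξ) (signSup J ξ) := by
      rw [← max_add_add_left]; simp
    linarith
  rw [Finset.sum_add_distrib (g := fun _ => e / 4), Finset.sum_const, Finset.card_univ,
    Fintype.card_fun, Fintype.card_bool, nsmul_eq_mul] at hr
  push_cast at hr
  linarith

/-- Linearization of the absolute value for vectors which are almost nonnegative. -/
lemma sum_max_signSup_abs_le {I J : Set (ι → ℝ)} (hI : I.Nonempty) (hJ : J.Nonempty)
    {ζ : ι → ℝ} {D : ℝ} (hD : 0 < D) (hζ : ∀ i, 0 ≤ ζ i) (hs : 0 < ∑ i, ζ i ^ 2)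
    (hIζ : ∀ z ∈ I, ∀ i, |z i| ≤ ζ i) (hJζ : ∀ y ∈ J, ∀ i, |y i| ≤ ζ i)
    (hJD : ∀ y ∈ J, ∀ i, -(D * ζ i) ≤ y i) :
    ∑ ξ, max (signSup I ξ) (signSup ((fun y i => |y i|) '' J) ξ) ≤
      ∑ ξ, max (signSup I ξ) (signSup J ξ)
        + 2 ^ Fintype.card ι * (√(D * (1 + D)) * √(∑ i, ζ i ^ 2)) := by
  have h1 : 0 < D * (1 + D) := by positivity
  have h2 := Real.sqrt_pos.2 h1
  have h3 := Real.sqrt_pos.2 hs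
  refine (sum_max_signSup_abs_le_aux hI hJ hD.le
    -- This e balances the two error terms.
    (e := 2 * (√(D * (1 + D)) * √(∑ i, ζ i ^ 2))) (by positivity) hζ hIζ hJζ hJD).trans
    (le_of_eq ?_)
  congr 2
  have h4 := Real.sq_sqrt h1.le
  have h5 := Real.sq_sqrt hs.le
  generalize √(D * (1 + D)) = a at *
  generalize √(∑ i, ζ i ^ 2) = b at *
  rw [← h4, ← h5]
  field_simp
  ring

/-- Linearization of the absolute value for two-sided suprema. -/
lemma sum_abs_signSum_abs_le {I J I' : Set (ι → ℝ)} (hI : I.Nonempty) (hJ : J.Nonempty)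
    {ζ : ι → ℝ} {D : ℝ} (hD : 0 < D) (hζ : ∀ i, 0 ≤ ζ i) (hs : 0 < ∑ i, ζ i ^ 2)
    (hI' : ∀ z ∈ I', ∀ i, |z i| ≤ ζ i) (hsymm : ∀ z ∈ I, -z ∈ I) (hII' : I ⊆ I') (hJI' : J ⊆ I')
    (hJD : ∀ y ∈ J, ∀ i, -(D * ζ i) ≤ y i) {B : (ι → Bool) → ℝ}
    (hB : ∀ ξ, B ξ ≤ max (signSup I ξ) (max (signSup ((fun y i => |y i|) '' J) ξ)
      (signSup ((fun y i => |y i|) '' J) fun i => !ξ i))) :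
    ∑ ξ, B ξ ≤ 2 * ∑ ξ, signSup I' ξ - ∑ ξ, signSup I ξ
        + 2 ^ Fintype.card ι * (2 * √(D * (1 + D)) * √(∑ i, ζ i ^ 2)) := by
  set S : (ι → Bool) → ℝ := signSup ((fun y i => |y i|) '' J)
  -- max(a,s,s') ≤ max(a,s) + max(a,s') - a. As a is even in ξ, the two maxima have the same sum
  -- over all signs.
  have h1 : ∑ ξ, B ξ ≤ ∑ ξ, (max (signSup I ξ) (S ξ)
      + max (signSup I fun i => !ξ i) (S fun i => !ξ i) - signSup I ξ) := by
    refine Finset.sum_le_sum fun ξ _ => (hB ξ).trans ?_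
    rw [signSup_not hsymm]
    have a1 := le_max_left (signSup I ξ) (S ξ)
    have a2 := le_max_right (signSup I ξ) (S ξ)
    have a3 := le_max_left (signSup I ξ) (S fun i => !ξ i)
    have a4 := le_max_right (signSup I ξ) (S fun i => !ξ i)
    refine max_le ?_ (max_le ?_ ?_) <;> linarith
  rw [Finset.sum_sub_distrib, Finset.sum_add_distrib,
    sum_not (fun ξ => max (signSup I ξ) (S ξ))] at h1
  have h2 := sum_max_signSup_abs_le hI hJ hD hζ hs (fun z hz => hI' z (hII' hz))
    (fun z hz => hI' z (hJI' hz)) hJD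
  have h3 : ∑ ξ, max (signSup I ξ) (signSup J ξ) ≤ ∑ ξ, signSup I' ξ :=
    Finset.sum_le_sum fun ξ _ => max_le (signSup_mono hI hI' hII' ξ) (signSup_mono hJ hI' hJI' ξ)
  linarith

end Contraction

/-! ### Integrals against signed measures -/

lemma relu_eq (x : ℝ) : relu x = (x + |x|) / 2 := by
  unfold relu
  rcases abs_cases x with ⟨h, h'⟩ | ⟨h, h'⟩
  · rw [h, max_eq_left h']; ring
  · rw [h, max_eq_right h'.le]; ring

lemma relu_nonneg (x : ℝ) : 0 ≤ relu x := le_max_right _ _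

lemma continuous_relu : Continuous relu := continuous_id.max continuous_const

lemma abs_relu_sub_le (x y : ℝ) : |relu x - relu y| ≤ |x - y| := abs_max_sub_max_le_abs x y 0

lemma relu_mul {c : ℝ} (hc : 0 ≤ c) (x : ℝ) : relu (c * x) = c * relu x := by
  simp [relu, mul_max_of_nonneg _ _ hc]

section SignedIntegral

variable {S : Type*} [MeasurableSpace S]

lemma abs_signedIntegral_le (ρ : SignedMeasure S) {g : S → ℝ} {b : ℝ} (h : ∀ ω, |g ω| ≤ b) :
    |signedIntegral ρ g| ≤ tvNorm ρ * b := by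
  have hfin : IsFiniteMeasure ρ.variation := by
    rw [← SignedMeasure.totalVariation_eq_variation]; infer_instance
  -- On an empty space the bound b may be negative.
  rcases isEmpty_or_nonempty S with hS | ⟨⟨ω⟩⟩
  · have h0 : ρ = 0 := by ext s; simp [Subsingleton.elim s ∅]
    subst h0
    simp [signedIntegral, tvNorm, SignedMeasure.totalVariation_zero]
  have hb : 0 ≤ b := (abs_nonneg _).trans (h ω)
  have := VectorMeasure.norm_integral_le_of_norm_le_const (μ := ρ)
    (B := ContinuousLinearMap.lsmul ℝ ℝ) (Filter.Eventually.of_forall fun ω => h ω)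
  unfold signedIntegral tvNorm
  rw [SignedMeasure.totalVariation_eq_variation]
  refine this.trans ?_
  rw [mul_comm, Measure.real]
  refine mul_le_mul_of_nonneg_left ?_ ENNReal.toReal_nonneg
  exact mul_le_of_le_one_right hb ContinuousLinearMap.opNorm_lsmul_le

lemma integrable_variation [TopologicalSpace S] [CompactSpace S] [OpensMeasurableSpace S]
    (ρ : SignedMeasure S) {g : S → ℝ} (hg : Continuous g) : ρ.Integrable g := by
  have hfin : IsFiniteMeasure ρ.variation := by
    rw [← SignedMeasure.totalVariation_eq_variation]; infer_instance
  exact hg.integrable_of_hasCompactSupport (HasCompactSupport.of_compactSpace g)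

variable [TopologicalSpace S] [CompactSpace S] [OpensMeasurableSpace S]

lemma signedIntegral_sum (ρ : SignedMeasure S) {κ : Type*} (s : Finset κ) (c : κ → ℝ)
    {g : κ → S → ℝ} (hg : ∀ i, Continuous (g i)) :
    signedIntegral ρ (fun ω => ∑ i ∈ s, c i * g i ω) = ∑ i ∈ s, c i * signedIntegral ρ (g i) := by
  unfold signedIntegral
  have h1 : (fun ω => ∑ i ∈ s, c i * g i ω) = fun ω => ∑ i ∈ s, (c i • g i) ω := by
    funext ω; simp
  rw [h1, VectorMeasure.integral_finsetSum s
    (fun i _ => integrable_variation ρ ((hg i).const_smul (c i)))]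
  refine Finset.sum_congr rfl fun i _ => ?_
  rw [VectorMeasure.integral_smul, smul_eq_mul]

lemma signedIntegral_linear (ρ : SignedMeasure S) (a b : ℝ) {g h : S → ℝ} (hg : Continuous g)
    (hh : Continuous h) :
    signedIntegral ρ (fun ω => a * g ω + b * h ω)
      = a * signedIntegral ρ g + b * signedIntegral ρ h := by
  have := signedIntegral_sum ρ Finset.univ ![a, b] (g := ![g, h])
    (by intro i; fin_cases i <;> assumption)
  simpa using this

end SignedIntegral

/-! ### Grönwall's inequality with variable coefficients -/

lemma norm_le_of_linear_comparison {E : Type*} [NormedAddCommGroup E] [NormedSpace ℝ E]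
    {f f' : ℝ → E} {φ k c : ℝ → ℝ} {a b : ℝ} (hk : Continuous k)
    (hf : ∀ τ ∈ Icc a b, HasDerivWithinAt f (f' τ) (Icc a b) τ)
    (hφ : ∀ τ, HasDerivAt φ (k τ * φ τ + c τ) τ)
    (hb : ∀ τ ∈ Icc a b, ‖f' τ‖ ≤ k τ * ‖f τ‖ + c τ) (ha : ‖f a‖ ≤ φ a) :
    ∀ τ ∈ Icc a b, ‖f τ‖ ≤ φ τ := by
  obtain ⟨K, hK⟩ := (isCompact_Icc (a := a) (b := b)).exists_bound_of_continuousOn hk.continuousOn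
  -- The added exponential has rate K + 1 > k, so the perturbed φ is a strict supersolution that ‖f‖
  -- cannot cross.
  have main : ∀ ε > 0, ∀ τ ∈ Icc a b, ‖f τ‖ ≤ φ τ + ε * Real.exp ((K + 1) * (τ - a)) := by
    intro ε hε
    have hderiv : ∀ τ, HasDerivAt (fun τ => φ τ + ε * Real.exp ((K + 1) * (τ - a)))
        (k τ * φ τ + c τ + ε * (Real.exp ((K + 1) * (τ - a)) * ((K + 1) * 1))) τ := fun τ =>
      (hφ τ).add (((((hasDerivAt_id τ).sub_const a).const_mul (K + 1)).exp).const_mul ε)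
    refine image_norm_le_of_norm_deriv_right_lt_deriv_boundary' (f' := f')
      (fun τ hτ => (hf τ hτ).continuousWithinAt) (fun τ hτ => ?_) ?_
      (fun τ _ => (hderiv τ).continuousAt.continuousWithinAt)
      (fun τ _ => (hderiv τ).hasDerivWithinAt) (fun τ hτ h => ?_)
    · exact (hf τ (Ico_subset_Icc_self hτ)).mono_of_mem_nhdsWithin
        (Icc_mem_nhdsGE_of_mem hτ)
    · simp only [sub_self, mul_zero, Real.exp_zero, mul_one]
      linarith
    · refine (hb τ (Ico_subset_Icc_self hτ)).trans_lt ?_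
      rw [h]
      have h1 := (le_abs_self _).trans (hK τ (Ico_subset_Icc_self hτ))
      have h2 := mul_pos hε (Real.exp_pos ((K + 1) * (τ - a)))
      nlinarith
  intro τ hτ
  refine le_of_forall_pos_le_add fun δ hδ => ?_
  have hE := Real.exp_pos ((K + 1) * (τ - a))
  have := main (δ / Real.exp ((K + 1) * (τ - a))) (by positivity) τ hτ
  rwa [div_mul_cancel₀ _ hE.ne'] at this

/-! ### Two-point estimates -/

/-- Weighted Cauchy–Schwarz; the hypothesis says α²/R + β²/M ≤ 4. -/
lemma sq_add_mul_le {α β a b R M : ℝ} (hR : 0 < R) (hM : 0 < M)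
    (h : α ^ 2 * M + β ^ 2 * R ≤ 4 * R * M) :
    (α * a + β * b) ^ 2 ≤ 4 * (R * a ^ 2 + M * b ^ 2) := by
  have h1 : (α * a + β * b) ^ 2 * (R * M) ≤ 4 * (R * a ^ 2 + M * b ^ 2) * (R * M) := by
    have h2 : (α * a + β * b) ^ 2 * (R * M) ≤ (α ^ 2 * M + β ^ 2 * R) * (a ^ 2 * R + b ^ 2 * M) := by
      nlinarith [sq_nonneg (α * M * b - β * R * a)]
    refine h2.trans ((mul_le_mul_of_nonneg_right h (by positivity)).trans (le_of_eq ?_))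
    ring
  exact le_of_mul_le_mul_right h1 (by positivity)

/-- The pair `(relu (A + B), relu (A - B))` for `(A, B)` in an ellipse. -/
lemma relu_pair_ellipse {A B R M : ℝ} (hR : 0 < R) (hRM : R ≤ M)
    (h : A ^ 2 * R + B ^ 2 * M ≤ R * M) :
    (relu (A + B) - relu (A - B)) ^ 2 * M + (relu (A + B) + relu (A - B)) ^ 2 * R
      ≤ 4 * R * M := by
  have hM : 0 < M := hR.trans_le hRM
  unfold relu
  -- If both terms are positive, the claim is four times the hypothesis. If only one is, then B² ≥
  -- A², and the slack is 2(M-R)(B²-A²) + (M+R)(B∓A)², which is where R ≤ M enters.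
  rcases max_cases (A + B) 0 with ⟨h1, h1'⟩ | ⟨h1, h1'⟩ <;>
  rcases max_cases (A - B) 0 with ⟨h2, h2'⟩ | ⟨h2, h2'⟩ <;> rw [h1, h2]
  · nlinarith
  · nlinarith [mul_nonneg (sub_nonneg.2 hRM) (mul_nonneg (sub_nonneg.2 h2'.le) h1'),
      mul_nonneg (add_pos hR hM).le (sq_nonneg (B - A))]
  · nlinarith [mul_nonneg (sub_nonneg.2 hRM) (mul_nonneg h2' (neg_nonneg.2 h1'.le)),
      mul_nonneg (add_pos hR hM).le (sq_nonneg (B + A))]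
  · have : 0 ≤ 4 * R * M := by positivity
    simpa using this

section TwoPoint

variable {E : Type*} [NormedAddCommGroup E] [InnerProductSpace ℝ E]

local notation "⟪" x ", " y "⟫" => inner ℝ x y

/-- Bessel's inequality for two orthogonal vectors. -/
lemma inner_sq_mul_add_le {m r ω : E} (hω : ‖ω‖ = 1) (hmr : ⟪m, r⟫ = 0) :
    ⟪ω, m⟫ ^ 2 * ‖r‖ ^ 2 + ⟪ω, r⟫ ^ 2 * ‖m‖ ^ 2 ≤ ‖r‖ ^ 2 * ‖m‖ ^ 2 := by
  set A := ⟪ω, m⟫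
  set B := ⟪ω, r⟫
  -- A test vector with ⟨ω,u⟩ = Q and ‖u‖² = Q‖r‖²‖m‖², to which Cauchy–Schwarz is applied.
  set u : E := (A * ‖r‖ ^ 2) • m + (B * ‖m‖ ^ 2) • r
  set Q := A ^ 2 * ‖r‖ ^ 2 + B ^ 2 * ‖m‖ ^ 2
  have h1 : ⟪ω, u⟫ = Q := by
    simp only [u, inner_add_right, inner_smul_right]; ring
  have h2 : ‖u‖ ^ 2 = Q * (‖r‖ ^ 2 * ‖m‖ ^ 2) := by
    rw [← real_inner_self_eq_norm_sq]
    simp only [u, inner_add_right, inner_add_left, inner_smul_right, inner_smul_left,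
      real_inner_self_eq_norm_sq, hmr, real_inner_comm m r, RCLike.conj_to_real]
    ring
  have h3 : Q ^ 2 ≤ Q * (‖r‖ ^ 2 * ‖m‖ ^ 2) := by
    rw [← h2, ← h1]
    have := abs_real_inner_le_norm ω u
    rw [hω, one_mul] at this
    exact sq_le_sq.2 (by rwa [abs_of_nonneg (norm_nonneg u)])
  rcases (show 0 ≤ Q by positivity).eq_or_lt with h | h
  · rw [← h]; positivity
  · nlinarith

/-- If A and B are the positive parts, then A² + B² = ⟨ω, A•G + B•G'⟩. As the angle is not acute,
that vector has squared norm at most (A²+B²)p. -/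
lemma relu_sq_add_relu_sq_le {G G' ω : E} {p : ℝ} (hω : ‖ω‖ = 1) (hG : ‖G‖ ^ 2 = p)
    (hG' : ‖G'‖ ^ 2 = p) (hc : ⟪G, G'⟫ ≤ 0) :
    relu ⟪ω, G⟫ ^ 2 + relu ⟪ω, G'⟫ ^ 2 ≤ p := by
  have h1 : ∀ x : E, ⟪ω, x⟫ ^ 2 ≤ ‖x‖ ^ 2 := fun x => by
    have := abs_real_inner_le_norm ω x
    rw [hω, one_mul] at this
    exact sq_le_sq.2 (by rwa [abs_of_nonneg (norm_nonneg x)])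
  have hG1 := h1 G
  have hG1' := h1 G'
  have hp : 0 ≤ p := hG ▸ sq_nonneg _
  unfold relu
  rcases max_cases ⟪ω, G⟫ 0 with ⟨h2, h2'⟩ | ⟨h2, h2'⟩ <;>
  rcases max_cases ⟪ω, G'⟫ 0 with ⟨h3, h3'⟩ | ⟨h3, h3'⟩ <;> rw [h2, h3]
  · have h4 := h1 (⟪ω, G⟫ • G + ⟪ω, G'⟫ • G')
    rw [← real_inner_self_eq_norm_sq] at h4
    simp only [inner_add_right, inner_add_left, inner_smul_right, inner_smul_left,
      real_inner_self_eq_norm_sq, real_inner_comm G G', RCLike.conj_to_real, hG, hG'] at h4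
    set A := ⟪ω, G⟫
    set B := ⟪ω, G'⟫
    have h5 : A * B * ⟪G, G'⟫ ≤ 0 := mul_nonpos_of_nonneg_of_nonpos (mul_nonneg h2' h3') hc
    have h6 : (A ^ 2 + B ^ 2) ^ 2 ≤ (A ^ 2 + B ^ 2) * p := by
      nlinarith
    rcases (show 0 ≤ A ^ 2 + B ^ 2 by positivity).eq_or_lt with h | h
    · rw [← h]; exact hp
    · nlinarith
  · simpa using hG1.trans_eq hG
  · simpa using hG1'.trans_eq hG'
  · simpa using hp

end TwoPoint

/-! ### The two-point functional (‖g‖‖g'‖)²(‖g‖‖g'‖ - ⟨g,g'⟩) -/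

section Coordinates

variable {D : ℕ}

local notation "⟪" x ", " y "⟫" => inner ℝ x y

lemma Eucl.norm_sq_eq (x : Eucl D) : ‖x‖ ^ 2 = ∑ j, x j ^ 2 := by
  simp [EuclideanSpace.norm_sq_eq]

/-- The integrand of the derivative of the two-point functional, for vectors of equal norm. -/
lemma exists_bound_two_point_of_norm_eq (G G' : Eucl D) {p c : ℝ} (hG : ‖G‖ ^ 2 = p)
    (hG' : ‖G'‖ ^ 2 = p) (hc : ⟪G, G'⟫ = c) :
    ∃ b : Fin D → ℝ, (∀ j, 0 ≤ b j) ∧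
      (∀ ω : Eucl D, ‖ω‖ = 1 → ∀ j,
        |relu ⟪ω, G⟫ * ((3 * p - 2 * c) * G j - p * G' j)
          + relu ⟪ω, G'⟫ * ((3 * p - 2 * c) * G' j - p * G j)| ≤ b j) ∧
      ∑ j, b j ^ 2 ≤ 20 * (p * (p - c)) ^ 2 := by
  set m : Eucl D := (1 / 2 : ℝ) • (G + G') with hm
  set r : Eucl D := (1 / 2 : ℝ) • (G - G') with hr
  have hp : 0 ≤ p := hG ▸ sq_nonneg _
  have hGm : G = m + r := by rw [hm, hr]; module
  have hGm' : G' = m - r := by rw [hm, hr]; module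
  have hmr : ⟪m, r⟫ = 0 := by
    simp only [hm, hr, inner_smul_left, inner_smul_right, inner_add_left, inner_sub_right,
      real_inner_self_eq_norm_sq, hG, hG', real_inner_comm G G', RCLike.conj_to_real]
    ring
  have hM : ‖m‖ ^ 2 = (p + c) / 2 := by
    rw [hm, norm_smul, mul_pow, norm_add_sq_real, hG, hG', hc]; norm_num; ring
  have hR : ‖r‖ ^ 2 = (p - c) / 2 := by
    rw [hr, norm_smul, mul_pow, norm_sub_sq_real, hG, hG', hc]; norm_num; ring
  set q := p - c with hq
  have hq0 : 0 ≤ q := by nlinarith [sq_nonneg ‖r‖]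
  -- In the orthogonal vectors m and r, the difference of the activations multiplies r and their sum
  -- multiplies m.
  have hW : ∀ (s s' : ℝ) (j : Fin D),
      s * ((3 * p - 2 * c) * G j - p * G' j) + s' * ((3 * p - 2 * c) * G' j - p * G j)
        = (s - s') * (2 * (p + q) * r j) + (s + s') * (2 * q * m j) := by
    intro s s' j
    rw [hGm, hGm', hq]
    simp only [PiLp.add_apply, PiLp.sub_apply]
    ring
  have hsum : ∀ R M : ℝ, ∑ j, (R * (2 * (p + q) * r j) ^ 2 + M * (2 * q * m j) ^ 2)
      = 4 * (p + q) ^ 2 * R * ‖r‖ ^ 2 + 4 * q ^ 2 * M * ‖m‖ ^ 2 := by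
    intro R M
    rw [Eucl.norm_sq_eq, Eucl.norm_sq_eq, Finset.mul_sum, Finset.mul_sum,
      ← Finset.sum_add_distrib]
    exact Finset.sum_congr rfl fun j _ => by ring
  rcases hq0.eq_or_lt with h0 | hqpos
  · refine ⟨0, fun _ => le_rfl, fun ω _ j => ?_, by simp [← h0]⟩
    have hr0 : r = 0 := by
      rw [← norm_eq_zero, ← sq_eq_zero_iff, hR, ← h0, zero_div]
    rw [hW, ← h0, hr0]
    simp
  -- Acute or right angle against obtuse angle. The sums of squares are 4q²(5p²-2pq+2q²) and
  -- 4p²q(p+4q) respectively; both are at most 20p²q² and equal it at q = p.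
  rcases le_or_gt q p with hqp | hqp
  · have hRpos : 0 < ‖r‖ ^ 2 := by rw [hR]; linarith
    have hRM : ‖r‖ ^ 2 ≤ ‖m‖ ^ 2 := by rw [hR, hM]; linarith
    refine ⟨fun j => √(4 * (‖r‖ ^ 2 * (2 * (p + q) * r j) ^ 2 + ‖m‖ ^ 2 * (2 * q * m j) ^ 2)),
      fun j => Real.sqrt_nonneg _, fun ω hω j => ?_, ?_⟩
    · rw [hW]
      refine Real.abs_le_sqrt (sq_add_mul_le hRpos (hRpos.trans_le hRM) ?_)
      have h1 := inner_sq_mul_add_le hω hmr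
      have h2 := relu_pair_ellipse hRpos hRM h1
      rwa [← inner_add_right, ← inner_sub_right, ← hGm, ← hGm'] at h2
    · simp_rw [Real.sq_sqrt (show 0 ≤ 4 * (‖r‖ ^ 2 * (2 * (p + q) * r _) ^ 2
        + ‖m‖ ^ 2 * (2 * q * m _) ^ 2) by positivity)]
      rw [← Finset.mul_sum, hsum, hR, hM, show c = p - q by rw [hq]; ring]
      nlinarith [mul_nonneg (sq_nonneg q) (mul_nonneg hqpos.le (sub_nonneg.2 hqp))]
  · refine ⟨fun j => √(2 * p * ((2 * (p + q) * r j) ^ 2 + (2 * q * m j) ^ 2)),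
      fun j => Real.sqrt_nonneg _, fun ω hω j => ?_, ?_⟩
    · rw [hW]
      refine Real.abs_le_sqrt ?_
      have h1 := relu_sq_add_relu_sq_le hω hG hG' (by rw [hc]; linarith)
      set s := relu ⟪ω, G⟫
      set s' := relu ⟪ω, G'⟫
      set a := 2 * (p + q) * r j
      set b := 2 * q * m j
      have h2 : ((s - s') * a + (s + s') * b) ^ 2 ≤ 2 * (s ^ 2 + s' ^ 2) * (a ^ 2 + b ^ 2) := by
        nlinarith [sq_nonneg ((s - s') * b - (s + s') * a)]
      refine h2.trans ?_
      gcongr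
    · simp_rw [Real.sq_sqrt (show 0 ≤ 2 * p * ((2 * (p + q) * r _) ^ 2
        + (2 * q * m _) ^ 2) by positivity)]
      have := hsum 1 1
      simp only [one_mul, mul_one] at this
      rw [← Finset.mul_sum, this, hR, hM, show c = p - q by rw [hq]; ring]
      nlinarith [mul_nonneg (mul_nonneg (sq_nonneg p) hqpos.le) (sub_nonneg.2 hqp.le)]

/-- The integrand of the derivative of the two-point functional. -/
lemma exists_bound_two_point (g g' : Eucl D) :
    ∃ b : Fin D → ℝ, (∀ j, 0 ≤ b j) ∧
      (∀ ω : Eucl D, ‖ω‖ = 1 → ∀ j,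
        |relu ⟪ω, g⟫ * (‖g'‖ ^ 2 * (3 * (‖g‖ * ‖g'‖) - 2 * ⟪g, g'⟫) * g j
            - (‖g‖ * ‖g'‖) ^ 2 * g' j)
          + relu ⟪ω, g'⟫ * (‖g‖ ^ 2 * (3 * (‖g‖ * ‖g'‖) - 2 * ⟪g, g'⟫) * g' j
            - (‖g‖ * ‖g'‖) ^ 2 * g j)| ≤ b j) ∧
      ∑ j, b j ^ 2 ≤ 20 * ((‖g‖ * ‖g'‖) ^ 2 * (‖g‖ * ‖g'‖ - ⟪g, g'⟫)) ^ 2 := by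
  rcases eq_or_ne g 0 with rfl | hg
  · exact ⟨0, fun _ => le_rfl, fun ω _ j => by simp, by simp⟩
  rcases eq_or_ne g' 0 with rfl | hg'
  · exact ⟨0, fun _ => le_rfl, fun ω _ j => by simp, by simp⟩
  have h1 : 0 < ‖g‖ := norm_pos_iff.2 hg
  have h2 : 0 < ‖g'‖ := norm_pos_iff.2 hg'
  -- Scaling g by l and g' by 1/l equalizes the norms and keeps ‖g‖‖g'‖ and ⟨g,g'⟩; σ is positively
  -- homogeneous.
  set l := √(‖g'‖ / ‖g‖) with hl
  have hlpos : 0 < l := Real.sqrt_pos.2 (by positivity)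
  have hl2 : l ^ 2 = ‖g'‖ / ‖g‖ := Real.sq_sqrt (by positivity)
  obtain ⟨b, hb0, hb, hbs⟩ := exists_bound_two_point_of_norm_eq (l • g) (l⁻¹ • g')
    (p := ‖g‖ * ‖g'‖) (c := ⟪g, g'⟫)
    (by rw [norm_smul, mul_pow, Real.norm_eq_abs, sq_abs, hl2]; field_simp)
    (by rw [norm_smul, mul_pow, Real.norm_eq_abs, sq_abs, inv_pow, hl2]; field_simp)
    (by rw [inner_smul_left, inner_smul_right]; simp [hlpos.ne'])
  refine ⟨fun j => ‖g‖ * ‖g'‖ * b j, fun j => mul_nonneg (by positivity) (hb0 j),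
    fun ω hω j => ?_, ?_⟩
  · refine le_trans (le_of_eq ?_) (mul_le_mul_of_nonneg_left (hb ω hω j) (by positivity))
    rw [← abs_of_nonneg (show 0 ≤ ‖g‖ * ‖g'‖ by positivity), ← abs_mul,
      abs_of_nonneg (show 0 ≤ ‖g‖ * ‖g'‖ by positivity), inner_smul_right, inner_smul_right,
      relu_mul hlpos.le, relu_mul (inv_pos.2 hlpos).le]
    congr 1
    simp only [PiLp.smul_apply, smul_eq_mul]
    have e1 : ‖g'‖ ^ 2 = ‖g‖ * ‖g'‖ * l ^ 2 := by rw [hl2]; field_simp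
    have e2 : ‖g‖ ^ 2 = ‖g‖ * ‖g'‖ * (l ^ 2)⁻¹ := by rw [hl2]; field_simp
    rw [e1, e2]
    generalize ‖g‖ * ‖g'‖ = P
    field_simp
  · simp_rw [mul_pow]
    rw [← Finset.mul_sum]
    nlinarith [mul_le_mul_of_nonneg_left hbs (sq_nonneg (‖g‖ * ‖g'‖))]

end Coordinates

/-! ### Flows -/

namespace FlowField

variable {D : ℕ} (ρ : FlowField D)

/-- The speed, extended continuously from `[0,1]` to the real line. -/
def extSpeed : ℝ → ℝ := IccExtend (zero_le_one' ℝ) fun t => ρ.speed t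

/-- The accumulated speed `∫₀^τ Λ(ρ, s) ds`. -/
def arc (τ : ℝ) : ℝ := ∫ s in (0 : ℝ)..τ, ρ.extSpeed s

lemma speed_nonneg (τ : ℝ) : 0 ≤ ρ.speed τ := Real.sqrt_nonneg _

lemma extSpeed_nonneg (τ : ℝ) : 0 ≤ ρ.extSpeed τ := ρ.speed_nonneg _

lemma extSpeed_eq {τ : ℝ} (hτ : τ ∈ Icc (0 : ℝ) 1) : ρ.extSpeed τ = ρ.speed τ :=
  IccExtend_of_mem _ _ hτ

@[simp] lemma arc_zero : ρ.arc 0 = 0 := intervalIntegral.integral_same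

lemma arc_one : ρ.arc 1 = ∫ τ in (0 : ℝ)..1, ρ.speed τ := by
  refine intervalIntegral.integral_congr fun τ hτ => ?_
  rw [uIcc_of_le zero_le_one] at hτ
  exact ρ.extSpeed_eq hτ

variable {ρ}

lemma continuous_extSpeed (hρ : ContinuousOn ρ.speed (Icc 0 1)) : Continuous ρ.extSpeed :=
  hρ.domRestrict.Icc_extend'

lemma hasDerivAt_arc (hρ : ContinuousOn ρ.speed (Icc 0 1)) (τ : ℝ) :
    HasDerivAt ρ.arc (ρ.extSpeed τ) τ :=
  (continuous_extSpeed hρ).integral_hasStrictDerivAt 0 τ |>.hasDerivAt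

lemma monotone_arc (hρ : ContinuousOn ρ.speed (Icc 0 1)) : Monotone ρ.arc :=
  monotone_of_hasDerivAt_nonneg (hasDerivAt_arc hρ) fun τ => ρ.extSpeed_nonneg τ

lemma arc_nonneg (hρ : ContinuousOn ρ.speed (Icc 0 1)) {τ : ℝ} (hτ : 0 ≤ τ) : 0 ≤ ρ.arc τ := by
  simpa using monotone_arc hρ hτ

lemma sum_tvNorm_mul_le (τ : ℝ) (b : Fin D → ℝ) :
    ∑ j, tvNorm (ρ τ j) * b j ≤ ρ.speed τ * √(∑ j, b j ^ 2) :=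
  Real.sum_mul_le_sqrt_mul_sqrt _ _ _

lemma norm_le_speed_mul {τ b : ℝ} (hb : 0 ≤ b) {v : Eucl D}
    (hv : ∀ j, |v j| ≤ tvNorm (ρ τ j) * b) : ‖v‖ ≤ ρ.speed τ * b := by
  rw [EuclideanSpace.norm_eq, speed, ← Real.sqrt_sq hb, ← Real.sqrt_mul (by positivity),
    Finset.sum_mul]
  refine Real.sqrt_le_sqrt (Finset.sum_le_sum fun j _ => ?_)
  rw [Real.norm_eq_abs, ← mul_pow]
  exact pow_le_pow_left₀ (abs_nonneg _) (hv j) 2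

lemma continuous_relu_inner (z : Eucl D) :
    Continuous fun ω : FlowSphere D => relu (inner ℝ (ω : Eucl D) z) :=
  continuous_relu.comp (continuous_subtype_val.inner continuous_const)

lemma norm_coe_sphere (ω : FlowSphere D) : ‖(ω : Eucl D)‖ = 1 := by simp

lemma abs_inner_sphere_le (ω : FlowSphere D) (z : Eucl D) : |inner ℝ (ω : Eucl D) z| ≤ ‖z‖ := by
  simpa [norm_coe_sphere ω] using abs_real_inner_le_norm (ω : Eucl D) z

lemma sum_mul_velocity {ι : Type*} [Fintype ι] (τ : ℝ) (c : ι → ℝ) (Z : ι → Eucl D) (j : Fin D) :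
    ∑ i, c i * ρ.velocity τ (Z i) j
      = signedIntegral (ρ τ j) (fun ω => ∑ i, c i * relu (inner ℝ (ω : Eucl D) (Z i))) := by
  rw [signedIntegral_sum _ _ _ fun i => continuous_relu_inner (Z i)]
  rfl

lemma norm_velocity_le (τ : ℝ) (z : Eucl D) : ‖ρ.velocity τ z‖ ≤ ρ.speed τ * ‖z‖ := by
  refine norm_le_speed_mul (norm_nonneg _) fun j => ?_
  refine abs_signedIntegral_le _ fun ω => ?_
  rw [abs_of_nonneg (relu_nonneg _)]
  exact max_le ((le_abs_self _).trans (abs_inner_sphere_le ω z)) (norm_nonneg _)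

variable {z z' : Eucl D} {Z Z' : ℝ → Eucl D}

lemma IsSolution.norm_le (hρ : ContinuousOn ρ.speed (Icc 0 1)) (hZ : ρ.IsSolution z Z) {τ : ℝ}
    (hτ : τ ∈ Icc (0 : ℝ) 1) : ‖Z τ‖ ≤ Real.exp (ρ.arc τ) * ‖z‖ := by
  refine norm_le_of_linear_comparison (c := fun _ => 0) (continuous_extSpeed hρ) hZ.2
    (φ := fun τ => Real.exp (ρ.arc τ) * ‖z‖) (fun τ => ?_) (fun τ hτ => ?_) ?_ τ hτ
  · refine (((hasDerivAt_arc hρ τ).exp).mul_const ‖z‖).congr_deriv ?_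
    ring
  · simpa [ρ.extSpeed_eq hτ] using norm_velocity_le τ (Z τ)
  · simp [hZ.1]

/-- The left side is the derivative of the two-point functional along the flow. In each coordinate
the integrand has a bound uniform in ω; Cauchy–Schwarz against the total variations gives √20 ≤ 9/2.
-/
lemma abs_two_point_deriv_le (τ : ℝ) (g g' : Eucl D) :
    |inner ℝ (ρ.velocity τ g) ((‖g'‖ ^ 2 * (3 * (‖g‖ * ‖g'‖) - 2 * inner ℝ g g')) • g
        - (‖g‖ * ‖g'‖) ^ 2 • g')
      + inner ℝ (ρ.velocity τ g') ((‖g‖ ^ 2 * (3 * (‖g‖ * ‖g'‖) - 2 * inner ℝ g g')) • g'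
        - (‖g‖ * ‖g'‖) ^ 2 • g)|
      ≤ ρ.speed τ * (9 / 2 * ((‖g‖ * ‖g'‖) ^ 2 * (‖g‖ * ‖g'‖ - inner ℝ g g'))) := by
  obtain ⟨b, hb0, hb, hbs⟩ := exists_bound_two_point g g'
  set c := (inner ℝ g g' : ℝ)
  have hN : 0 ≤ (‖g‖ * ‖g'‖) ^ 2 * (‖g‖ * ‖g'‖ - c) :=
    mul_nonneg (sq_nonneg _) (sub_nonneg.2 (real_inner_le_norm g g'))
  have h1 : ∑ j, tvNorm (ρ τ j) * b j
      ≤ ρ.speed τ * (9 / 2 * ((‖g‖ * ‖g'‖) ^ 2 * (‖g‖ * ‖g'‖ - c))) := by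
    refine (sum_tvNorm_mul_le τ b).trans (mul_le_mul_of_nonneg_left ?_ (ρ.speed_nonneg τ))
    rw [Real.sqrt_le_left (by positivity)]
    exact hbs.trans (by nlinarith [sq_nonneg ((‖g‖ * ‖g'‖) ^ 2 * (‖g‖ * ‖g'‖ - c))])
  refine le_trans ?_ h1
  rw [PiLp.inner_apply, PiLp.inner_apply, ← Finset.sum_add_distrib]
  refine (Finset.abs_sum_le_sum_abs _ _).trans (Finset.sum_le_sum fun j _ => ?_)
  have h2 := signedIntegral_linear (ρ τ j)
    (‖g'‖ ^ 2 * (3 * (‖g‖ * ‖g'‖) - 2 * c) * g j - (‖g‖ * ‖g'‖) ^ 2 * g' j)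
    (‖g‖ ^ 2 * (3 * (‖g‖ * ‖g'‖) - 2 * c) * g' j - (‖g‖ * ‖g'‖) ^ 2 * g j)
    (continuous_relu_inner g) (continuous_relu_inner g')
  have h3 := abs_signedIntegral_le (ρ τ j) (b := b j) (g := fun ω : FlowSphere D =>
    (‖g'‖ ^ 2 * (3 * (‖g‖ * ‖g'‖) - 2 * c) * g j - (‖g‖ * ‖g'‖) ^ 2 * g' j)
      * relu (inner ℝ (ω : Eucl D) g)
    + (‖g‖ ^ 2 * (3 * (‖g‖ * ‖g'‖) - 2 * c) * g' j - (‖g‖ * ‖g'‖) ^ 2 * g j)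
      * relu (inner ℝ (ω : Eucl D) g'))
    (fun ω => by
      refine le_of_eq_of_le ?_ (hb ω (norm_coe_sphere ω) j)
      congr 1; ring)
  rw [h2] at h3
  refine le_of_eq_of_le ?_ h3
  simp only [velocity, PiLp.sub_apply, PiLp.smul_apply, smul_eq_mul, RCLike.inner_apply,
    conj_trivial]

/-- The angle between two trajectories of a ReLU flow. -/
lemma IsSolution.norm_mul_norm_sub_inner_le (hρ : ContinuousOn ρ.speed (Icc 0 1))
    (hZ : ρ.IsSolution z Z) (hZ' : ρ.IsSolution z' Z') {τ : ℝ} (hτ : τ ∈ Icc (0 : ℝ) 1) :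
    ‖Z τ‖ * ‖Z' τ‖ - inner ℝ (Z τ) (Z' τ)
      ≤ 2 * Real.exp (3 / 2 * ρ.arc τ) * (‖z‖ * ‖z'‖) := by
  -- The cube of ‖Z‖‖Z'‖ is written as a 3/2 power of a product of squared norms, which is
  -- differentiable even where a trajectory vanishes.
  set N : ℝ → ℝ := fun τ => (‖Z τ‖ ^ 2 * ‖Z' τ‖ ^ 2) ^ (3 / 2 : ℝ)
    - ‖Z τ‖ ^ 2 * ‖Z' τ‖ ^ 2 * inner ℝ (Z τ) (Z' τ) with hN
  have hsqrt : ∀ a b : ℝ, 0 ≤ a → 0 ≤ b → (a ^ 2 * b ^ 2) ^ (1 / 2 : ℝ) = a * b := by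
    intro a b ha hb
    rw [← mul_pow, ← Real.sqrt_eq_rpow, Real.sqrt_sq (mul_nonneg ha hb)]
  have hcube : ∀ a b : ℝ, 0 ≤ a → 0 ≤ b → (a ^ 2 * b ^ 2) ^ (3 / 2 : ℝ) = (a * b) ^ 3 := by
    intro a b ha hb
    rw [show (3 / 2 : ℝ) = 1 / 2 * (3 : ℕ) by norm_num, Real.rpow_mul (by positivity),
      hsqrt a b ha hb, Real.rpow_natCast]
  have hN' : ∀ τ, N τ = (‖Z τ‖ * ‖Z' τ‖) ^ 2 * (‖Z τ‖ * ‖Z' τ‖ - inner ℝ (Z τ) (Z' τ)) := by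
    intro τ
    simp only [hN]
    rw [hcube _ _ (norm_nonneg _) (norm_nonneg _)]; ring
  have hN0 : ∀ τ, 0 ≤ N τ := fun τ => by
    rw [hN']
    exact mul_nonneg (sq_nonneg _) (sub_nonneg.2 (real_inner_le_norm _ _))
  have hderiv : ∀ τ ∈ Icc (0 : ℝ) 1, HasDerivWithinAt N
      (inner ℝ (ρ.velocity τ (Z τ)) ((‖Z' τ‖ ^ 2 * (3 * (‖Z τ‖ * ‖Z' τ‖)
          - 2 * inner ℝ (Z τ) (Z' τ))) • Z τ - (‖Z τ‖ * ‖Z' τ‖) ^ 2 • Z' τ)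
        + inner ℝ (ρ.velocity τ (Z' τ)) ((‖Z τ‖ ^ 2 * (3 * (‖Z τ‖ * ‖Z' τ‖)
          - 2 * inner ℝ (Z τ) (Z' τ))) • Z' τ - (‖Z τ‖ * ‖Z' τ‖) ^ 2 • Z τ)) (Icc 0 1) τ := by
    intro τ hτ
    have h1 := (hZ.2 τ hτ).norm_sq
    have h2 := (hZ'.2 τ hτ).norm_sq
    have h3 := (hZ.2 τ hτ).inner ℝ (hZ'.2 τ hτ)
    have h4 := h1.mul h2
    have h5 := (h4.rpow_const (p := 3 / 2) (Or.inr (by norm_num))).sub (h4.mul h3)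
    refine h5.congr_deriv ?_
    simp only [Pi.mul_apply]
    rw [show (3 / 2 - 1 : ℝ) = 1 / 2 by norm_num, hsqrt _ _ (norm_nonneg _) (norm_nonneg _)]
    simp only [inner_sub_right, inner_smul_right, real_inner_comm (ρ.velocity τ (Z τ)),
      real_inner_comm (ρ.velocity τ (Z' τ))]
    ring
  have hmain := norm_le_of_linear_comparison (c := fun _ => 0) ((continuous_extSpeed hρ).const_mul (9 / 2))
    hderiv (φ := fun τ => Real.exp (9 / 2 * ρ.arc τ) * (2 * (‖z‖ * ‖z'‖) ^ 3)) (fun τ => ?_)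
    (fun τ hτ => ?_) ?_ τ hτ
  · set P := ‖Z τ‖ * ‖Z' τ‖
    set q := P - inner ℝ (Z τ) (Z' τ) with hq
    have hq0 : 0 ≤ q := sub_nonneg.2 (real_inner_le_norm _ _)
    have hqP : q ≤ 2 * P := by
      have := neg_le_of_abs_le (abs_real_inner_le_norm (Z τ) (Z' τ))
      simp only [hq, P]; linarith
    rw [Real.norm_of_nonneg (hN0 τ), hN'] at hmain
    change P ^ 2 * q ≤ _ at hmain
    -- As q ≤ 2P, q³ ≤ 4P²q; the cube root turns the rate 9/2 into 3/2.
    refine le_of_pow_le_pow_left₀ (n := 3) (by norm_num) (by positivity) ?_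
    have h3 : Real.exp (3 / 2 * ρ.arc τ) ^ 3 = Real.exp (9 / 2 * ρ.arc τ) := by
      rw [← Real.exp_nat_mul]; congr 1; push_cast; ring
    rw [mul_pow, mul_pow, h3]
    nlinarith [mul_nonneg (mul_nonneg hq0 (sub_nonneg.2 hqP)) (show 0 ≤ 2 * P + q by linarith)]
  · refine ((((hasDerivAt_arc hρ τ).const_mul (9 / 2)).exp).mul_const
      (2 * (‖z‖ * ‖z'‖) ^ 3)).congr_deriv ?_
    ring
  · rw [add_zero, Real.norm_eq_abs, Real.norm_of_nonneg (hN0 τ), hN',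
      ρ.extSpeed_eq hτ]
    refine (abs_two_point_deriv_le τ (Z τ) (Z' τ)).trans (le_of_eq (by ring))
  · rw [Real.norm_of_nonneg (hN0 0), hN', hZ.1, hZ'.1, arc_zero, mul_zero, Real.exp_zero, one_mul]
    have := neg_le_of_abs_le (abs_real_inner_le_norm z z')
    nlinarith [mul_le_mul_of_nonneg_left
      (show ‖z‖ * ‖z'‖ - inner ℝ z z' ≤ 2 * (‖z‖ * ‖z'‖) by linarith) (sq_nonneg (‖z‖ * ‖z'‖))]

/-- The vector u, the image of g under the reflection fixing ω, has the norm of g, so ⟨u,g'⟩ ≥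
-‖g‖‖g'‖. -/
lemma neg_inner_mul_inner_le (ω : FlowSphere D) (g g' : Eucl D) :
    -(inner ℝ (ω : Eucl D) g * inner ℝ (ω : Eucl D) g') ≤ (‖g‖ * ‖g'‖ - inner ℝ g g') / 2 := by
  set u : Eucl D := (2 * inner ℝ (ω : Eucl D) g) • (ω : Eucl D) - g
  have h1 : ‖u‖ ^ 2 = ‖g‖ ^ 2 := by
    simp only [u]
    rw [norm_sub_sq_real, norm_smul, norm_coe_sphere, inner_smul_left, mul_one,
      Real.norm_eq_abs, sq_abs]
    simp only [conj_trivial]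
    ring
  have h2 : ‖u‖ = ‖g‖ := (sq_eq_sq₀ (norm_nonneg _) (norm_nonneg _)).1 h1
  have h3 := neg_le_of_abs_le (abs_real_inner_le_norm u g')
  rw [h2] at h3
  simp only [u, inner_sub_left, inner_smul_left, conj_trivial] at h3
  linarith

section Signs

variable {ι : Type*} [Fintype ι] {z : ι → Eucl D} {Z : ι → ℝ → Eucl D}

/-- Contraction of the signed sum of trajectories of a ReLU flow. -/
lemma norm_signSum_le (hρ : ContinuousOn ρ.speed (Icc 0 1)) (hZ : ∀ i, ρ.IsSolution (z i) (Z i))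
    (ξ : ι → Bool) {τ₁ τ₂ c B : ℝ} (hB0 : 0 ≤ B) (h0 : 0 ≤ τ₁) (h12 : τ₁ ≤ τ₂) (h1 : τ₂ ≤ 1)
    (hc : ‖∑ i, sgn (ξ i) • Z i τ₁‖ ≤ Real.exp (ρ.arc τ₁) * c)
    (hB : ∀ τ ∈ Icc τ₁ τ₂, ∀ ω : FlowSphere D,
      |∑ i, sgn (ξ i) * abs (inner ℝ (ω : Eucl D) (Z i τ))| ≤ Real.exp (ρ.arc τ) * B) :
    ‖∑ i, sgn (ξ i) • Z i τ₂‖ ≤ Real.exp (ρ.arc τ₂) *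
      (Real.exp (-(ρ.arc τ₂ - ρ.arc τ₁) / 2) * c
        + (1 - Real.exp (-(ρ.arc τ₂ - ρ.arc τ₁) / 2)) * B) := by
  -- The comparison function is e^arc times the solution of m' = Λ(B-m)/2 with m(τ₁) = c.
  refine norm_le_of_linear_comparison (a := τ₁) (b := τ₂)
    (f := fun τ => ∑ i, sgn (ξ i) • Z i τ)
    (f' := fun τ => ∑ i, sgn (ξ i) • ρ.velocity τ (Z i τ))
    (φ := fun τ => Real.exp (ρ.arc τ) * (Real.exp (-(ρ.arc τ - ρ.arc τ₁) / 2) * c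
        + (1 - Real.exp (-(ρ.arc τ - ρ.arc τ₁) / 2)) * B))
    (k := fun τ => ρ.extSpeed τ / 2) (c := fun τ => ρ.extSpeed τ / 2 * (Real.exp (ρ.arc τ) * B))
    ((continuous_extSpeed hρ).div_const 2) (fun τ hτ => ?_) (fun τ => ?_) (fun τ hτ => ?_) ?_
    τ₂ (right_mem_Icc.2 h12)
  · refine HasDerivWithinAt.fun_sum fun i _ => ?_
    exact (((hZ i).2 τ ⟨h0.trans hτ.1, hτ.2.trans h1⟩).mono
      (Icc_subset_Icc h0 h1)).const_smul (sgn (ξ i))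
  · have hd := hasDerivAt_arc hρ τ
    have hE := (((hd.sub_const (ρ.arc τ₁)).neg).div_const 2).exp
    have := hd.exp.mul ((hE.mul_const c).add ((hE.const_sub 1).mul_const B))
    refine this.congr_deriv ?_
    simp only [Pi.add_apply, Pi.neg_apply]
    ring
  · have hτ' : τ ∈ Icc (0 : ℝ) 1 := ⟨h0.trans hτ.1, hτ.2.trans h1⟩
    rw [ρ.extSpeed_eq hτ']
    have : ‖∑ i, sgn (ξ i) • ρ.velocity τ (Z i τ)‖
        ≤ ρ.speed τ * ((‖∑ i, sgn (ξ i) • Z i τ‖ + Real.exp (ρ.arc τ) * B) / 2) := by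
      refine norm_le_speed_mul (by positivity) fun j => ?_
      have hj : (∑ i, sgn (ξ i) • ρ.velocity τ (Z i τ)) j
          = ∑ i, sgn (ξ i) * ρ.velocity τ (Z i τ) j := by simp
      rw [hj, sum_mul_velocity τ (fun i => sgn (ξ i)) (fun i => Z i τ)]
      refine abs_signedIntegral_le _ fun ω => ?_
      -- σ(v) = (v+|v|)/2: the linear half reproduces the signed sum, and the other half is bounded
      -- by B.
      have h2 : ∑ i, sgn (ξ i) * relu (inner ℝ (ω : Eucl D) (Z i τ))
          = (inner ℝ (ω : Eucl D) (∑ i, sgn (ξ i) • Z i τ)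
            + ∑ i, sgn (ξ i) * abs (inner ℝ (ω : Eucl D) (Z i τ))) / 2 := by
        simp only [relu_eq, inner_sum, inner_smul_right, ← Finset.sum_add_distrib, Finset.sum_div]
        exact Finset.sum_congr rfl fun i _ => by ring
      rw [h2, abs_div, abs_two]
      refine div_le_div_of_nonneg_right ((abs_add_le _ _).trans ?_) zero_le_two
      exact add_le_add (abs_inner_sphere_le ω _) (hB τ hτ ω)
    exact this.trans (le_of_eq (by ring))
  · simpa using hc

end Signs

/-! ### Normalized profiles of flows -/

section Profiles

variable {ι κ : Type*} {z : ι → κ → Eucl D}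

/-- The vectors `(e^{-ℓ} ω · Z_i(τ))_i` for all flows with accumulated speed `ℓ` at time `τ`, where
the trajectories `Z_i` start from the points `z i t` with a common index `t`. -/
def profiles (z : ι → κ → Eucl D) (ℓ : ℝ) : Set (ι → ℝ) :=
  {y | ∃ (ρ : FlowField D) (t : κ) (Z : ι → ℝ → Eucl D) (τ : ℝ) (ω : FlowSphere D),
    ContinuousOn ρ.speed (Icc 0 1) ∧ (∀ i, ρ.IsSolution (z i t) (Z i)) ∧ τ ∈ Icc (0 : ℝ) 1 ∧
    ρ.arc τ = ℓ ∧ y = fun i => Real.exp (-ℓ) * inner ℝ (ω : Eucl D) (Z i τ)}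

lemma neg_mem_profiles {ℓ : ℝ} {y : ι → ℝ} (hy : y ∈ profiles z ℓ) : -y ∈ profiles z ℓ := by
  obtain ⟨ρ, t, Z, τ, ω, h1, h2, h3, h4, rfl⟩ := hy
  refine ⟨ρ, t, Z, τ, -ω, h1, h2, h3, h4, ?_⟩
  funext i
  simp [inner_neg_left]

lemma abs_le_of_mem_profiles {ζ : ι → ℝ} (hz : ∀ i t, ‖z i t‖ ≤ ζ i) {ℓ : ℝ} {y : ι → ℝ}
    (hy : y ∈ profiles z ℓ) (i : ι) : |y i| ≤ ζ i := by
  obtain ⟨ρ, t, Z, τ, ω, h1, h2, h3, rfl, rfl⟩ := hy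
  have h4 := (abs_inner_sphere_le ω (Z i τ)).trans (((h2 i).norm_le h1 h3).trans
    (mul_le_mul_of_nonneg_left (hz i t) (Real.exp_pos _).le))
  calc |Real.exp (-ρ.arc τ) * inner ℝ (ω : Eucl D) (Z i τ)|
      = Real.exp (-ρ.arc τ) * |inner ℝ (ω : Eucl D) (Z i τ)| := by
        rw [abs_mul, abs_of_pos (Real.exp_pos _)]
    _ ≤ Real.exp (-ρ.arc τ) * (Real.exp (ρ.arc τ) * ζ i) := by gcongr
    _ = ζ i := by rw [← mul_assoc, ← Real.exp_add]; simp

/-- By reflection and the angle bound, -y_i y_j ≤ e^(-2ℓ)·e^(3ℓ/2)·ζ_i ζ_j = u²ζ_i ζ_j with u =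
e^(-ℓ/4). So y_i < -uζ_i and y_j > uζ_j cannot both occur. -/
lemma one_signed_of_mem_profiles {ζ : ι → ℝ} (hz : ∀ i t, ‖z i t‖ ≤ ζ i) {ℓ : ℝ} {y : ι → ℝ}
    (hy : y ∈ profiles z ℓ) :
    (∀ i, -(Real.exp (-ℓ / 4) * ζ i) ≤ y i) ∨ ∀ i, y i ≤ Real.exp (-ℓ / 4) * ζ i := by
  obtain ⟨ρ, t, Z, τ, ω, h1, h2, h3, rfl, rfl⟩ := hy
  by_contra! h
  obtain ⟨⟨i, hi⟩, j, hj⟩ := h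
  set u := Real.exp (-ρ.arc τ / 4) with hu
  have hu0 : 0 < u := Real.exp_pos _
  have hζ : ∀ i, 0 ≤ ζ i := fun i => (norm_nonneg _).trans (hz i t)
  have h4 := mul_lt_mul'' (lt_neg_of_lt_neg hi) hj (mul_nonneg hu0.le (hζ i))
    (mul_nonneg hu0.le (hζ j))
  have h5 := (neg_inner_mul_inner_le ω (Z i τ) (Z j τ)).trans
    (div_le_div_of_nonneg_right ((h2 i).norm_mul_norm_sub_inner_le h1 (h2 j) h3) zero_le_two)
  have h6 : ‖z i t‖ * ‖z j t‖ ≤ ζ i * ζ j :=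
    mul_le_mul (hz i t) (hz j t) (norm_nonneg _) (hζ i)
  have e1 : Real.exp (-ρ.arc τ) = u ^ 4 := by
    rw [hu, ← Real.exp_nat_mul]; congr 1; push_cast; ring
  have e2 : Real.exp (3 / 2 * ρ.arc τ) * u ^ 6 = 1 := by
    rw [hu, ← Real.exp_nat_mul, ← Real.exp_add, ← Real.exp_zero]; congr 1; push_cast; ring
  rw [e1] at h4
  have h7 := mul_le_mul_of_nonneg_left h5 (show 0 ≤ u ^ 8 by positivity)
  have h8 : u ^ 8 * (2 * Real.exp (3 / 2 * ρ.arc τ) * (‖z i t‖ * ‖z j t‖) / 2)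
      = u ^ 2 * (‖z i t‖ * ‖z j t‖) := by
    linear_combination (u ^ 2 * (‖z i t‖ * ‖z j t‖)) * e2
  rw [h8] at h7
  nlinarith [mul_le_mul_of_nonneg_left h6 (sq_nonneg u)]

lemma inner_signSum_eq [Fintype ι] (ξ : ι → Bool) (a : ℝ) (ω : Eucl D) (Z : ι → Eucl D) :
    signSum ξ (fun i => a * inner ℝ ω (Z i)) = a * inner ℝ ω (∑ i, sgn (ξ i) • Z i) := by
  simp only [signSum, inner_sum, inner_smul_right, Finset.mul_sum]
  exact Finset.sum_congr rfl fun i _ => by ring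

lemma exists_sphere_norm_eq (ω₀ : FlowSphere D) (v : Eucl D) :
    ∃ ω : FlowSphere D, ‖v‖ = inner ℝ (ω : Eucl D) v := by
  rcases eq_or_ne v 0 with rfl | hv
  · exact ⟨ω₀, by simp⟩
  · have : 0 < ‖v‖ := norm_pos_iff.2 hv
    refine ⟨⟨‖v‖⁻¹ • v, by simp [norm_smul, this.ne']⟩, ?_⟩
    rw [inner_smul_left, real_inner_self_eq_norm_sq]
    simp only [conj_trivial]
    field_simp

/-- Decay of the signed sums of profiles towards the signed sums of their absolute values. -/
lemma signSum_profiles_le [Fintype ι] (ξ : ι → Bool) {ℓ₁ ℓ₂ c B : ℝ} (h0 : 0 ≤ ℓ₁) (h12 : ℓ₁ ≤ ℓ₂)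
    (hB0 : 0 ≤ B) (hc : ∀ y ∈ profiles z ℓ₁, signSum ξ y ≤ c)
    (hB : ∀ ℓ ∈ Icc ℓ₁ ℓ₂, ∀ y ∈ profiles z ℓ, abs (signSum ξ fun i => |y i|) ≤ B) :
    ∀ y ∈ profiles z ℓ₂, signSum ξ y
      ≤ Real.exp (-(ℓ₂ - ℓ₁) / 2) * c + (1 - Real.exp (-(ℓ₂ - ℓ₁) / 2)) * B := by
  rintro y ⟨ρ, t, Z, τ₂, ω, hρ, hZ, hτ₂, rfl, rfl⟩
  -- An earlier time at which the accumulated speed equals ℓ₁.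
  obtain ⟨τ₁, hτ₁, hℓ⟩ : ℓ₁ ∈ ρ.arc '' Icc 0 τ₂ :=
    intermediate_value_Icc hτ₂.1 (fun τ _ => (hasDerivAt_arc hρ τ).continuousAt.continuousWithinAt)
      (by simpa using ⟨h0, h12⟩)
  subst hℓ
  have hτ₁' : τ₁ ∈ Icc (0 : ℝ) 1 := ⟨hτ₁.1, hτ₁.2.trans hτ₂.2⟩
  have hmain := norm_signSum_le (B := B) (c := c) hρ hZ ξ hB0 hτ₁.1 hτ₁.2 hτ₂.2 ?_ ?_
  · rw [inner_signSum_eq]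
    have h1 := (le_abs_self _).trans (abs_inner_sphere_le ω (∑ i, sgn (ξ i) • Z i τ₂))
    calc Real.exp (-ρ.arc τ₂) * inner ℝ (ω : Eucl D) (∑ i, sgn (ξ i) • Z i τ₂)
        ≤ Real.exp (-ρ.arc τ₂) * (Real.exp (ρ.arc τ₂) *
          (Real.exp (-(ρ.arc τ₂ - ρ.arc τ₁) / 2) * c
            + (1 - Real.exp (-(ρ.arc τ₂ - ρ.arc τ₁) / 2)) * B)) := by
          gcongr
          exact h1.trans hmain
      _ = _ := by rw [← mul_assoc, ← Real.exp_add]; simp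
  -- The norm of the signed sum is itself the signed sum of a profile, with ω' in its direction.
  · obtain ⟨ω', hω'⟩ := exists_sphere_norm_eq ω (∑ i, sgn (ξ i) • Z i τ₁)
    have h2 := hc _ ⟨ρ, t, Z, τ₁, ω', hρ, hZ, hτ₁', rfl, rfl⟩
    rw [inner_signSum_eq, ← hω'] at h2
    rw [Real.exp_neg] at h2
    rwa [inv_mul_le_iff₀ (Real.exp_pos _)] at h2
  · intro τ hτ ω'
    have h3 := hB (ρ.arc τ) ⟨monotone_arc hρ hτ.1, monotone_arc hρ hτ.2⟩ _
      ⟨ρ, t, Z, τ, ω', hρ, hZ, ⟨hτ₁.1.trans hτ.1, hτ.2.trans hτ₂.2⟩, rfl, rfl⟩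
    have h4 : signSum ξ (fun i => |Real.exp (-ρ.arc τ) * inner ℝ (ω' : Eucl D) (Z i τ)|)
        = Real.exp (-ρ.arc τ) * ∑ i, sgn (ξ i) * abs (inner ℝ (ω' : Eucl D) (Z i τ)) := by
      simp only [signSum, Finset.mul_sum, abs_mul, abs_of_pos (Real.exp_pos _)]
      exact Finset.sum_congr rfl fun i _ => by ring
    rw [h4, abs_mul, abs_of_pos (Real.exp_pos _), Real.exp_neg,
      inv_mul_le_iff₀ (Real.exp_pos _)] at h3
    exact h3

/-- Zero accumulated speed does not force τ = 0, but it removes the weight of B in the contraction,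
so the crude B = ∑ζ_i is good enough. -/
lemma signSum_profiles_zero_le [Fintype ι] {ζ : ι → ℝ} (hz : ∀ i t, ‖z i t‖ ≤ ζ i) (ξ : ι → Bool)
    {y : ι → ℝ} (hy : y ∈ profiles z 0) : ∃ t, signSum ξ y ≤ ‖∑ i, sgn (ξ i) • z i t‖ := by
  obtain ⟨ρ, t, Z, τ, ω, hρ, hZ, hτ, h0, rfl⟩ := hy
  refine ⟨t, ?_⟩
  have hζ : ∀ i, 0 ≤ ζ i := fun i => (norm_nonneg _).trans (hz i t)
  have hmain := norm_signSum_le (B := ∑ i, ζ i) (c := ‖∑ i, sgn (ξ i) • z i t‖) hρ hZ ξ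
    (Finset.sum_nonneg fun i _ => hζ i) le_rfl hτ.1 hτ.2 ?_ ?_
  · rw [h0] at hmain
    simp only [arc_zero, neg_zero, zero_div, Real.exp_zero, one_mul, sub_self, zero_mul,
      add_zero] at hmain
    rw [inner_signSum_eq, neg_zero, Real.exp_zero, one_mul]
    exact (le_abs_self _).trans ((abs_inner_sphere_le ω _).trans hmain)
  · simp only [(hZ _).1, arc_zero, Real.exp_zero, one_mul, le_refl]
  · intro s hs ω'
    have hs' : s ∈ Icc (0 : ℝ) 1 := ⟨hs.1, hs.2.trans hτ.2⟩
    rw [Finset.mul_sum]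
    refine (Finset.abs_sum_le_sum_abs _ _).trans (Finset.sum_le_sum fun i _ => ?_)
    rw [abs_mul, abs_sgn, one_mul, abs_abs]
    exact (abs_inner_sphere_le ω' (Z i s)).trans (((hZ i).norm_le hρ hs').trans
      (mul_le_mul_of_nonneg_left (hz i t) (Real.exp_pos _).le))

lemma profiles_zero_nonempty [Nonempty κ] (ω : FlowSphere D) : (profiles z 0).Nonempty := by
  obtain ⟨t⟩ := ‹Nonempty κ›
  have h : speed (fun _ _ => 0 : FlowField D) = fun _ => 0 := by
    funext τ
    simp [speed, tvNorm, SignedMeasure.totalVariation_zero]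
  refine ⟨_, fun _ _ => 0, t, fun i _ => z i t, 0, ω, ?_, fun i => ⟨rfl, fun τ _ => ?_⟩,
    ⟨le_rfl, zero_le_one⟩, arc_zero _, rfl⟩
  · rw [h]; exact continuousOn_const
  · have : velocity (fun _ _ => 0 : FlowField D) τ (z i t) = 0 := by
      ext j
      simp [velocity, signedIntegral]
    rw [this]
    exact hasDerivWithinAt_const _ _ _

end Profiles

end FlowField

/-! ### Signed sums over decaying families -/

section Decay

variable {ι : Type*}

/-- The properties of the normalized profiles of ReLU flows which bound their signed sums. -/
structure IsDecayingFamily [Fintype ι] (Y : ℝ → Set (ι → ℝ)) (ζ : ι → ℝ) : Prop where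
  zero_nonempty : (Y 0).Nonempty
  nonneg : ∀ i, 0 ≤ ζ i
  neg_mem : ∀ ℓ, ∀ y ∈ Y ℓ, -y ∈ Y ℓ
  abs_le : ∀ ℓ, ∀ y ∈ Y ℓ, ∀ i, |y i| ≤ ζ i
  one_signed : ∀ ℓ, ∀ y ∈ Y ℓ, (∀ i, -(Real.exp (-ℓ / 4) * ζ i) ≤ y i) ∨
    ∀ i, y i ≤ Real.exp (-ℓ / 4) * ζ i
  decay : ∀ (ξ : ι → Bool) {ℓ₁ ℓ₂ c B : ℝ}, 0 ≤ ℓ₁ → ℓ₁ ≤ ℓ₂ → 0 ≤ B →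
    (∀ y ∈ Y ℓ₁, signSum ξ y ≤ c) →
    (∀ ℓ ∈ Icc ℓ₁ ℓ₂, ∀ y ∈ Y ℓ, abs (signSum ξ fun i => |y i|) ≤ B) →
    ∀ y ∈ Y ℓ₂, signSum ξ y
      ≤ Real.exp (-(ℓ₂ - ℓ₁) / 2) * c + (1 - Real.exp (-(ℓ₂ - ℓ₁) / 2)) * B

/-- The union of the members of a family up to the parameter `s`. -/
def unionUpTo (Y : ℝ → Set (ι → ℝ)) (s : ℝ) : Set (ι → ℝ) := ⋃ ℓ ∈ Icc 0 s, Y ℓ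

lemma mem_unionUpTo {Y : ℝ → Set (ι → ℝ)} {s : ℝ} {y : ι → ℝ} :
    y ∈ unionUpTo Y s ↔ ∃ ℓ, 0 ≤ ℓ ∧ ℓ ≤ s ∧ y ∈ Y ℓ := by
  simp [unionUpTo, and_assoc]

lemma unionUpTo_mono (Y : ℝ → Set (ι → ℝ)) {s s' : ℝ} (h : s ≤ s') :
    unionUpTo Y s ⊆ unionUpTo Y s' := fun y hy => by
  obtain ⟨ℓ, h1, h2, h3⟩ := mem_unionUpTo.1 hy
  exact mem_unionUpTo.2 ⟨ℓ, h1, h2.trans h, h3⟩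

namespace IsDecayingFamily

variable [Fintype ι] {Y : ℝ → Set (ι → ℝ)} {ζ : ι → ℝ}

lemma unionUpTo_nonempty (hY : IsDecayingFamily Y ζ) {s : ℝ} (hs : 0 ≤ s) :
    (unionUpTo Y s).Nonempty := by
  obtain ⟨y, hy⟩ := hY.zero_nonempty
  exact ⟨y, mem_unionUpTo.2 ⟨0, le_rfl, hs, hy⟩⟩

lemma abs_le_of_mem_unionUpTo (hY : IsDecayingFamily Y ζ) {s : ℝ} :
    ∀ y ∈ unionUpTo Y s, ∀ i, |y i| ≤ ζ i := fun y hy => by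
  obtain ⟨ℓ, -, -, h⟩ := mem_unionUpTo.1 hy
  exact hY.abs_le ℓ y h

lemma neg_mem_unionUpTo (hY : IsDecayingFamily Y ζ) {s : ℝ} :
    ∀ y ∈ unionUpTo Y s, -y ∈ unionUpTo Y s := fun y hy => by
  obtain ⟨ℓ, h0, hs, h⟩ := mem_unionUpTo.1 hy
  exact mem_unionUpTo.2 ⟨ℓ, h0, hs, hY.neg_mem ℓ y h⟩

lemma signSup_nonneg (hY : IsDecayingFamily Y ζ) {s : ℝ} (hs : 0 ≤ s) (ξ : ι → Bool) :
    0 ≤ signSup (unionUpTo Y s) ξ := by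
  obtain ⟨y, hy⟩ := hY.unionUpTo_nonempty hs
  have h1 := le_signSup hY.abs_le_of_mem_unionUpTo ξ hy
  have h2 := le_signSup hY.abs_le_of_mem_unionUpTo ξ (hY.neg_mem_unionUpTo y hy)
  rw [signSum_neg] at h2
  linarith

variable [DecidableEq ι]

/-- One step of the recursion for the mean of the suprema. -/
lemma sum_signSup_step (hY : IsDecayingFamily Y ζ) (hζ : 0 < ∑ i, ζ i ^ 2) {s δ D θ : ℝ}
    (hs : 0 ≤ s) (hδ : 0 ≤ δ) (hD : D = Real.exp (-s / 4)) (hθ : θ = 1 - Real.exp (-δ / 2)) :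
    (1 - 2 * θ) * (∑ ξ, signSup (unionUpTo Y (s + δ)) ξ - ∑ ξ, signSup (unionUpTo Y s) ξ)
      ≤ θ * (2 ^ Fintype.card ι * (2 * √(D * (1 + D)) * √(∑ i, ζ i ^ 2))) := by
  have hD0 : 0 < D := hD ▸ Real.exp_pos _
  have hθ0 : 0 ≤ θ := by
    rw [hθ, sub_nonneg, Real.exp_le_one_iff]; linarith
  set I := unionUpTo Y s
  set I' := unionUpTo Y (s + δ)
  -- The almost nonnegative members of the new layer. Every member of the layer lies in J up to a
  -- sign, so J yields all its absolute values.
  set J : Set (ι → ℝ) := {y | (∃ ℓ ∈ Icc s (s + δ), y ∈ Y ℓ) ∧ ∀ i, -(D * ζ i) ≤ y i} with hJ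
  have hII' : I ⊆ I' := unionUpTo_mono Y (by linarith)
  have hJI' : J ⊆ I' := fun y hy => by
    obtain ⟨⟨ℓ, hℓ, h⟩, -⟩ := hy
    exact mem_unionUpTo.2 ⟨ℓ, hs.trans hℓ.1, hℓ.2, h⟩
  have hor : ∀ ℓ ∈ Icc s (s + δ), ∀ y ∈ Y ℓ, y ∈ J ∨ -y ∈ J := by
    intro ℓ hℓ y hy
    have hexp : ∀ i, Real.exp (-ℓ / 4) * ζ i ≤ D * ζ i := fun i => by
      rw [hD]
      refine mul_le_mul_of_nonneg_right (Real.exp_le_exp.2 ?_) (hY.nonneg i)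
      linarith [hℓ.1]
    rcases hY.one_signed ℓ y hy with h | h
    · exact Or.inl ⟨⟨ℓ, hℓ, hy⟩, fun i => (neg_le_neg (hexp i)).trans (h i)⟩
    · exact Or.inr ⟨⟨ℓ, hℓ, hY.neg_mem ℓ y hy⟩, fun i => neg_le_neg ((h i).trans (hexp i))⟩
  rcases J.eq_empty_or_nonempty with hJ0 | hJne
  · have : I' = I := by
      refine Subset.antisymm (fun y hy => ?_) hII'
      obtain ⟨ℓ, h0, h1, h⟩ := mem_unionUpTo.1 hy
      rcases le_or_gt ℓ s with hℓ | hℓ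
      · exact mem_unionUpTo.2 ⟨ℓ, h0, hℓ, h⟩
      · have := hor ℓ ⟨hℓ.le, h1⟩ y h
        simp [hJ0] at this
    rw [this, sub_self, mul_zero]
    positivity
  have hIne : I.Nonempty := hY.unionUpTo_nonempty hs
  set S := signSup ((fun (y : ι → ℝ) i => |y i|) '' J) with hS
  set B : (ι → Bool) → ℝ := fun ξ => max (signSup I ξ) (max (S ξ) (S fun i => !ξ i)) with hB
  have hmain := sum_abs_signSum_abs_le hIne hJne hD0 hY.nonneg hζ hY.abs_le_of_mem_unionUpTo
    hY.neg_mem_unionUpTo hII' hJI' (fun y hy => hy.2) (B := B) (fun ξ => le_rfl)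
  -- A member at ℓ in the new layer has decayed from level s towards B, with weight at most θ on B.
  have hstep : ∀ ξ, signSup I' ξ ≤ (1 - θ) * signSup I ξ + θ * B ξ := by
    intro ξ
    have hIB : signSup I ξ ≤ B ξ := le_max_left _ _
    have hI0 : 0 ≤ signSup I ξ := hY.signSup_nonneg hs ξ
    have habs : ∀ y ∈ (fun (y : ι → ℝ) i => |y i|) '' J, ∀ i, |y i| ≤ ζ i := by
      rintro _ ⟨y, hy, rfl⟩ i
      simpa using hY.abs_le_of_mem_unionUpTo y (hJI' hy) i
    have hBabs : ∀ ℓ ∈ Icc s (s + δ), ∀ y ∈ Y ℓ, abs (signSum ξ fun i => |y i|) ≤ B ξ := by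
      intro ℓ hℓ y hy
      have hmem : (fun i => |y i|) ∈ (fun (y : ι → ℝ) i => |y i|) '' J := by
        rcases hor ℓ hℓ y hy with h | h
        · exact ⟨y, h, rfl⟩
        · exact ⟨-y, h, by funext i; simp⟩
      refine abs_le'.2 ⟨?_, ?_⟩
      · exact (le_signSup habs ξ hmem).trans ((le_max_left _ _).trans (le_max_right _ _))
      · rw [← signSum_not]
        exact (le_signSup habs _ hmem).trans ((le_max_right _ _).trans (le_max_right _ _))
    refine signSup_le (hY.unionUpTo_nonempty (by linarith)) fun y hy => ?_
    obtain ⟨ℓ, h0, h1, h⟩ := mem_unionUpTo.1 hy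
    rcases le_or_gt ℓ s with hℓ | hℓ
    · have := le_signSup hY.abs_le_of_mem_unionUpTo ξ
        (mem_unionUpTo.2 ⟨ℓ, h0, hℓ, h⟩ : y ∈ unionUpTo Y s)
      change _ ≤ signSup I ξ at this
      nlinarith [mul_le_mul_of_nonneg_left hIB hθ0]
    · have := hY.decay ξ hs hℓ.le (hI0.trans hIB) (fun y hy =>
        le_signSup hY.abs_le_of_mem_unionUpTo ξ (mem_unionUpTo.2 ⟨s, hs, le_rfl, hy⟩))
        (fun ℓ' hℓ' => hBabs ℓ' ⟨hℓ'.1, hℓ'.2.trans h1⟩) y h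
      change _ ≤ _ * signSup I ξ + _ at this
      have he : 1 - Real.exp (-(ℓ - s) / 2) ≤ θ := by
        rw [hθ]
        have : Real.exp (-δ / 2) ≤ Real.exp (-(ℓ - s) / 2) := Real.exp_le_exp.2 (by linarith)
        linarith
      nlinarith [mul_le_mul_of_nonneg_right he (sub_nonneg.2 hIB)]
  have hsum := Finset.sum_le_sum fun ξ (_ : ξ ∈ Finset.univ) => hstep ξ
  rw [Finset.sum_add_distrib, ← Finset.mul_sum, ← Finset.mul_sum] at hsum
  -- With a and a' the sums for I and I', (1-θ)a + θ(2a'-a) = a + 2θ(a'-a), which is absorbed on the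
  -- left.
  have := mul_le_mul_of_nonneg_left hmain hθ0
  linarith

/-- The mean of the suprema over a decaying family up to an arbitrary parameter. -/
lemma sum_signSup_unionUpTo_le (hY : IsDecayingFamily Y ζ) (hζ : 0 < ∑ i, ζ i ^ 2) {s : ℝ}
    (hs : 0 ≤ s) :
    ∑ ξ, signSup (unionUpTo Y s) ξ
      ≤ ∑ ξ, signSup (Y 0) ξ + 2 ^ Fintype.card ι * (941 / 100 * √(∑ i, ζ i ^ 2)) := by
  -- With δ = -8 log l, both D = l^(2j) and θ = 1 - l⁴ are powers of l. As l tends to 1 the constant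
  -- tends to 8 + 4/3; this l keeps it below 9.41.
  set l : ℝ := 999 / 1000 with hl
  have hl0 : 0 < l := by norm_num [hl]
  set δ := -8 * Real.log l with hδ
  have hδ0 : 0 < δ := by
    have := Real.log_neg hl0 (by norm_num [hl])
    rw [hδ]; linarith
  have hexp : ∀ k : ℕ, Real.exp (-(k * δ) / 8) = l ^ k := fun k => by
    rw [hδ, show -(k * (-8 * Real.log l)) / 8 = k * Real.log l by ring, Real.exp_nat_mul,
      Real.exp_log hl0]
  set θ := 1 - l ^ 4 with hθ
  have hθ' : θ = 1 - Real.exp (-δ / 2) := by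
    rw [hθ, ← hexp 4]; congr 2; push_cast; ring
  set E : ℝ := 2 ^ Fintype.card ι with hE
  set r := √(∑ i, ζ i ^ 2) with hr
  have hE0 : 0 ≤ E := by positivity
  have hr0 : 0 ≤ r := Real.sqrt_nonneg _
  have hstep : ∀ j : ℕ, (1 - 2 * θ) * (∑ ξ, signSup (unionUpTo Y ((j + 1 : ℕ) * δ)) ξ
      - ∑ ξ, signSup (unionUpTo Y (j * δ)) ξ) ≤ θ * (E * r) * (2 * l ^ j + (l ^ 3) ^ j) := by
    intro j
    have h1 := hY.sum_signSup_step hζ (s := j * δ) (δ := δ) (D := l ^ (2 * j)) (θ := θ)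
      (by positivity) hδ0.le (by rw [← hexp]; congr 1; push_cast; ring) hθ'
    rw [show (j : ℝ) * δ + δ = (j + 1 : ℕ) * δ by push_cast; ring] at h1
    refine h1.trans ?_
    have hu : 0 ≤ l ^ j := by positivity
    -- √(u²+u⁴) ≤ u + u³/2 with u = l^j, so that only geometric series remain.
    have h2 : √(l ^ (2 * j) * (1 + l ^ (2 * j))) ≤ l ^ j + (l ^ 3) ^ j / 2 := by
      rw [Real.sqrt_le_left (by positivity), ← pow_mul, mul_comm 3 j, mul_comm 2 j, pow_mul,
        pow_mul]
      nlinarith [pow_nonneg hu 6]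
    have h3 : (0 : ℝ) ≤ θ := by norm_num [hθ, hl]
    calc θ * (E * (2 * √(l ^ (2 * j) * (1 + l ^ (2 * j))) * r))
        ≤ θ * (E * (2 * (l ^ j + (l ^ 3) ^ j / 2) * r)) := by gcongr
      _ = _ := by ring
  have htel : ∀ j : ℕ, (1 - 2 * θ) * (∑ ξ, signSup (unionUpTo Y (j * δ)) ξ
      - ∑ ξ, signSup (Y 0) ξ)
      ≤ θ * (E * r) * ∑ k ∈ Finset.range j, (2 * l ^ k + (l ^ 3) ^ k) := by
    intro j
    induction j with
    | zero =>
      have : unionUpTo Y ((0 : ℕ) * δ) = Y 0 := by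
        ext y
        rw [mem_unionUpTo]
        constructor
        · rintro ⟨ℓ, h0, h1, h⟩
          have : ℓ = 0 := le_antisymm (by simpa using h1) h0
          rwa [this] at h
        · exact fun h => ⟨0, le_rfl, by simp, h⟩
      rw [this]; simp
    | succ j ih =>
      rw [Finset.sum_range_succ, mul_add]
      have := hstep j
      linarith
  have hgeom : ∀ (q : ℝ) (j : ℕ), 0 ≤ q → q < 1 →
      ∑ k ∈ Finset.range j, q ^ k ≤ 1 / (1 - q) := by
    intro q j h0 h1
    have h2 : 0 < 1 - q := by linarith
    rw [le_div_iff₀ h2, geom_sum_mul_neg]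
    have := pow_nonneg h0 j
    linarith
  obtain ⟨j, hj⟩ := exists_nat_ge (s / δ)
  have hsj : s ≤ j * δ := (div_le_iff₀ hδ0).1 hj
  have hmono : ∑ ξ, signSup (unionUpTo Y s) ξ ≤ ∑ ξ, signSup (unionUpTo Y (j * δ)) ξ :=
    Finset.sum_le_sum fun ξ _ => signSup_mono (hY.unionUpTo_nonempty hs)
      hY.abs_le_of_mem_unionUpTo (unionUpTo_mono Y hsj) ξ
  have h1 := htel j
  rw [Finset.sum_add_distrib, ← Finset.mul_sum] at h1
  have h2 := hgeom l j hl0.le (by norm_num [hl])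
  have h3 := hgeom (l ^ 3) j (by positivity) (by norm_num [hl])
  have h4 : θ * (2 * ∑ k ∈ Finset.range j, l ^ k + ∑ k ∈ Finset.range j, (l ^ 3) ^ k)
      ≤ (1 - 2 * θ) * (941 / 100) := by
    have : (0 : ℝ) ≤ θ := by norm_num [hθ, hl]
    refine (mul_le_mul_of_nonneg_left (add_le_add
      (mul_le_mul_of_nonneg_left h2 zero_le_two) h3) this).trans ?_
    norm_num [hθ, hl]
  have h5 := mul_le_mul_of_nonneg_left h4 (mul_nonneg hE0 hr0)
  have h6 : (0 : ℝ) < 1 - 2 * θ := by norm_num [hθ, hl]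
  have h7 : (1 - 2 * θ) * (∑ ξ, signSup (unionUpTo Y (j * δ)) ξ - ∑ ξ, signSup (Y 0) ξ)
      ≤ (1 - 2 * θ) * (E * (941 / 100 * r)) :=
    h1.trans (le_of_eq_of_le (by ring) (h5.trans (le_of_eq (by ring))))
  have h8 := le_of_mul_le_mul_left h7 h6
  linarith

/-- The mean of the suprema over the whole decaying family. -/
lemma sum_signSup_iUnion_le (hY : IsDecayingFamily Y ζ) (hζ : 0 < ∑ i, ζ i ^ 2) :
    ∑ ξ, signSup (⋃ ℓ ∈ Ici (0 : ℝ), Y ℓ) ξ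
      ≤ ∑ ξ, signSup (Y 0) ξ + 2 ^ Fintype.card ι * (941 / 100 * √(∑ i, ζ i ^ 2)) := by
  refine le_of_forall_pos_le_add fun ε hε => ?_
  have hne : (⋃ ℓ ∈ Ici (0 : ℝ), Y ℓ).Nonempty := by
    obtain ⟨y, hy⟩ := hY.zero_nonempty
    exact ⟨y, mem_iUnion₂.2 ⟨0, self_mem_Ici, hy⟩⟩
  obtain ⟨N, hN⟩ : ∃ N : ℝ, N = (Fintype.card (ι → Bool) : ℝ) := ⟨_, rfl⟩
  have hN0 : 0 < N := by rw [hN]; exact_mod_cast Fintype.card_pos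
  -- Each of the finitely many ξ has a near-maximizer at a finite parameter; the sum of these
  -- parameters serves all of them.
  have hex : ∀ ξ : ι → Bool, ∃ s, 0 ≤ s ∧
      signSup (⋃ ℓ ∈ Ici (0 : ℝ), Y ℓ) ξ - ε / N ≤ signSup (unionUpTo Y s) ξ := by
    intro ξ
    obtain ⟨_, ⟨y, hy, rfl⟩, h⟩ := exists_lt_of_lt_csSup (hne.image (signSum ξ))
      (sub_lt_self (signSup (⋃ ℓ ∈ Ici (0 : ℝ), Y ℓ) ξ) (div_pos hε hN0))
    obtain ⟨ℓ, h0, hy⟩ := mem_iUnion₂.1 hy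
    exact ⟨ℓ, h0, h.le.trans (le_signSup hY.abs_le_of_mem_unionUpTo ξ
      (mem_unionUpTo.2 ⟨ℓ, h0, le_rfl, hy⟩))⟩
  choose s hs0 hs using hex
  have hle : ∀ ξ, s ξ ≤ ∑ ξ, s ξ := fun ξ =>
    Finset.single_le_sum (fun ξ _ => hs0 ξ) (Finset.mem_univ ξ)
  have hS0 : 0 ≤ ∑ ξ, s ξ := Finset.sum_nonneg fun ξ _ => hs0 ξ
  have h1 : ∑ ξ, signSup (⋃ ℓ ∈ Ici (0 : ℝ), Y ℓ) ξ
      ≤ ∑ ξ, (signSup (unionUpTo Y (∑ ξ, s ξ)) ξ + ε / N) := by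
    refine Finset.sum_le_sum fun ξ _ => ?_
    have := signSup_mono (hY.unionUpTo_nonempty (hs0 ξ)) hY.abs_le_of_mem_unionUpTo
      (unionUpTo_mono Y (hle ξ)) ξ
    linarith [hs ξ]
  have h2 := hY.sum_signSup_unionUpTo_le hζ hS0
  rw [Finset.sum_add_distrib, Finset.sum_const, Finset.card_univ, nsmul_eq_mul, ← hN,
    mul_div_cancel₀ _ hN0.ne'] at h1
  linarith

end IsDecayingFamily

end Decay

lemma FlowField.isDecayingFamily_profiles {D : ℕ} {ι κ : Type*} [Fintype ι] [Nonempty κ]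
    {z : ι → κ → Eucl D} {ζ : ι → ℝ} (hz : ∀ i t, ‖z i t‖ ≤ ζ i) (ω : FlowSphere D) :
    IsDecayingFamily (FlowField.profiles z) ζ where
  zero_nonempty := profiles_zero_nonempty ω
  nonneg i := (norm_nonneg _).trans (hz i (Classical.arbitrary κ))
  neg_mem _ _ := neg_mem_profiles
  abs_le _ _ := abs_le_of_mem_profiles hz
  one_signed _ _ := one_signed_of_mem_profiles hz
  decay := signSum_profiles_le

/-! ### Rademacher sums in Hilbert spaces -/

/-- p and q lie between Q and P and have the same sum, so this is convexity of the power. -/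
lemma pow_add_pow_le_of_add_eq {p q P Q : ℝ} (hQ : 0 ≤ Q) (hp : p ≤ P) (hq : q ≤ P)
    (h : p + q = P + Q) (k : ℕ) : p ^ k + q ^ k ≤ P ^ k + Q ^ k := by
  have hp' : Q ≤ p := by linarith
  have hq' : Q ≤ q := by linarith
  induction k with
  | zero => simp
  | succ k ih =>
    have h1 : Q ^ k ≤ p ^ k := pow_le_pow_left₀ hQ hp' k
    have h2 : Q ^ k ≤ q ^ k := pow_le_pow_left₀ hQ hq' k
    rw [pow_succ, pow_succ, pow_succ, pow_succ]
    have h4 : q = P + Q - p := by linarith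
    have h5 : p ^ k * p + q ^ k * q
        = P * (p ^ k + q ^ k) - (P - p) * p ^ k - (P - q) * q ^ k := by ring
    have h6 : (P - p) * Q ^ k + (P - q) * Q ^ k = (P - Q) * Q ^ k := by rw [h4]; ring
    have h7 := mul_le_mul_of_nonneg_left h1 (sub_nonneg.2 hp)
    have h8 := mul_le_mul_of_nonneg_left h2 (sub_nonneg.2 hq)
    have h9 := mul_le_mul_of_nonneg_left ih (show 0 ≤ P by linarith)
    linarith

section Hilbert

variable {H : Type*} [NormedAddCommGroup H] [InnerProductSpace ℝ H]

/-- cosh is a power series in the squared norm with nonnegative coefficients. The pair ‖u±v‖² has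
the same sum as (‖u‖±‖v‖)² and is less spread out. -/
lemma cosh_norm_add_add_cosh_norm_sub_le (u v : H) :
    Real.cosh ‖u + v‖ + Real.cosh ‖u - v‖ ≤ 2 * (Real.cosh ‖u‖ * Real.cosh ‖v‖) := by
  have h1 : 2 * (Real.cosh ‖u‖ * Real.cosh ‖v‖)
      = Real.cosh (‖u‖ + ‖v‖) + Real.cosh (‖u‖ - ‖v‖) := by
    rw [Real.cosh_add, Real.cosh_sub]; ring
  rw [h1]
  refine hasSum_le (fun k => ?_) ((Real.hasSum_cosh _).add (Real.hasSum_cosh _))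
    ((Real.hasSum_cosh _).add (Real.hasSum_cosh _))
  rw [← add_div, ← add_div]
  refine div_le_div_of_nonneg_right ?_ (by positivity)
  simp only [pow_mul]
  have hi := abs_le.1 (abs_real_inner_le_norm u v)
  refine pow_add_pow_le_of_add_eq (sq_nonneg _) ?_ ?_ ?_ k
  · rw [norm_add_sq_real]; nlinarith
  · rw [norm_sub_sq_real]; nlinarith
  · rw [norm_add_sq_real, norm_sub_sq_real]; ring

variable {ι : Type*} [DecidableEq ι]

lemma sum_sgn_smul_flipAt {s : Finset ι} {k : ι} (hk : k ∉ s) (ξ : ι → Bool) (v : ι → H) :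
    ∑ i ∈ s, sgn (flipAt k ξ i) • v i = ∑ i ∈ s, sgn (ξ i) • v i := by
  refine Finset.sum_congr rfl fun i hi => ?_
  have : i ≠ k := fun h => hk (h ▸ hi)
  simp [flipAt, this]

variable [Fintype ι]

lemma two_mul_sum_eq_flipAt (k : ι) (f : (ι → Bool) → ℝ) :
    2 * ∑ ξ, f ξ = ∑ ξ, (f ξ + f (flipAt k ξ)) := by
  rw [Finset.sum_add_distrib, sum_flipAt, two_mul]

/-- A dimension-free sub-Gaussian bound; one vector is split off at a time by averaging over its
sign. -/
lemma sum_cosh_norm_le (v : ι → H) (s : Finset ι) :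
    ∑ ξ : ι → Bool, Real.cosh ‖∑ i ∈ s, sgn (ξ i) • v i‖
      ≤ 2 ^ Fintype.card ι * Real.exp ((∑ i ∈ s, ‖v i‖ ^ 2) / 2) := by
  induction s using Finset.induction_on with
  | empty => simp
  | insert k s hk ih =>
    have h1 : 2 * ∑ ξ : ι → Bool, Real.cosh ‖∑ i ∈ insert k s, sgn (ξ i) • v i‖
        ≤ ∑ ξ : ι → Bool, 2 * (Real.cosh ‖∑ i ∈ s, sgn (ξ i) • v i‖ * Real.cosh ‖v k‖) := by
      rw [two_mul_sum_eq_flipAt k]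
      refine Finset.sum_le_sum fun ξ _ => ?_
      rw [Finset.sum_insert hk, Finset.sum_insert hk, sum_sgn_smul_flipAt hk,
        show flipAt k ξ k = !ξ k by simp [flipAt], sgn_not, neg_smul]
      set W := ∑ i ∈ s, sgn (ξ i) • v i
      have h2 := cosh_norm_add_add_cosh_norm_sub_le W (sgn (ξ k) • v k)
      rwa [norm_smul, Real.norm_eq_abs, abs_sgn, one_mul, add_comm W, sub_eq_neg_add W] at h2
    rw [← Finset.mul_sum, ← Finset.sum_mul] at h1
    rw [Finset.sum_insert hk, add_div, Real.exp_add]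
    have h3 := Real.cosh_le_exp_half_sq ‖v k‖
    have h4 : 0 ≤ ∑ ξ : ι → Bool, Real.cosh ‖∑ i ∈ s, sgn (ξ i) • v i‖ :=
      Finset.sum_nonneg fun ξ _ => (Real.cosh_pos _).le
    calc ∑ ξ : ι → Bool, Real.cosh ‖∑ i ∈ insert k s, sgn (ξ i) • v i‖
        ≤ (∑ ξ : ι → Bool, Real.cosh ‖∑ i ∈ s, sgn (ξ i) • v i‖) * Real.cosh ‖v k‖ := by linarith
      _ ≤ (2 ^ Fintype.card ι * Real.exp ((∑ i ∈ s, ‖v i‖ ^ 2) / 2))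
          * Real.exp (‖v k‖ ^ 2 / 2) :=
        mul_le_mul ih h3 (Real.cosh_pos _).le (by positivity)
      _ = _ := by ring

lemma sum_norm_sq_eq (v : ι → H) (s : Finset ι) :
    ∑ ξ : ι → Bool, ‖∑ i ∈ s, sgn (ξ i) • v i‖ ^ 2
      = 2 ^ Fintype.card ι * ∑ i ∈ s, ‖v i‖ ^ 2 := by
  induction s using Finset.induction_on with
  | empty => simp
  | insert k s hk ih =>
    have h1 : 2 * ∑ ξ : ι → Bool, ‖∑ i ∈ insert k s, sgn (ξ i) • v i‖ ^ 2
        = ∑ ξ : ι → Bool, 2 * (‖∑ i ∈ s, sgn (ξ i) • v i‖ ^ 2 + ‖v k‖ ^ 2) := by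
      rw [two_mul_sum_eq_flipAt k]
      refine Finset.sum_congr rfl fun ξ _ => ?_
      rw [Finset.sum_insert hk, Finset.sum_insert hk, sum_sgn_smul_flipAt hk,
        show flipAt k ξ k = !ξ k by simp [flipAt], sgn_not, neg_smul,
        add_comm _ (∑ i ∈ s, sgn (ξ i) • v i), add_comm _ (∑ i ∈ s, sgn (ξ i) • v i),
        ← sub_eq_add_neg, norm_add_sq_real, norm_sub_sq_real, norm_smul, Real.norm_eq_abs,
        abs_sgn, one_mul]
      ring
    rw [← Finset.mul_sum, Finset.sum_add_distrib, ih] at h1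
    rw [Finset.sum_insert hk]
    simp only [Finset.sum_const, Finset.card_univ, Fintype.card_fun, Fintype.card_bool,
      nsmul_eq_mul] at h1
    push_cast at h1
    linarith

lemma sum_norm_sum_sgn_smul_le (v : ι → H) :
    ∑ ξ : ι → Bool, ‖∑ i, sgn (ξ i) • v i‖ ≤ 2 ^ Fintype.card ι * √(∑ i, ‖v i‖ ^ 2) := by
  have h := Real.sum_sqrt_mul_sqrt_le (s := (Finset.univ : Finset (ι → Bool)))
    (f := fun ξ => ‖∑ i, sgn (ξ i) • v i‖ ^ 2) (g := fun _ => 1) (fun _ => sq_nonneg _)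
    (fun _ => zero_le_one)
  simp only [Real.sqrt_sq (norm_nonneg _), Real.sqrt_one, mul_one, sum_norm_sq_eq,
    Finset.sum_const, Finset.card_univ, Fintype.card_fun, Fintype.card_bool, nsmul_eq_mul] at h
  push_cast at h
  refine h.trans (le_of_eq ?_)
  have h2 : (0 : ℝ) ≤ 2 ^ Fintype.card ι := by positivity
  rw [Real.sqrt_mul h2, mul_right_comm, Real.mul_self_sqrt h2]

/-- The minimum over l is at l = √(2a/V); for V = 0 a large l is used. -/
lemma le_sqrt_of_forall_le_div_add {m a V : ℝ} (ha : 0 < a) (hV : 0 ≤ V)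
    (h : ∀ l, 0 < l → m ≤ a / l + l * V / 2) : m ≤ √(2 * a * V) := by
  rcases hV.eq_or_lt with rfl | hV
  · simp only [mul_zero, zero_div, add_zero, Real.sqrt_zero] at h ⊢
    by_contra! hm
    have := h (2 * a / m) (by positivity)
    rw [div_div_eq_mul_div, mul_comm a m, mul_div_mul_right _ _ ha.ne'] at this
    linarith
  · have hs : 0 < √(2 * a * V) := Real.sqrt_pos.2 (by positivity)
    have h1 := h (√(2 * a * V) / V) (by positivity)
    have h2 := Real.mul_self_sqrt (show 0 ≤ 2 * a * V by positivity)
    have h3 : a / (√(2 * a * V) / V) = √(2 * a * V) / 2 := by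
      rw [div_div_eq_mul_div, div_eq_div_iff hs.ne' two_ne_zero, h2]; ring
    rw [h3, div_mul_cancel₀ _ hV.ne'] at h1
    linarith

/-- The maximal inequality for finitely many Rademacher sums. -/
lemma sum_sup_norm_sum_sgn_smul_le {L : Type*} [Fintype L] [Nonempty L] (v : L → ι → H) {V : ℝ}
    (hV : ∀ l, ∑ i, ‖v l i‖ ^ 2 ≤ V) :
    ∑ ξ : ι → Bool, (⨆ l, ‖∑ i, sgn (ξ i) • v l i‖)
      ≤ 2 ^ Fintype.card ι * √(2 * Real.log (2 * Fintype.card L) * V) := by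
  set M : (ι → Bool) → ℝ := fun ξ => ⨆ l, ‖∑ i, sgn (ξ i) • v l i‖ with hM
  set E : ℝ := 2 ^ Fintype.card ι with hE
  have hE0 : 0 < E := by positivity
  have hN : (1 : ℝ) ≤ Fintype.card L := by exact_mod_cast Fintype.card_pos
  have ha : 0 < Real.log (2 * Fintype.card L) := Real.log_pos (by linarith)
  have hV0 : 0 ≤ V :=
    (Finset.sum_nonneg fun i _ => sq_nonneg _).trans (hV (Classical.arbitrary L))
  rw [← div_le_iff₀' hE0]
  refine le_sqrt_of_forall_le_div_add ha hV0 fun r hr => ?_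
  set c := Real.log (2 * Fintype.card L) + r ^ 2 * V / 2 with hc
  have h1 : ∑ ξ, Real.exp (r * M ξ) ≤ E * Real.exp c := by
    -- The supremum is attained at some l, and exp ≤ 2 cosh; hence the 2 inside the logarithm.
    calc ∑ ξ, Real.exp (r * M ξ)
        ≤ ∑ ξ : ι → Bool, 2 * ∑ l, Real.cosh ‖∑ i, sgn (ξ i) • (r • v l i)‖ := by
          refine Finset.sum_le_sum fun ξ _ => ?_
          obtain ⟨l, hl⟩ := exists_eq_ciSup_of_finite (f := fun l => ‖∑ i, sgn (ξ i) • v l i‖)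
          have h2 : ‖∑ i, sgn (ξ i) • (r • v l i)‖ = r * M ξ := by
            simp only [hM]
            rw [← hl]
            simp only [smul_comm _ r, ← Finset.smul_sum]
            rw [norm_smul, Real.norm_of_nonneg hr.le]
          have h3 := Finset.single_le_sum
            (f := fun l => Real.cosh ‖∑ i, sgn (ξ i) • (r • v l i)‖)
            (fun l _ => (Real.cosh_pos _).le) (Finset.mem_univ l)
          simp only [h2] at h3
          rw [Real.cosh_eq] at h3
          have := Real.exp_pos (-(r * M ξ))
          linarith
      _ = 2 * ∑ l, ∑ ξ : ι → Bool, Real.cosh ‖∑ i, sgn (ξ i) • (r • v l i)‖ := by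
          rw [← Finset.mul_sum, Finset.sum_comm]
      _ ≤ 2 * ∑ l : L, E * Real.exp (r ^ 2 * V / 2) := by
          refine mul_le_mul_of_nonneg_left (Finset.sum_le_sum fun l _ => ?_) zero_le_two
          refine (sum_cosh_norm_le _ _).trans
            (mul_le_mul_of_nonneg_left (Real.exp_le_exp.2 ?_) hE0.le)
          simp only [norm_smul, mul_pow, Real.norm_eq_abs, sq_abs, ← Finset.mul_sum]
          have := mul_le_mul_of_nonneg_left (hV l) (sq_nonneg r)
          linarith
      _ = E * Real.exp c := by
          rw [hc, Real.exp_add, Real.exp_log (by linarith)]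
          simp only [Finset.sum_const, Finset.card_univ, nsmul_eq_mul]
          ring
  -- Jensen's inequality in the form 1 + t ≤ e^t at t = rM - c.
  have h2 : ∑ ξ, (1 + (r * M ξ - c)) ≤ E := by
    calc ∑ ξ, (1 + (r * M ξ - c)) ≤ ∑ ξ, Real.exp (r * M ξ) * Real.exp (-c) := by
          refine Finset.sum_le_sum fun ξ _ => ?_
          rw [← Real.exp_add, ← sub_eq_add_neg, add_comm]
          exact Real.add_one_le_exp _
      _ = (∑ ξ, Real.exp (r * M ξ)) * Real.exp (-c) := by rw [Finset.sum_mul]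
      _ ≤ E * Real.exp c * Real.exp (-c) := by gcongr
      _ = E := by rw [mul_assoc, ← Real.exp_add]; simp
  rw [Finset.sum_add_distrib, Finset.sum_sub_distrib, ← Finset.mul_sum] at h2
  simp only [Finset.sum_const, Finset.card_univ, Fintype.card_fun, Fintype.card_bool,
    nsmul_eq_mul] at h2
  push_cast at h2
  rw [div_le_iff₀ hE0]
  have h3 : r * ∑ ξ, M ξ ≤ r * ((Real.log (2 * Fintype.card L) / r + r * V / 2) * E) := by
    have h4 : r * ((Real.log (2 * Fintype.card L) / r + r * V / 2) * E) = E * c := by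
      rw [hc]; field_simp
    rw [h4]
    simp only [← hE] at h2
    linarith
  exact le_of_mul_le_mul_left h3 hr

end Hilbert

/-! ### Chaining along dyadic grids -/

section Chaining

variable {T : ℝ}

/-- The points of the dyadic grid of mesh `T / 2^k` in `[0,T]`. -/
def gridPt (hT : 0 ≤ T) (k j : ℕ) : Icc (0 : ℝ) T := projIcc 0 T hT (j * (T / 2 ^ k))

lemma gridPt_succ_two_mul (hT : 0 ≤ T) (k j : ℕ) : gridPt hT (k + 1) (2 * j) = gridPt hT k j := by
  unfold gridPt
  congr 1
  push_cast
  rw [pow_succ]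
  field_simp

lemma gridPt_zero (hT : 0 ≤ T) (k : ℕ) : gridPt hT k 0 = ⟨0, left_mem_Icc.2 hT⟩ := by
  simp [gridPt, projIcc_left]

lemma abs_gridPt_sub_le (hT : 0 ≤ T) (k j : ℕ) :
    |(gridPt hT k j : ℝ) - gridPt hT k (2 * (j / 2))| ≤ T / 2 ^ k := by
  refine (abs_projIcc_sub_projIcc hT).trans ?_
  have h1 : (0 : ℝ) ≤ T / 2 ^ k := by positivity
  rw [← sub_mul, abs_mul, abs_of_nonneg h1]
  refine mul_le_of_le_one_left h1 ?_
  have h2 : (j : ℝ) - (2 * (j / 2) : ℕ) = (j % 2 : ℕ) := by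
    rw [sub_eq_iff_eq_add]
    norm_cast
    omega
  rw [h2, Nat.abs_cast]
  exact_mod_cast Nat.lt_succ_iff.1 (Nat.mod_lt j two_pos)

lemma tendsto_gridPt (hT : 0 < T) (t : Icc (0 : ℝ) T) :
    Filter.Tendsto (fun m => gridPt hT.le m ⌊(t : ℝ) / (T / 2 ^ m)⌋₊) Filter.atTop (nhds t) := by
  rw [tendsto_iff_dist_tendsto_zero]
  have h0 : Filter.Tendsto (fun m : ℕ => T / 2 ^ m) Filter.atTop (nhds 0) := by
    have := (tendsto_pow_atTop_nhds_zero_of_lt_one (r := (1 / 2 : ℝ)) (by norm_num)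
      (by norm_num)).const_mul T
    simpa [div_eq_mul_inv] using this
  refine squeeze_zero (fun _ => dist_nonneg) (fun m => ?_) h0
  have hm : 0 < T / 2 ^ m := by positivity
  have h1 : t = projIcc 0 T hT.le (t : ℝ) := (projIcc_val hT.le t).symm
  rw [Subtype.dist_eq, Real.dist_eq]
  conv_lhs => rw [h1]
  refine (abs_projIcc_sub_projIcc hT.le).trans ?_
  have h2 := Nat.floor_le (div_nonneg t.2.1 hm.le)
  have h3 := Nat.lt_floor_add_one ((t : ℝ) / (T / 2 ^ m))
  rw [le_div_iff₀ hm] at h2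
  rw [div_lt_iff₀ hm] at h3
  rw [projIcc_val, abs_le]
  constructor <;> nlinarith

variable {E : Type*} [NormedAddCommGroup E]

/-- The largest increment of `S` along the links of level `k`. -/
def linkSup (hT : 0 ≤ T) (S : Icc (0 : ℝ) T → E) (k : ℕ) : ℝ :=
  ⨆ j : Fin (2 ^ k + 1), ‖S (gridPt hT k j) - S (gridPt hT k (2 * ((j : ℕ) / 2)))‖

lemma linkSup_nonneg (hT : 0 ≤ T) (S : Icc (0 : ℝ) T → E) (k : ℕ) : 0 ≤ linkSup hT S k :=
  Real.iSup_nonneg fun _ => norm_nonneg _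

/-- Point j of level k is linked to point ⌊j/2⌋ of level k-1, which is point 2⌊j/2⌋ of level k. At
level 0 both endpoints are linked to time 0. -/
lemma norm_gridPt_le (hT : 0 ≤ T) (S : Icc (0 : ℝ) T → E) (m : ℕ) :
    ∀ j ≤ 2 ^ m, ‖S (gridPt hT m j)‖
      ≤ ‖S ⟨0, left_mem_Icc.2 hT⟩‖ + ∑ k ∈ Finset.range (m + 1), linkSup hT S k := by
  have hlink : ∀ m, ∀ j ≤ 2 ^ m, ‖S (gridPt hT m j)‖
      ≤ ‖S (gridPt hT m (2 * (j / 2)))‖ + linkSup hT S m := by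
    intro m j hj
    have h1 := le_ciSup (f := fun j : Fin (2 ^ m + 1) =>
      ‖S (gridPt hT m j) - S (gridPt hT m (2 * ((j : ℕ) / 2)))‖) (finite_range _).bddAbove
      ⟨j, Nat.lt_succ_of_le hj⟩
    have h2 := norm_le_norm_add_norm_sub' (S (gridPt hT m j)) (S (gridPt hT m (2 * (j / 2))))
    exact h2.trans (add_le_add_right h1 _)
  induction m with
  | zero =>
    intro j hj
    have h := hlink 0 j hj
    rw [show 2 * (j / 2) = 0 by simp at hj; omega, gridPt_zero] at h
    simpa using h
  | succ m ih =>
    intro j hj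
    have h := hlink (m + 1) j hj
    rw [gridPt_succ_two_mul] at h
    have h2 := ih (j / 2) (by rw [pow_succ] at hj; omega)
    rw [Finset.sum_range_succ]
    linarith

lemma ofReal_norm_le_tsum_linkSup (hT : 0 < T) {S : Icc (0 : ℝ) T → E} (hS : Continuous S)
    (t : Icc (0 : ℝ) T) :
    ENNReal.ofReal ‖S t‖ ≤ ENNReal.ofReal ‖S ⟨0, left_mem_Icc.2 hT.le⟩‖
      + ∑' k, ENNReal.ofReal (linkSup hT.le S k) := by
  have h1 : Filter.Tendsto (fun m => ENNReal.ofReal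
      ‖S (gridPt hT.le m ⌊(t : ℝ) / (T / 2 ^ m)⌋₊)‖) Filter.atTop (nhds (ENNReal.ofReal ‖S t‖)) :=
    ((ENNReal.continuous_ofReal.comp (continuous_norm.comp hS)).tendsto t).comp
      (tendsto_gridPt hT t)
  refine le_of_tendsto' h1 fun m => ?_
  have hm : 0 < T / 2 ^ m := by positivity
  refine (ENNReal.ofReal_le_ofReal (norm_gridPt_le hT.le S m _ ?_)).trans ?_
  · refine Nat.floor_le_of_le ?_
    rw [div_le_iff₀ hm]
    push_cast
    rw [mul_div_cancel₀ _ (by positivity)]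
    exact t.2.2
  · rw [ENNReal.ofReal_add (norm_nonneg _) (Finset.sum_nonneg fun k _ => linkSup_nonneg _ _ _),
      ENNReal.ofReal_sum_of_nonneg fun k _ => linkSup_nonneg _ _ _]
    gcongr
    exact ENNReal.sum_le_tsum _

variable {H : Type*} [NormedAddCommGroup H] [InnerProductSpace ℝ H]
variable {ι : Type*} [Fintype ι] [DecidableEq ι]

/-- Chaining for Rademacher sums of continuous curves in a Hilbert space. -/
lemma sum_iSup_norm_sum_sgn_smul_le (hT : 0 < T) {v : ι → Icc (0 : ℝ) T → H}
    (hv : ∀ i, Continuous (v i)) {δ : ι → ℕ → ℝ}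
    (hδ : ∀ i k, ∀ s t : Icc (0 : ℝ) T, |(s : ℝ) - t| ≤ T / 2 ^ k → ‖v i s - v i t‖ ≤ δ i k) :
    ∑ ξ : ι → Bool, ⨆ t, ENNReal.ofReal ‖∑ i, sgn (ξ i) • v i t‖
      ≤ 2 ^ Fintype.card ι * (ENNReal.ofReal √(∑ i, ‖v i ⟨0, left_mem_Icc.2 hT.le⟩‖ ^ 2)
        + ∑' k : ℕ, ENNReal.ofReal (√(2 * (k + 2)) * √(∑ i, δ i k ^ 2))) := by
  set t₀ : Icc (0 : ℝ) T := ⟨0, left_mem_Icc.2 hT.le⟩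
  set S : (ι → Bool) → Icc (0 : ℝ) T → H := fun ξ t => ∑ i, sgn (ξ i) • v i t with hSdef
  have hS : ∀ ξ, Continuous (S ξ) := fun ξ =>
    continuous_finsetSum _ fun i _ => (hv i).const_smul (sgn (ξ i))
  have h2 : ((2 : ℝ≥0∞) ^ Fintype.card ι) = ENNReal.ofReal (2 ^ Fintype.card ι) := by
    rw [ENNReal.ofReal_pow zero_le_two]; simp
  have hlevel : ∀ k : ℕ, ∑ ξ, linkSup hT.le (S ξ) k
      ≤ 2 ^ Fintype.card ι * (√(2 * (k + 2)) * √(∑ i, δ i k ^ 2)) := by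
    intro k
    have h3 := sum_sup_norm_sum_sgn_smul_le (L := Fin (2 ^ k + 1)) (V := ∑ i, δ i k ^ 2)
      (fun j i => v i (gridPt hT.le k j) - v i (gridPt hT.le k (2 * ((j : ℕ) / 2)))) (fun j =>
        Finset.sum_le_sum fun i _ => pow_le_pow_left₀ (norm_nonneg _)
          (hδ i k _ _ (abs_gridPt_sub_le hT.le k j)) 2)
    have h4 : Real.log (2 * Fintype.card (Fin (2 ^ k + 1))) ≤ k + 2 := by
      -- Twice the number of links is at most 2^(k+2), and log 2 < 1.
      have h5 : (2 * (Fintype.card (Fin (2 ^ k + 1)) : ℝ)) ≤ 2 ^ (k + 2) := by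
        have : (1 : ℝ) ≤ 2 ^ k := one_le_pow₀ one_le_two
        rw [Fintype.card_fin]
        push_cast
        rw [pow_add]
        linarith
      have h6 : (0 : ℝ) < 2 * (Fintype.card (Fin (2 ^ k + 1)) : ℝ) := by
        rw [Fintype.card_fin]; positivity
      refine (Real.log_le_log h6 h5).trans ?_
      rw [Real.log_pow]
      push_cast
      have := Real.log_two_lt_d9
      have : (0 : ℝ) ≤ k := Nat.cast_nonneg k
      nlinarith
    rw [← Real.sqrt_mul (by positivity)]
    refine le_trans (le_of_eq (Finset.sum_congr rfl fun ξ _ => ?_)) (h3.trans ?_)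
    · simp only [linkSup, hSdef, ← Finset.sum_sub_distrib, smul_sub]
    · gcongr
  have hsum : ∀ ξ, ⨆ t, ENNReal.ofReal ‖S ξ t‖ ≤ ENNReal.ofReal ‖S ξ t₀‖
      + ∑' k, ENNReal.ofReal (linkSup hT.le (S ξ) k) := fun ξ =>
    iSup_le fun t => ofReal_norm_le_tsum_linkSup hT (hS ξ) t
  refine (Finset.sum_le_sum fun ξ _ => hsum ξ).trans ?_
  rw [Finset.sum_add_distrib, mul_add, h2]
  refine add_le_add ?_ ?_
  · rw [← ENNReal.ofReal_sum_of_nonneg fun _ _ => norm_nonneg _,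
      ← ENNReal.ofReal_mul (by positivity)]
    exact ENNReal.ofReal_le_ofReal (sum_norm_sum_sgn_smul_le fun i => v i t₀)
  · rw [← Summable.tsum_finsetSum fun _ _ => ENNReal.summable, ← ENNReal.tsum_mul_left]
    refine ENNReal.tsum_le_tsum fun k => ?_
    rw [← ENNReal.ofReal_sum_of_nonneg fun _ _ => linkSup_nonneg _ _ _,
      ← ENNReal.ofReal_mul (by positivity)]
    exact ENNReal.ofReal_le_ofReal (hlevel k)

end Chaining

/-! ### Rademacher sums over function classes -/

section FunctionClasses

variable {d n : ℕ} {T : ℝ}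

lemma bddAbove_pathModulus (x : PathSpace d T) (h : ℝ) :
    BddAbove (range fun p : {p : Icc (0 : ℝ) T × Icc (0 : ℝ) T // |(p.1 : ℝ) - (p.2 : ℝ)| ≤ h} =>
      ‖x p.1.1 - x p.1.2‖) := by
  refine ⟨‖x‖ + ‖x‖, ?_⟩
  rintro _ ⟨p, rfl⟩
  exact (norm_sub_le _ _).trans (add_le_add (x.norm_coe_le_norm _) (x.norm_coe_le_norm _))

lemma norm_sub_le_pathModulus (x : PathSpace d T) {h : ℝ} {s t : Icc (0 : ℝ) T}
    (hst : |(s : ℝ) - t| ≤ h) : ‖x s - x t‖ ≤ pathModulus x h :=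
  le_ciSup (bddAbove_pathModulus x h) ⟨(s, t), hst⟩

lemma pathModulus_nonneg (x : PathSpace d T) (h : ℝ) : 0 ≤ pathModulus x h :=
  Real.iSup_nonneg fun _ => norm_nonneg _

/-- The sum over all signs of the suprema of the signed sums over a class of functions along
paths. -/
def radSum (Φ : Set (Eucl d → ℝ)) (x : Fin n → PathSpace d T) : ℝ≥0∞ :=
  ∑ ξ : Fin n → Bool, ⨆ t, ⨆ f ∈ Φ, ENNReal.ofReal |∑ i, sgn (ξ i) * f (x i t)|

/-- The contribution of the increments to the chaining bound. -/
def chainTail (x : Fin n → PathSpace d T) : ℝ≥0∞ :=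
  ∑' k : ℕ, ENNReal.ofReal (√(2 * (k + 2)) * √(∑ i, pathModulus (x i) (T / 2 ^ k) ^ 2))

lemma sum_iSup_norm_sum_sgn_smul_comp_le (hT : 0 < T) {H : Type*} [NormedAddCommGroup H]
    [InnerProductSpace ℝ H] {φ : Eucl d → H} {K : ℝ} (hK : 0 ≤ K)
    (hφ : ∀ a b, ‖φ a - φ b‖ ≤ K * ‖a - b‖) (x : Fin n → PathSpace d T) {b : Fin n → ℝ}
    (hb : ∀ i t, ‖φ (x i t)‖ ^ 2 ≤ b i) :
    ∑ ξ : Fin n → Bool, ⨆ t, ENNReal.ofReal ‖∑ i, sgn (ξ i) • φ (x i t)‖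
      ≤ 2 ^ n * (ENNReal.ofReal √(∑ i, b i) + ENNReal.ofReal K * chainTail x) := by
  have hcont : Continuous φ := by
    refine (LipschitzWith.of_dist_le' (K := K) fun a b => ?_).continuous
    simpa [dist_eq_norm] using hφ a b
  have h := sum_iSup_norm_sum_sgn_smul_le hT (v := fun i t => φ (x i t))
    (fun i => hcont.comp (x i).continuous) (δ := fun i k => K * pathModulus (x i) (T / 2 ^ k))
    (fun i k s t hst => (hφ _ _).trans
      (mul_le_mul_of_nonneg_left (norm_sub_le_pathModulus (x i) hst) hK))
  rw [Fintype.card_fin] at h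
  refine h.trans ?_
  gcongr
  · exact hb _ _
  · rw [chainTail, ← ENNReal.tsum_mul_left]
    refine ENNReal.tsum_le_tsum fun k => ?_
    rw [← ENNReal.ofReal_mul hK]
    refine ENNReal.ofReal_le_ofReal (le_of_eq ?_)
    simp only [mul_pow, ← Finset.mul_sum]
    rw [Real.sqrt_mul (sq_nonneg K), Real.sqrt_sq hK]
    ring

/-! ### Unit balls of reproducing kernel Hilbert spaces -/

/-- The feature map of a reproducing kernel. -/
lemma IsReproducingKernel.exists_feature {H : Type*} [NormedAddCommGroup H]
    [InnerProductSpace ℝ H] [RKHS ℝ H (Eucl d) ℝ] {k : Eucl d → Eucl d → ℝ} {K₁ K₂ : ℝ}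
    (hk : IsReproducingKernel H k) (hK₁ : 0 < K₁)
    (hlip : ∀ x y, k x x + k y y - 2 * k x y ≤ K₁ ^ 2 * ‖x - y‖ ^ 2) (hK₂ : K₂ = √(k 0 0)) :
    ∃ φ : Eucl d → H, (∀ x (f : H), f x = inner ℝ f (φ x)) ∧
      (∀ x y, ‖φ x - φ y‖ ≤ K₁ * ‖x - y‖) ∧ ‖φ 0‖ = K₂ := by
  choose φ hφ hφ' using hk
  have hin : ∀ a b, inner ℝ (φ a) (φ b) = k a b := fun a b => by rw [← hφ' b (φ a), hφ]
  have hdist : ∀ a b, ‖φ a - φ b‖ ≤ K₁ * ‖a - b‖ := by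
    intro a b
    refine le_of_sq_le_sq ?_ (by positivity)
    rw [norm_sub_sq_real, ← real_inner_self_eq_norm_sq, ← real_inner_self_eq_norm_sq, hin, hin,
      hin, mul_pow]
    linarith [hlip a b]
  refine ⟨φ, hφ', hdist, ?_⟩
  rw [hK₂, ← hin, real_inner_self_eq_norm_sq, Real.sqrt_sq (norm_nonneg _)]

lemma radSum_rkhsUnitBall_le (hT : 0 < T) {H : Type*} [NormedAddCommGroup H]
    [InnerProductSpace ℝ H] [RKHS ℝ H (Eucl d) ℝ] {k : Eucl d → Eucl d → ℝ} {K₁ K₂ : ℝ}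
    (hk : IsReproducingKernel H k) (hK₁ : 0 < K₁)
    (hlip : ∀ x y, k x x + k y y - 2 * k x y ≤ K₁ ^ 2 * ‖x - y‖ ^ 2) (hK₂ : K₂ = √(k 0 0))
    (x : Fin n → PathSpace d T) :
    radSum (rkhsUnitBall H) x ≤ 2 ^ n *
      (ENNReal.ofReal √(∑ i, 2 * (K₁ ^ 2 * ‖x i‖ ^ 2 + K₂ ^ 2))
        + ENNReal.ofReal K₁ * chainTail x) := by
  obtain ⟨φ, hφ', hdist, h0⟩ := hk.exists_feature hK₁ hlip hK₂
  refine le_trans (Finset.sum_le_sum fun ξ _ => iSup_mono fun t => iSup₂_le fun f hf => ?_)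
    (sum_iSup_norm_sum_sgn_smul_comp_le hT hK₁.le hdist x fun i t => ?_)
  · obtain ⟨g, hg, hfg⟩ := hf
    refine ENNReal.ofReal_le_ofReal ?_
    have : ∑ i, sgn (ξ i) * f (x i t) = inner ℝ g (∑ i, sgn (ξ i) • φ (x i t)) := by
      simp only [inner_sum, inner_smul_right, hfg, hφ']
    rw [this]
    exact (abs_real_inner_le_norm _ _).trans (mul_le_of_le_one_left (norm_nonneg _) hg)
  · have h1 : ‖φ (x i t)‖ ≤ K₂ + K₁ * ‖x i‖ := by
      have h2 := norm_le_norm_add_norm_sub' (φ (x i t)) (φ 0)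
      have h3 := hdist (x i t) 0
      rw [sub_zero] at h3
      have h4 := mul_le_mul_of_nonneg_left ((x i).norm_coe_le_norm t) hK₁.le
      linarith
    have h5 := pow_le_pow_left₀ (norm_nonneg _) h1 2
    -- (K₂ + K₁‖x‖)² ≤ 2(K₁²‖x‖² + K₂²) produces the 2 under the square root.
    nlinarith [sq_nonneg (K₂ - K₁ * ‖x i‖)]

/-! ### Suprema over sets of vectors -/

lemma ofReal_signSup_le {ι : Type*} [Fintype ι] {A : Set (ι → ℝ)} (hA : A.Nonempty)
    {ξ : ι → Bool} {c : ℝ≥0∞} (h : ∀ y ∈ A, ENNReal.ofReal (signSum ξ y) ≤ c) :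
    ENNReal.ofReal (signSup A ξ) ≤ c := by
  rcases eq_or_ne c ∞ with rfl | hc
  · exact le_top
  refine ENNReal.ofReal_le_of_le_toReal (signSup_le hA fun y hy => ?_)
  exact (ENNReal.ofReal_le_iff_le_toReal hc).1 (h y hy)

lemma signSup_nonneg_of_neg_mem {ι : Type*} [Fintype ι] {A : Set (ι → ℝ)}
    (hA : A.Nonempty) {ζ : ι → ℝ} (h : ∀ y ∈ A, ∀ i, |y i| ≤ ζ i) (hneg : ∀ y ∈ A, -y ∈ A) (ξ : ι → Bool) :
    0 ≤ signSup A ξ := by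
  obtain ⟨y, hy⟩ := hA
  have h1 := le_signSup h ξ hy
  have h2 := le_signSup h ξ (hneg y hy)
  rw [signSum_neg] at h2
  linarith

lemma le_of_forall_pos_le_one_add_mul {a R : ℝ} (h : ∀ ε > 0, a ≤ (1 + ε) * R) : a ≤ R := by
  rcases le_or_gt R 0 with hR | hR
  · have := h 1 one_pos
    nlinarith
  · refine le_of_forall_pos_le_add fun δ hδ => ?_
    have := h (δ / R) (by positivity)
    rwa [add_mul, one_mul, div_mul_cancel₀ _ hR.ne'] at this

end FunctionClasses

section Barron

variable {d n : ℕ} {T : ℝ}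

/-! ### The unit ball of the Barron space -/

/-- The embedding `x ↦ (x, 1)`. -/
def barronEmbed (x : Eucl d) : WithLp 2 (Eucl d × ℝ) := WithLp.toLp 2 (x, 1)

lemma norm_barronEmbed_sq (x : Eucl d) : ‖barronEmbed x‖ ^ 2 = ‖x‖ ^ 2 + 1 := by
  rw [WithLp.prod_norm_sq_eq_of_L2]
  simp [barronEmbed]

lemma norm_barronEmbed_sub (x y : Eucl d) : ‖barronEmbed x - barronEmbed y‖ = ‖x - y‖ := by
  rw [← sq_eq_sq₀ (norm_nonneg _) (norm_nonneg _), WithLp.prod_norm_sq_eq_of_L2]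
  simp [barronEmbed]

lemma inner_barronEmbed (p : WithLp 2 (Eucl d × ℝ)) (x : Eucl d) :
    inner ℝ p (barronEmbed x) = inner ℝ p.fst x + p.snd := by
  rw [WithLp.prod_inner_apply]
  simp [barronEmbed]

lemma exists_barronRepr {f : Eucl d → ℝ} (hf : f ∈ barronUnitBall d) {ε : ℝ} (hε : 0 < ε) :
    ∃ ρ, IsBarronRepr ρ f ∧ tvNorm ρ ≤ 1 + ε := by
  obtain ⟨⟨ρ₀, h₀⟩, h1⟩ := hf
  -- Excludes the default value 0 of an infimum over the empty set.
  have : Nonempty {ρ : SignedMeasure (BarronSphere d) // IsBarronRepr ρ f} := ⟨⟨ρ₀, h₀⟩⟩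
  obtain ⟨⟨ρ, hρ⟩, h⟩ := exists_lt_of_ciInf_lt (show barronNorm f < 1 + ε by linarith)
  exact ⟨ρ, hρ, h.le⟩

lemma continuous_relu_barron (x : Eucl d) : Continuous fun p : BarronSphere d =>
    relu (inner ℝ (p : WithLp 2 (Eucl d × ℝ)).fst x + (p : WithLp 2 (Eucl d × ℝ)).snd) := by
  simp only [← inner_barronEmbed]
  exact continuous_relu.comp (continuous_subtype_val.inner continuous_const)

/-- The sum is linear in ρ, so a bound for single neurons passes to the unit ball; ε allows for an
infimum that is not attained. -/
lemma abs_sum_mul_barron_le {f : Eucl d → ℝ} (hf : f ∈ barronUnitBall d) {κ : Type*} [Fintype κ]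
    (c : κ → ℝ) (x : κ → Eucl d) {R : ℝ} (hR0 : 0 ≤ R)
    (hR : ∀ p : BarronSphere d,
      |∑ i, c i * relu (inner ℝ (p : WithLp 2 (Eucl d × ℝ)) (barronEmbed (x i)))| ≤ R) :
    |∑ i, c i * f (x i)| ≤ R := by
  refine le_of_forall_pos_le_one_add_mul fun ε hε => ?_
  obtain ⟨ρ, hρ, hρ1⟩ := exists_barronRepr hf hε
  simp only [hρ _]
  rw [← signedIntegral_sum ρ _ c fun i => continuous_relu_barron (x i)]
  refine (abs_signedIntegral_le ρ fun p => ?_).trans (mul_le_mul_of_nonneg_right hρ1 hR0)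
  simpa only [inner_barronEmbed] using hR p

/-- The linear half of σ is handled by chaining for x ↦ (x,1). Linearizing the absolute value costs
√2·√(∑ζ_i²) and leaves the chaining term with factor 1. -/
lemma radSum_barronUnitBall_le (hn : 0 < n) (hT : 0 < T) (x : Fin n → PathSpace d T) :
    radSum (barronUnitBall d) x ≤ 2 ^ n *
      (ENNReal.ofReal ((1 + √2) * √(∑ i, (‖x i‖ ^ 2 + 1))) + chainTail x) := by
  set ζ : Fin n → ℝ := fun i => √(‖x i‖ ^ 2 + 1) with hζ
  have hζ2 : ∀ i, ζ i ^ 2 = ‖x i‖ ^ 2 + 1 := fun i => Real.sq_sqrt (by positivity)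
  have hζ0 : ∀ i, 0 ≤ ζ i := fun i => Real.sqrt_nonneg _
  have hz : ∀ i t, ‖barronEmbed (x i t)‖ ^ 2 ≤ ‖x i‖ ^ 2 + 1 := by
    intro i t
    rw [norm_barronEmbed_sq]
    have := (x i).norm_coe_le_norm t
    gcongr
  have hpos : 0 < ∑ i, ζ i ^ 2 := by
    have : Nonempty (Fin n) := ⟨⟨0, hn⟩⟩
    refine Finset.sum_pos (fun i _ => ?_) Finset.univ_nonempty
    rw [hζ2]; positivity
  set I : Set (Fin n → ℝ) := {y | ∃ (t : Icc (0 : ℝ) T) (p : BarronSphere d),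
    y = fun i => inner ℝ (p : WithLp 2 (Eucl d × ℝ)) (barronEmbed (x i t))} with hI
  have hnorm : ∀ p : BarronSphere d, ‖(p : WithLp 2 (Eucl d × ℝ))‖ = 1 := fun p => by simp
  have hIne : I.Nonempty := by
    refine ⟨_, ⟨0, left_mem_Icc.2 hT.le⟩, ⟨WithLp.toLp 2 (0, 1), ?_⟩, rfl⟩
    rw [mem_sphere_zero_iff_norm, ← sq_eq_sq₀ (norm_nonneg _) zero_le_one,
      WithLp.prod_norm_sq_eq_of_L2]
    simp
  have hIζ : ∀ y ∈ I, ∀ i, |y i| ≤ ζ i := by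
    rintro _ ⟨t, p, rfl⟩ i
    refine (abs_real_inner_le_norm _ _).trans ?_
    rw [hnorm, one_mul]
    exact Real.le_sqrt_of_sq_le (hz i t)
  have hIneg : ∀ y ∈ I, -y ∈ I := by
    rintro _ ⟨t, p, rfl⟩
    exact ⟨t, -p, by funext i; simp [inner_neg_left]⟩
  set S := signSup ((fun (y : Fin n → ℝ) i => |y i|) '' I) with hS
  set B : (Fin n → Bool) → ℝ := fun ξ => max (signSup I ξ) (max (S ξ) (S fun i => !ξ i)) with hB
  have habs : ∀ y ∈ (fun (y : Fin n → ℝ) i => |y i|) '' I, ∀ i, |y i| ≤ ζ i := by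
    rintro _ ⟨y, hy, rfl⟩ i
    simpa using hIζ y hy i
  -- D = 1 imposes nothing beyond |y_i| ≤ ζ_i, so all three sets can be I.
  have hmain := sum_abs_signSum_abs_le hIne hIne one_pos hζ0 hpos hIζ hIneg Subset.rfl
    Subset.rfl (fun y hy i => by rw [one_mul]; exact neg_le_of_abs_le (hIζ y hy i)) (B := B)
    (fun ξ => le_rfl)
  have hI0 : ∀ ξ, 0 ≤ signSup I ξ := signSup_nonneg_of_neg_mem hIne hIζ hIneg
  have hB0 : ∀ ξ, 0 ≤ B ξ := fun ξ => (hI0 ξ).trans (le_max_left _ _)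
  have hpoint : ∀ ξ t, ∀ f ∈ barronUnitBall d,
      |∑ i, sgn (ξ i) * f (x i t)| ≤ (signSup I ξ + B ξ) / 2 := by
    intro ξ t f hf
    refine abs_sum_mul_barron_le hf _ _ (by linarith [hI0 ξ, hB0 ξ]) fun p => ?_
    set y : Fin n → ℝ := fun i => inner ℝ (p : WithLp 2 (Eucl d × ℝ)) (barronEmbed (x i t))
    have hy : y ∈ I := ⟨t, p, rfl⟩
    have h1 : ∑ i, sgn (ξ i) * relu (y i) = (signSum ξ y + signSum ξ fun i => |y i|) / 2 := by
      simp only [relu_eq, signSum, ← Finset.sum_add_distrib, Finset.sum_div]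
      exact Finset.sum_congr rfl fun i _ => by ring
    change |∑ i, sgn (ξ i) * relu (y i)| ≤ _
    rw [h1, abs_div, abs_two]
    refine div_le_div_of_nonneg_right ((abs_add_le _ _).trans (add_le_add ?_ ?_)) zero_le_two
    · refine abs_le'.2 ⟨le_signSup hIζ ξ hy, ?_⟩
      rw [← signSum_neg]
      exact le_signSup hIζ ξ (hIneg y hy)
    · have hy' : (fun i => |y i|) ∈ (fun (y : Fin n → ℝ) i => |y i|) '' I := ⟨y, hy, rfl⟩
      refine abs_le'.2 ⟨?_, ?_⟩
      · exact (le_signSup habs ξ hy').trans ((le_max_left _ _).trans (le_max_right _ _))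
      · rw [← signSum_not]
        exact (le_signSup habs _ hy').trans ((le_max_right _ _).trans (le_max_right _ _))
  have hsum : ∑ ξ, (signSup I ξ + B ξ) / 2
      ≤ ∑ ξ, signSup I ξ + 2 ^ n * (√2 * √(∑ i, (‖x i‖ ^ 2 + 1))) := by
    rw [← Finset.sum_div, Finset.sum_add_distrib]
    simp only [hζ2, Fintype.card_fin] at hmain
    norm_num at hmain
    linarith
  have hm := sum_iSup_norm_sum_sgn_smul_comp_le hT zero_le_one (φ := barronEmbed)
    (fun a b => by rw [norm_barronEmbed_sub, one_mul]) x hz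
  rw [ENNReal.ofReal_one, one_mul] at hm
  have h2 : ((2 : ℝ≥0∞) ^ n) = ENNReal.ofReal (2 ^ n) := by
    rw [ENNReal.ofReal_pow zero_le_two]; simp
  calc radSum (barronUnitBall d) x
      ≤ ∑ ξ : Fin n → Bool, ENNReal.ofReal ((signSup I ξ + B ξ) / 2) :=
        Finset.sum_le_sum fun ξ _ => iSup_le fun t => iSup₂_le fun f hf =>
          ENNReal.ofReal_le_ofReal (hpoint ξ t f hf)
    _ = ENNReal.ofReal (∑ ξ, (signSup I ξ + B ξ) / 2) := by
        rw [ENNReal.ofReal_sum_of_nonneg fun ξ _ => by linarith [hI0 ξ, hB0 ξ]]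
    _ ≤ ENNReal.ofReal (∑ ξ, signSup I ξ + 2 ^ n * (√2 * √(∑ i, (‖x i‖ ^ 2 + 1)))) :=
        ENNReal.ofReal_le_ofReal hsum
    _ = ∑ ξ, ENNReal.ofReal (signSup I ξ)
          + 2 ^ n * ENNReal.ofReal (√2 * √(∑ i, (‖x i‖ ^ 2 + 1))) := by
        rw [ENNReal.ofReal_add (Finset.sum_nonneg fun ξ _ => hI0 ξ) (by positivity),
          ENNReal.ofReal_sum_of_nonneg fun ξ _ => hI0 ξ, h2, ENNReal.ofReal_mul (by positivity)]
    _ ≤ 2 ^ n * (ENNReal.ofReal √(∑ i, (‖x i‖ ^ 2 + 1)) + chainTail x)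
          + 2 ^ n * ENNReal.ofReal (√2 * √(∑ i, (‖x i‖ ^ 2 + 1))) := by
        gcongr
        refine (Finset.sum_le_sum fun ξ _ => ?_).trans hm
        refine ofReal_signSup_le hIne ?_
        rintro _ ⟨t, p, rfl⟩
        refine le_iSup_of_le t (ENNReal.ofReal_le_ofReal ?_)
        have : signSum ξ (fun i => inner ℝ (p : WithLp 2 (Eucl d × ℝ)) (barronEmbed (x i t)))
            = inner ℝ (p : WithLp 2 (Eucl d × ℝ)) (∑ i, sgn (ξ i) • barronEmbed (x i t)) := by
          simp only [signSum, inner_sum, inner_smul_right]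
        rw [this]
        refine (real_inner_le_norm _ _).trans ?_
        rw [hnorm, one_mul]
    _ = _ := by
        rw [add_mul, one_mul, ENNReal.ofReal_add (by positivity) (by positivity)]
        ring

end Barron

section FlowSpace

variable {d n D : ℕ} {T : ℝ}

/-! ### The unit ball of the flow-induced function space -/

lemma sum_flowEmbed_eq (hD : d + 1 ≤ D) (g : Fin d → ℝ) (c : ℝ) :
    ∑ j : Fin D, (if h : (j : ℕ) < d then g ⟨j, h⟩ else if (j : ℕ) = d then c else 0)
      = ∑ j, g j + c := by
  set G : ℕ → ℝ := fun j => if h : j < d then g ⟨j, h⟩ else if j = d then c else 0 with hG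
  have h1 : ∑ j : Fin D, G j = ∑ j ∈ Finset.range D, G j := Fin.sum_univ_eq_sum_range G D
  have h2 : ∑ j ∈ Finset.range D, G j = ∑ j ∈ Finset.range (d + 1), G j := by
    refine (Finset.sum_subset (Finset.range_mono hD) fun j _ hj => ?_).symm
    have hj' : d + 1 ≤ j := by simpa using hj
    simp only [hG]
    rw [dif_neg (by omega), if_neg (by omega)]
  have h3 : ∑ j ∈ Finset.range d, G j = ∑ j : Fin d, g j := by
    rw [← Fin.sum_univ_eq_sum_range]
    exact Finset.sum_congr rfl fun j _ => by simp [hG]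
  change ∑ j : Fin D, G j = _
  rw [h1, h2, Finset.sum_range_succ, h3]
  simp [hG]

lemma norm_flowEmbed_sq (hD : d + 1 ≤ D) (x : Eucl d) : ‖flowEmbed D x‖ ^ 2 = ‖x‖ ^ 2 + 1 := by
  rw [Eucl.norm_sq_eq, Eucl.norm_sq_eq, ← sum_flowEmbed_eq hD]
  refine Finset.sum_congr rfl fun j _ => ?_
  simp only [flowEmbed]
  split_ifs <;> simp

lemma norm_flowEmbed_sub (hD : d + 1 ≤ D) (x y : Eucl d) :
    ‖flowEmbed D x - flowEmbed D y‖ = ‖x - y‖ := by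
  rw [← sq_eq_sq₀ (norm_nonneg _) (norm_nonneg _), Eucl.norm_sq_eq, Eucl.norm_sq_eq,
    ← add_zero (∑ j, (x - y).ofLp j ^ 2), ← sum_flowEmbed_eq hD]
  refine Finset.sum_congr rfl fun j _ => ?_
  simp only [flowEmbed, PiLp.sub_apply]
  split_ifs <;> simp

lemma exists_flowRepr {f : Eucl d → ℝ} (hf : f ∈ flowUnitBall d D) {ε : ℝ} (hε : 0 < ε) :
    ∃ (ρ : FlowField D) (a : Eucl D), IsFlowRepr ρ a f ∧ ‖a‖ * Real.exp (ρ.arc 1) ≤ 1 + ε := by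
  have h1 : flowNorm D f < ENNReal.ofReal (1 + ε) :=
    hf.2.trans_lt (by rw [← ENNReal.ofReal_one]; exact (ENNReal.ofReal_lt_ofReal_iff
      (by linarith)).2 (by linarith))
  simp only [flowNorm, iInf_lt_iff] at h1
  obtain ⟨ρ, a, h, hlt⟩ := h1
  refine ⟨ρ, a, h, ?_⟩
  rw [FlowField.arc_one]
  exact ((ENNReal.ofReal_lt_ofReal_iff (by linarith)).1 hlt).le

/-- ⟨a, Z(1)⟩ is ‖a‖e^(arc 1), at most 1 + ε, times a profile in the direction a/‖a‖: the flow norm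
contains exactly the normalization of the profiles. -/
lemma abs_sum_mul_flow_le {f : Eucl d → ℝ} (hf : f ∈ flowUnitBall d D) {ι κ : Type*} [Fintype ι]
    (ξ : ι → Bool) (x : ι → κ → Eucl d) {R : ℝ} (hR0 : 0 ≤ R)
    (hR : ∀ ℓ, 0 ≤ ℓ → ∀ y ∈ FlowField.profiles (fun i t => flowEmbed D (x i t)) ℓ,
      |signSum ξ y| ≤ R) (t : κ) :
    |∑ i, sgn (ξ i) * f (x i t)| ≤ R := by
  refine le_of_forall_pos_le_one_add_mul fun ε hε => ?_
  obtain ⟨ρ, a, ⟨hρ, hrep⟩, hle⟩ := exists_flowRepr hf hε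
  choose Z hZ hfZ using fun i => hrep (x i t)
  simp only [hfZ]
  rcases eq_or_ne a 0 with rfl | ha
  · simp only [inner_zero_left, mul_zero, Finset.sum_const_zero, abs_zero]
    positivity
  have ha' : 0 < ‖a‖ := norm_pos_iff.2 ha
  set ω : FlowSphere D := ⟨‖a‖⁻¹ • a, by simp [norm_smul, ha'.ne']⟩ with hω
  have haω : a = ‖a‖ • (ω : Eucl D) := by simp [hω, smul_smul, ha'.ne']
  have h1 := hR (ρ.arc 1) (FlowField.arc_nonneg hρ.2 zero_le_one) _
    ⟨ρ, t, Z, 1, ω, hρ.2, hZ, right_mem_Icc.2 zero_le_one, rfl, rfl⟩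
  have h2 : ∑ i, sgn (ξ i) * inner ℝ a (Z i 1) = ‖a‖ * Real.exp (ρ.arc 1) *
      signSum ξ (fun i => Real.exp (-ρ.arc 1) * inner ℝ (ω : Eucl D) (Z i 1)) := by
    have h3 : Real.exp (ρ.arc 1) * Real.exp (-ρ.arc 1) = 1 := by rw [← Real.exp_add]; simp
    conv_lhs => rw [haω]
    simp only [signSum, Finset.mul_sum, inner_smul_left, conj_trivial]
    refine Finset.sum_congr rfl fun i _ => ?_
    linear_combination (-(sgn (ξ i) * ‖a‖ * inner ℝ (ω : Eucl D) (Z i 1))) * h3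
  rw [h2, abs_mul, abs_of_nonneg (by positivity : 0 ≤ ‖a‖ * Real.exp (ρ.arc 1))]
  exact mul_le_mul hle h1 (abs_nonneg _) (by linarith)

/-- The profiles at ℓ = 0 are dominated by the embedded curves, to which chaining applies; the
larger ℓ contribute the additive 9.41. -/
lemma radSum_flowUnitBall_le (hn : 0 < n) (hT : 0 < T) (hD : d + 1 ≤ D)
    (x : Fin n → PathSpace d T) :
    radSum (flowUnitBall d D) x ≤ 2 ^ n *
      (ENNReal.ofReal (1041 / 100 * √(∑ i, (‖x i‖ ^ 2 + 1))) + chainTail x) := by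
  set ζ : Fin n → ℝ := fun i => √(‖x i‖ ^ 2 + 1) with hζ
  have hζ2 : ∀ i, ζ i ^ 2 = ‖x i‖ ^ 2 + 1 := fun i => Real.sq_sqrt (by positivity)
  have hz2 : ∀ i t, ‖flowEmbed D (x i t)‖ ^ 2 ≤ ‖x i‖ ^ 2 + 1 := by
    intro i t
    rw [norm_flowEmbed_sq hD]
    have := (x i).norm_coe_le_norm t
    gcongr
  have hz : ∀ i t, ‖flowEmbed D (x i t)‖ ≤ ζ i := fun i t => Real.le_sqrt_of_sq_le (hz2 i t)
  have hpos : 0 < ∑ i, ζ i ^ 2 := by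
    have : Nonempty (Fin n) := ⟨⟨0, hn⟩⟩
    refine Finset.sum_pos (fun i _ => ?_) Finset.univ_nonempty
    rw [hζ2]; positivity
  have : Nonempty (Icc (0 : ℝ) T) := ⟨⟨0, left_mem_Icc.2 hT.le⟩⟩
  let ω₀ : FlowSphere D := ⟨EuclideanSpace.single ⟨0, by omega⟩ 1, by simp⟩
  set Y := FlowField.profiles (fun i t => flowEmbed D (x i t)) with hYdef
  have hY : IsDecayingFamily Y ζ := FlowField.isDecayingFamily_profiles hz ω₀
  set A : Set (Fin n → ℝ) := ⋃ ℓ ∈ Ici (0 : ℝ), Y ℓ with hA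
  have hAζ : ∀ y ∈ A, ∀ i, |y i| ≤ ζ i := fun y hy => by
    obtain ⟨ℓ, -, h⟩ := mem_iUnion₂.1 hy
    exact hY.abs_le ℓ y h
  have hAneg : ∀ y ∈ A, -y ∈ A := fun y hy => by
    obtain ⟨ℓ, h0, h⟩ := mem_iUnion₂.1 hy
    exact mem_iUnion₂.2 ⟨ℓ, h0, hY.neg_mem ℓ y h⟩
  have hAne : A.Nonempty := by
    obtain ⟨y, hy⟩ := hY.zero_nonempty
    exact ⟨y, mem_iUnion₂.2 ⟨0, self_mem_Ici, hy⟩⟩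
  have hA0 : ∀ ξ, 0 ≤ signSup A ξ := signSup_nonneg_of_neg_mem hAne hAζ hAneg
  have hY0 : ∀ ξ, 0 ≤ signSup (Y 0) ξ :=
    signSup_nonneg_of_neg_mem hY.zero_nonempty (hY.abs_le 0) (hY.neg_mem 0)
  have hpoint : ∀ ξ t, ∀ f ∈ flowUnitBall d D,
      |∑ i, sgn (ξ i) * f (x i t)| ≤ signSup A ξ := by
    intro ξ t f hf
    refine abs_sum_mul_flow_le hf ξ (fun i t => x i t) (hA0 ξ) (fun ℓ hℓ y hy => ?_) t
    have hyA : y ∈ A := mem_iUnion₂.2 ⟨ℓ, hℓ, hy⟩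
    refine abs_le'.2 ⟨le_signSup hAζ ξ hyA, ?_⟩
    rw [← signSum_neg]
    exact le_signSup hAζ ξ (hAneg y hyA)
  have hsum := hY.sum_signSup_iUnion_le hpos
  simp only [hζ2, Fintype.card_fin] at hsum
  have hm := sum_iSup_norm_sum_sgn_smul_comp_le hT zero_le_one (φ := flowEmbed D)
    (fun a b => by rw [norm_flowEmbed_sub hD, one_mul]) x hz2
  rw [ENNReal.ofReal_one, one_mul] at hm
  have h2 : ((2 : ℝ≥0∞) ^ n) = ENNReal.ofReal (2 ^ n) := by
    rw [ENNReal.ofReal_pow zero_le_two]; simp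
  calc radSum (flowUnitBall d D) x
      ≤ ∑ ξ : Fin n → Bool, ENNReal.ofReal (signSup A ξ) :=
        Finset.sum_le_sum fun ξ _ => iSup_le fun t => iSup₂_le fun f hf =>
          ENNReal.ofReal_le_ofReal (hpoint ξ t f hf)
    _ = ENNReal.ofReal (∑ ξ, signSup A ξ) := by
        rw [ENNReal.ofReal_sum_of_nonneg fun ξ _ => hA0 ξ]
    _ ≤ ENNReal.ofReal (∑ ξ, signSup (Y 0) ξ + 2 ^ n * (941 / 100 * √(∑ i, (‖x i‖ ^ 2 + 1)))) :=
        ENNReal.ofReal_le_ofReal hsum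
    _ = ∑ ξ, ENNReal.ofReal (signSup (Y 0) ξ)
          + 2 ^ n * ENNReal.ofReal (941 / 100 * √(∑ i, (‖x i‖ ^ 2 + 1))) := by
        rw [ENNReal.ofReal_add (Finset.sum_nonneg fun ξ _ => hY0 ξ) (by positivity),
          ENNReal.ofReal_sum_of_nonneg fun ξ _ => hY0 ξ, h2, ENNReal.ofReal_mul (by positivity)]
    _ ≤ 2 ^ n * (ENNReal.ofReal √(∑ i, (‖x i‖ ^ 2 + 1)) + chainTail x)
          + 2 ^ n * ENNReal.ofReal (941 / 100 * √(∑ i, (‖x i‖ ^ 2 + 1))) := by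
        gcongr
        refine (Finset.sum_le_sum fun ξ _ => ?_).trans hm
        refine ofReal_signSup_le hY.zero_nonempty fun y hy => ?_
        obtain ⟨t, ht⟩ := FlowField.signSum_profiles_zero_le hz ξ hy
        exact le_iSup_of_le t (ENNReal.ofReal_le_ofReal ht)
    _ = _ := by
        rw [show (1041 / 100 : ℝ) = 1 + 941 / 100 by norm_num, add_mul, one_mul,
          ENNReal.ofReal_add (by positivity) (by positivity)]
        ring

end FlowSpace

section Symmetrization

variable {d n : ℕ} {T : ℝ}

/-! ### Symmetrization -/

/-- Continuous functions of uniformly linear growth. -/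
structure IsGrowthClass (Φ : Set (Eucl d → ℝ)) : Prop where
  continuous : ∀ f ∈ Φ, Continuous f
  growth : ∃ c, ∀ f ∈ Φ, ∀ x, |f x| ≤ c * (1 + ‖x‖)

lemma continuous_eval_path (t : Icc (0 : ℝ) T) : Continuous fun x : PathSpace d T => x t :=
  continuous_eval_const t

lemma iSup_norm_sq_eq (hT : 0 < T) (x : PathSpace d T) : ⨆ t, ‖x t‖ ^ 2 = ‖x‖ ^ 2 := by
  have : Nonempty (Icc (0 : ℝ) T) := ⟨⟨0, left_mem_Icc.2 hT.le⟩⟩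
  have hbdd : ∀ t, ‖x t‖ ^ 2 ≤ ‖x‖ ^ 2 := fun t =>
    pow_le_pow_left₀ (norm_nonneg _) (x.norm_coe_le_norm t) 2
  refine le_antisymm (ciSup_le hbdd) ?_
  have h0 : 0 ≤ ⨆ t, ‖x t‖ ^ 2 := Real.iSup_nonneg fun t => sq_nonneg _
  rw [← Real.le_sqrt (norm_nonneg _) h0, ContinuousMap.norm_le _ (Real.sqrt_nonneg _)]
  exact fun t => Real.le_sqrt_of_sq_le
    (le_ciSup (f := fun t => ‖x t‖ ^ 2) ⟨_, by rintro _ ⟨t, rfl⟩; exact hbdd t⟩ t)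

lemma iSup_norm_sq_add_one_eq (hT : 0 < T) (x : PathSpace d T) :
    ⨆ t, (‖x t‖ ^ 2 + 1) = ‖x‖ ^ 2 + 1 := by
  have : Nonempty (Icc (0 : ℝ) T) := ⟨⟨0, left_mem_Icc.2 hT.le⟩⟩
  rw [← iSup_norm_sq_eq hT, ciSup_add]
  exact ⟨‖x‖ ^ 2, by
    rintro _ ⟨t, rfl⟩
    exact pow_le_pow_left₀ (norm_nonneg _) (x.norm_coe_le_norm t) 2⟩

lemma integral_empiricalMeasure (x : Fin n → Eucl d) (f : Eucl d → ℝ) :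
    ∫ y, f y ∂(empiricalMeasure x) = (n : ℝ)⁻¹ * ∑ i, f (x i) := by
  rw [empiricalMeasure, integral_smul_measure, integral_finsetSum_measure]
  · simp [integral_dirac]
  · intro i _
    exact integrable_dirac (by simp)

variable {μ : Measure (PathSpace d T)}

lemma integral_marginal (t : Icc (0 : ℝ) T) {f : Eucl d → ℝ} (hf : Continuous f) :
    ∫ y, f y ∂(marginal μ t) = ∫ y, f (y t) ∂μ :=
  integral_map (continuous_eval_path t).measurable.aemeasurable hf.aestronglyMeasurable

variable {Φ : Set (Eucl d → ℝ)}

lemma supGmmd_eq (hΦ : IsGrowthClass Φ) (x : Fin n → PathSpace d T) :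
    supGmmd Φ μ x = ⨆ t, ⨆ f ∈ Φ,
      ENNReal.ofReal |∫ y, f (y t) ∂μ - (n : ℝ)⁻¹ * ∑ i, f (x i t)| := by
  refine iSup_congr fun t => iSup_congr fun f => iSup_congr fun hf => ?_
  rw [integral_marginal t (hΦ.continuous f hf), integral_empiricalMeasure]

/-- Uncountable suprema of continuous functions are lower semicontinuous, hence measurable. -/
lemma measurable_iSup_ofReal_abs {S : Type*} [TopologicalSpace S] [MeasurableSpace S]
    [OpensMeasurableSpace S] {g : Icc (0 : ℝ) T → (Eucl d → ℝ) → S → ℝ}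
    (hg : ∀ t, ∀ f ∈ Φ, Continuous (g t f)) :
    Measurable fun s => ⨆ t, ⨆ f ∈ Φ, ENNReal.ofReal |g t f s| := by
  refine LowerSemicontinuous.measurable ?_
  refine lowerSemicontinuous_iSup fun t => lowerSemicontinuous_biSup fun f hf => ?_
  exact (ENNReal.continuous_ofReal.comp (hg t f hf).abs).lowerSemicontinuous

lemma IsGrowthClass.continuous_eval (hΦ : IsGrowthClass Φ) {f : Eucl d → ℝ} (hf : f ∈ Φ)
    (t : Icc (0 : ℝ) T) : Continuous fun x : PathSpace d T => f (x t) :=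
  (hΦ.continuous f hf).comp (continuous_eval_path t)

lemma measurable_supGmmd (hΦ : IsGrowthClass Φ) :
    Measurable fun x : Fin n → PathSpace d T => supGmmd Φ μ x := by
  simp only [supGmmd_eq hΦ]
  refine measurable_iSup_ofReal_abs fun t f hf => continuous_const.sub (continuous_const.mul ?_)
  exact continuous_finsetSum _ fun i _ => (hΦ.continuous_eval hf t).comp (continuous_apply i)

lemma measurable_radSum (hΦ : IsGrowthClass Φ) :
    Measurable fun x : Fin n → PathSpace d T => radSum Φ x := by
  refine Finset.measurable_fun_sum _ fun ξ _ => measurable_iSup_ofReal_abs fun t f hf => ?_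
  exact continuous_finsetSum _ fun i _ =>
    continuous_const.mul ((hΦ.continuous_eval hf t).comp (continuous_apply i))

lemma integrable_eval [IsProbabilityMeasure μ]
    (hμ : Integrable (fun x : PathSpace d T => ‖x‖ ^ 2) μ) (hΦ : IsGrowthClass Φ)
    {f : Eucl d → ℝ} (hf : f ∈ Φ) (t : Icc (0 : ℝ) T) : Integrable (fun x => f (x t)) μ := by
  obtain ⟨c, hc⟩ := hΦ.growth
  have h1 : Integrable (fun x : PathSpace d T => |c| * (2 + ‖x‖ ^ 2)) μ :=
    ((integrable_const 2).add hμ).const_mul _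
  refine h1.mono' (hΦ.continuous_eval hf t).aestronglyMeasurable
    (Filter.Eventually.of_forall fun x => ?_)
  have h2 : 1 + ‖x t‖ ≤ 2 + ‖x‖ ^ 2 := by
    have := x.norm_coe_le_norm t
    nlinarith [sq_nonneg (‖x‖ - 1), norm_nonneg x]
  have h3 : 0 ≤ 1 + ‖x t‖ := by positivity
  exact (hc f hf (x t)).trans ((mul_le_mul_of_nonneg_right (le_abs_self c) h3).trans
    (mul_le_mul_of_nonneg_left h2 (abs_nonneg c)))

/-- The supremum over the class of the differences between two samples. -/
def ghostSup (Φ : Set (Eucl d → ℝ)) (ξ : Fin n → Bool)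
    (w : Fin n → PathSpace d T × PathSpace d T) : ℝ≥0∞ :=
  ⨆ t, ⨆ f ∈ Φ, ENNReal.ofReal |∑ i, sgn (ξ i) * (f ((w i).1 t) - f ((w i).2 t))|

lemma measurable_ghostSup (hΦ : IsGrowthClass Φ) (ξ : Fin n → Bool) :
    Measurable (ghostSup (T := T) Φ ξ) := by
  refine measurable_iSup_ofReal_abs fun t f hf => continuous_finsetSum _ fun i _ => ?_
  exact continuous_const.mul
    (((hΦ.continuous_eval hf t).comp (continuous_fst.comp (continuous_apply i))).sub
      ((hΦ.continuous_eval hf t).comp (continuous_snd.comp (continuous_apply i))))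

variable [IsProbabilityMeasure μ]

/-- The law of pairs of independent samples. -/
abbrev pairLaw (n : ℕ) (μ : Measure (PathSpace d T)) :
    Measure (Fin n → PathSpace d T × PathSpace d T) := Measure.pi fun _ => μ.prod μ

/-- Exchanging the two paths of a pair preserves the product law and flips the sign of its term. -/
lemma lintegral_ghostSup (hΦ : IsGrowthClass Φ) (ξ ξ' : Fin n → Bool) :
    ∫⁻ w, ghostSup Φ ξ w ∂(pairLaw n μ) = ∫⁻ w, ghostSup Φ ξ' w ∂(pairLaw n μ) := by
  set s : Fin n → PathSpace d T × PathSpace d T → PathSpace d T × PathSpace d T :=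
    fun i => if ξ i = ξ' i then id else Prod.swap with hs
  have hmp : MeasurePreserving (fun (w : Fin n → PathSpace d T × PathSpace d T) i => s i (w i))
      (pairLaw n μ) (pairLaw n μ) := by
    refine measurePreserving_pi _ _ fun i => ?_
    by_cases h : ξ i = ξ' i
    · simp only [hs, if_pos h]
      exact MeasurePreserving.id _
    · simp only [hs, if_neg h]
      exact Measure.measurePreserving_swap
  rw [← hmp.lintegral_comp (measurable_ghostSup hΦ ξ)]
  refine lintegral_congr fun w => ?_
  refine iSup_congr fun t => iSup_congr fun f => iSup_congr fun hf => ?_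
  congr 2
  refine Finset.sum_congr rfl fun i _ => ?_
  by_cases h : ξ i = ξ' i
  · simp [hs, h]
  · have h' : ξ i = !ξ' i := by
      revert h; cases ξ i <;> cases ξ' i <;> simp
    simp only [hs, if_neg h, h', sgn_not, Prod.fst_swap, Prod.snd_swap]
    ring

lemma ofReal_abs_integral_le {S : Type*} [MeasurableSpace S] (ν : Measure S) (f : S → ℝ) :
    ENNReal.ofReal |∫ s, f s ∂ν| ≤ ∫⁻ s, ENNReal.ofReal |f s| ∂ν := by
  have := enorm_integral_le_lintegral_enorm (μ := ν) f
  simpa only [Real.enorm_eq_ofReal_abs] using this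

/-- The mean under μ is an expectation over the ghost sample, and the expectation moves outside the
suprema. -/
lemma supGmmd_le_lintegral (hn : 0 < n)
    (hμ : Integrable (fun x : PathSpace d T => ‖x‖ ^ 2) μ) (hΦ : IsGrowthClass Φ)
    (x : Fin n → PathSpace d T) :
    supGmmd Φ μ x ≤ ENNReal.ofReal (n : ℝ)⁻¹ * ∫⁻ y : Fin n → PathSpace d T,
      ghostSup Φ (fun _ => true) (fun i => (x i, y i)) ∂(Measure.pi fun _ => μ) := by
  have hn' : (n : ℝ) ≠ 0 := by exact_mod_cast hn.ne'
  rw [supGmmd_eq hΦ]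
  refine iSup_le fun t => iSup₂_le fun f hf => ?_
  have hint : ∀ i, Integrable (fun y : Fin n → PathSpace d T => f (y i t))
      (Measure.pi fun _ => μ) := fun i =>
    (measurePreserving_eval (fun _ : Fin n => μ) i).integrable_comp_of_integrable
      (integrable_eval hμ hΦ hf t)
  have heval : ∀ i, ∫ y : Fin n → PathSpace d T, f (y i t) ∂(Measure.pi fun _ => μ)
      = ∫ y, f (y t) ∂μ := fun i => by
    have h := (measurePreserving_eval (fun _ : Fin n => μ) i)
    conv_rhs => rw [← h.map_eq]
    exact (integral_map h.measurable.aemeasurable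
      (hΦ.continuous_eval hf t).aestronglyMeasurable).symm
  have h1 : ∫ y, f (y t) ∂μ - (n : ℝ)⁻¹ * ∑ i, f (x i t)
      = -((n : ℝ)⁻¹ * ∫ y : Fin n → PathSpace d T, ∑ i, sgn true * (f (x i t) - f (y i t))
        ∂(Measure.pi fun _ => μ)) := by
    have hsum : ∫ y : Fin n → PathSpace d T, ∑ i, sgn true * (f (x i t) - f (y i t))
        ∂(Measure.pi fun _ => μ) = ∑ i, ∫ y : Fin n → PathSpace d T,
          sgn true * (f (x i t) - f (y i t)) ∂(Measure.pi fun _ => μ) :=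
      integral_finsetSum _ fun i _ => ((integrable_const _).sub (hint i)).const_mul _
    rw [hsum]
    simp only [integral_sub (integrable_const _) (hint _), heval,
      integral_const, sgn, if_true, one_mul, Finset.sum_sub_distrib, Finset.sum_const,
      Finset.card_univ, Fintype.card_fin, nsmul_eq_mul, probReal_univ, one_smul]
    field_simp
    ring
  rw [h1, abs_neg, abs_mul, abs_of_nonneg (by positivity : (0 : ℝ) ≤ (n : ℝ)⁻¹),
    ENNReal.ofReal_mul (by positivity)]
  gcongr
  refine (ofReal_abs_integral_le _ _).trans (lintegral_mono fun y => ?_)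
  exact le_iSup_of_le t (le_iSup₂_of_le f hf le_rfl)

lemma sum_ghostSup_le (w : Fin n → PathSpace d T × PathSpace d T) :
    ∑ ξ, ghostSup Φ ξ w ≤ radSum Φ (fun i => (w i).1) + radSum Φ (fun i => (w i).2) := by
  rw [radSum, radSum, ← Finset.sum_add_distrib]
  refine Finset.sum_le_sum fun ξ _ => iSup_le fun t => iSup₂_le fun f hf => ?_
  have h1 : |∑ i, sgn (ξ i) * (f ((w i).1 t) - f ((w i).2 t))|
      ≤ |∑ i, sgn (ξ i) * f ((w i).1 t)| + |∑ i, sgn (ξ i) * f ((w i).2 t)| := by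
    simp only [mul_sub, Finset.sum_sub_distrib]
    exact abs_sub _ _
  refine (ENNReal.ofReal_le_ofReal h1).trans ?_
  rw [ENNReal.ofReal_add (abs_nonneg _) (abs_nonneg _)]
  exact add_le_add (le_iSup_of_le t (le_iSup₂_of_le f hf le_rfl))
    (le_iSup_of_le t (le_iSup₂_of_le f hf le_rfl))

lemma lintegral_ghostSup_eq (hΦ : IsGrowthClass Φ) (ξ : Fin n → Bool) :
    ∫⁻ w, ghostSup Φ ξ w ∂(pairLaw n μ) = ∫⁻ x : Fin n → PathSpace d T,
      ∫⁻ y : Fin n → PathSpace d T, ghostSup Φ ξ (fun i => (x i, y i))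
        ∂(Measure.pi fun _ => μ) ∂(Measure.pi fun _ => μ) := by
  have hmp := measurePreserving_arrowProdEquivProdArrow (PathSpace d T) (PathSpace d T) (Fin n)
    (fun _ => μ) (fun _ => μ)
  obtain ⟨F, hF⟩ : ∃ F : (Fin n → PathSpace d T) × (Fin n → PathSpace d T) → ℝ≥0∞,
    ∀ p, F p = ghostSup Φ ξ (fun i => (p.1 i, p.2 i)) := ⟨_, fun _ => rfl⟩
  have hm : Measurable fun (p : (Fin n → PathSpace d T) × (Fin n → PathSpace d T)) (i : Fin n) =>
      (p.1 i, p.2 i) :=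
    measurable_pi_lambda _ fun i => ((measurable_pi_apply i).comp measurable_fst).prodMk
      ((measurable_pi_apply i).comp measurable_snd)
  have h3 : Measurable F := by
    rw [funext hF]
    exact (measurable_ghostSup hΦ ξ).comp hm
  have h4 := lintegral_prod (μ := Measure.pi fun _ : Fin n => μ)
    (ν := Measure.pi fun _ : Fin n => μ) F h3.aemeasurable
  rw [← hmp.lintegral_comp h3] at h4
  simp only [hF] at h4
  exact h4

/-- Symmetrization. -/
lemma two_pow_mul_lintegral_supGmmd_le (hn : 0 < n)
    (hμ : Integrable (fun x : PathSpace d T => ‖x‖ ^ 2) μ) (hΦ : IsGrowthClass Φ) :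
    2 ^ n * ∫⁻ x : Fin n → PathSpace d T, supGmmd Φ μ x ∂(Measure.pi fun _ => μ)
      ≤ ENNReal.ofReal (n : ℝ)⁻¹ *
        (2 * ∫⁻ x : Fin n → PathSpace d T, radSum Φ x ∂(Measure.pi fun _ => μ)) := by
  set π : Measure (Fin n → PathSpace d T) := Measure.pi fun _ => μ
  have h1 : ∫⁻ x, supGmmd Φ μ x ∂π
      ≤ ENNReal.ofReal (n : ℝ)⁻¹ * ∫⁻ w, ghostSup Φ (fun _ => true) w ∂(pairLaw n μ) := by
    have h2 := lintegral_ghostSup_eq (μ := μ) hΦ (fun _ : Fin n => true)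
    rw [h2, ← lintegral_const_mul' _ _ ENNReal.ofReal_ne_top]
    exact lintegral_mono fun x => supGmmd_le_lintegral hn hμ hΦ x
  have hfst : MeasurePreserving (fun (w : Fin n → PathSpace d T × PathSpace d T) i => (w i).1)
      (pairLaw n μ) π := measurePreserving_pi _ _ fun _ => measurePreserving_fst
  have hsnd : MeasurePreserving (fun (w : Fin n → PathSpace d T × PathSpace d T) i => (w i).2)
      (pairLaw n μ) π := measurePreserving_pi _ _ fun _ => measurePreserving_snd
  have h2 : 2 ^ n * ∫⁻ w, ghostSup Φ (fun _ => true) w ∂(pairLaw n μ)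
      ≤ 2 * ∫⁻ x, radSum Φ x ∂π := by
    -- All 2^n signed integrals coincide, so their sum replaces 2^n copies of one of them.
    calc 2 ^ n * ∫⁻ w, ghostSup Φ (fun _ => true) w ∂(pairLaw n μ)
        = ∑ ξ : Fin n → Bool, ∫⁻ w, ghostSup Φ ξ w ∂(pairLaw n μ) := by
          rw [Finset.sum_congr rfl fun ξ _ => lintegral_ghostSup hΦ ξ fun _ => true]
          simp
      _ = ∫⁻ w, ∑ ξ : Fin n → Bool, ghostSup Φ ξ w ∂(pairLaw n μ) :=
          (lintegral_finsetSum _ fun ξ _ => measurable_ghostSup hΦ ξ).symm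
      _ ≤ ∫⁻ w, (radSum Φ (fun i => (w i).1) + radSum Φ (fun i => (w i).2)) ∂(pairLaw n μ) :=
          lintegral_mono fun w => sum_ghostSup_le w
      _ = 2 * ∫⁻ x, radSum Φ x ∂π := by
          have hm : Measurable fun w : Fin n → PathSpace d T × PathSpace d T =>
              radSum Φ (fun i => (w i).1) := (measurable_radSum hΦ).comp hfst.measurable
          rw [lintegral_add_left hm,
            hfst.lintegral_comp (measurable_radSum hΦ), hsnd.lintegral_comp (measurable_radSum hΦ),
            two_mul]
  calc 2 ^ n * ∫⁻ x, supGmmd Φ μ x ∂π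
      ≤ 2 ^ n * (ENNReal.ofReal (n : ℝ)⁻¹
        * ∫⁻ w, ghostSup Φ (fun _ => true) w ∂(pairLaw n μ)) := by gcongr
    _ = ENNReal.ofReal (n : ℝ)⁻¹
        * (2 ^ n * ∫⁻ w, ghostSup Φ (fun _ => true) w ∂(pairLaw n μ)) := by ring
    _ ≤ _ := by gcongr

end Symmetrization

section Moments

variable {d n : ℕ} {T : ℝ}

/-! ### Moments of the chaining bound -/

lemma lipschitz_pathModulus (h : ℝ) : LipschitzWith 2 fun x : PathSpace d T => pathModulus x h := by
  refine LipschitzWith.of_le_add_mul 2 fun x y => ?_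
  refine Real.iSup_le (fun p => ?_) (add_nonneg (pathModulus_nonneg y h) (by positivity))
  have h1 := norm_sub_le_pathModulus y p.2
  have h2 := (x - y).norm_coe_le_norm p.1.1
  have h3 := (x - y).norm_coe_le_norm p.1.2
  rw [ContinuousMap.sub_apply] at h2 h3
  rw [dist_eq_norm, NNReal.coe_ofNat]
  have h4 : x p.1.1 - x p.1.2
      = (y p.1.1 - y p.1.2) + ((x p.1.1 - y p.1.1) - (x p.1.2 - y p.1.2)) := by abel
  rw [h4]
  have h5 := norm_add_le (y p.1.1 - y p.1.2) ((x p.1.1 - y p.1.1) - (x p.1.2 - y p.1.2))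
  have h6 := norm_sub_le (x p.1.1 - y p.1.1) (x p.1.2 - y p.1.2)
  linarith

lemma pathModulus_le (x : PathSpace d T) (h : ℝ) : pathModulus x h ≤ 2 * ‖x‖ := by
  refine Real.iSup_le (fun p => ?_) (by positivity)
  have h1 := x.norm_coe_le_norm p.1.1
  have h2 := x.norm_coe_le_norm p.1.2
  have h3 := norm_sub_le (x p.1.1) (x p.1.2)
  linarith

variable {μ : Measure (PathSpace d T)}

lemma integrable_pathModulus_sq (hμ : Integrable (fun x : PathSpace d T => ‖x‖ ^ 2) μ) (h : ℝ) :
    Integrable (fun x => pathModulus x h ^ 2) μ := by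
  refine (hμ.const_mul 4).mono'
    ((lipschitz_pathModulus h).continuous.pow 2).aestronglyMeasurable
    (Filter.Eventually.of_forall fun x => ?_)
  rw [Real.norm_of_nonneg (sq_nonneg _)]
  have := pow_le_pow_left₀ (pathModulus_nonneg x h) (pathModulus_le x h) 2
  linarith

/-- Jensen's inequality from √g ≤ 1/(2l) + l·g/2, optimized over l. -/
lemma lintegral_ofReal_sqrt_le {S : Type*} [MeasurableSpace S] {ν : Measure S}
    [IsProbabilityMeasure ν] {g : S → ℝ} (hg : Integrable g ν) (hg0 : ∀ s, 0 ≤ g s) :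
    ∫⁻ s, ENNReal.ofReal √(g s) ∂ν ≤ ENNReal.ofReal √(∫ s, g s ∂ν) := by
  have hI : 0 ≤ ∫ s, g s ∂ν := integral_nonneg hg0
  have hbound : ∀ l, 0 < l → ∫⁻ s, ENNReal.ofReal √(g s) ∂ν
      ≤ ENNReal.ofReal (1 / 2 / l + l * (∫ s, g s ∂ν) / 2) := by
    intro l hl
    have h1 : ∀ s, √(g s) ≤ 1 / 2 / l + l / 2 * g s := by
      intro s
      have h2 := Real.sq_sqrt (hg0 s)
      have h3 : 1 / 2 / l + l / 2 * g s - √(g s) = (l * √(g s) - 1) ^ 2 / (2 * l) := by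
        rw [eq_div_iff (by positivity)]
        field_simp
        rw [← h2, Real.sqrt_sq (Real.sqrt_nonneg _)]
        ring
      have : 0 ≤ (l * √(g s) - 1) ^ 2 / (2 * l) := by positivity
      linarith
    have hint : Integrable (fun s => 1 / 2 / l + l / 2 * g s) ν :=
      (integrable_const _).add (hg.const_mul _)
    calc ∫⁻ s, ENNReal.ofReal √(g s) ∂ν ≤ ∫⁻ s, ENNReal.ofReal (1 / 2 / l + l / 2 * g s) ∂ν :=
          lintegral_mono fun s => ENNReal.ofReal_le_ofReal (h1 s)
      _ = ENNReal.ofReal (∫ s, (1 / 2 / l + l / 2 * g s) ∂ν) :=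
          (ofReal_integral_eq_lintegral_ofReal hint (Filter.Eventually.of_forall fun s =>
            (Real.sqrt_nonneg _).trans (h1 s))).symm
      _ = _ := by
          rw [integral_add (integrable_const _) (hg.const_mul _), integral_const_mul]
          simp only [integral_const, probReal_univ, one_smul]
          congr 1
          ring
  have hfin : ∫⁻ s, ENNReal.ofReal √(g s) ∂ν ≠ ∞ :=
    ((hbound 1 one_pos).trans_lt ENNReal.ofReal_lt_top).ne
  rw [← ENNReal.ofReal_toReal hfin]
  refine ENNReal.ofReal_le_ofReal ?_
  have := le_sqrt_of_forall_le_div_add (a := 1 / 2) (by norm_num) hI fun l hl =>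
    ENNReal.toReal_le_of_le_ofReal (by positivity) (hbound l hl)
  simpa using this

variable [IsProbabilityMeasure μ]

lemma integrable_sum_pi {b : PathSpace d T → ℝ} (hb : Integrable b μ) :
    Integrable (fun x : Fin n → PathSpace d T => ∑ i, b (x i)) (Measure.pi fun _ => μ) :=
  integrable_finsetSum _ fun i _ =>
    (measurePreserving_eval (fun _ : Fin n => μ) i).integrable_comp_of_integrable hb

lemma integral_sum_pi {b : PathSpace d T → ℝ} (hb : Integrable b μ) :
    ∫ x : Fin n → PathSpace d T, ∑ i, b (x i) ∂(Measure.pi fun _ => μ) = n * ∫ x, b x ∂μ := by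
  have heval : ∀ i, ∫ x : Fin n → PathSpace d T, b (x i) ∂(Measure.pi fun _ => μ)
      = ∫ x, b x ∂μ := fun i => by
    have h := (measurePreserving_eval (fun _ : Fin n => μ) i)
    have hb' : AEStronglyMeasurable b (Measure.map (Function.eval i) (Measure.pi fun _ => μ)) := by
      rw [h.map_eq]; exact hb.aestronglyMeasurable
    conv_rhs => rw [← h.map_eq]
    exact (integral_map h.measurable.aemeasurable hb').symm
  have hint : ∀ i, Integrable (fun x : Fin n → PathSpace d T => b (x i))
      (Measure.pi fun _ => μ) := fun i =>
    (measurePreserving_eval (fun _ : Fin n => μ) i).integrable_comp_of_integrable hb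
  rw [integral_finsetSum _ fun i _ => hint i]
  simp [heval]

lemma lintegral_sqrt_sum_pi_le {b : PathSpace d T → ℝ} (hb : Integrable b μ) (hb0 : ∀ x, 0 ≤ b x) :
    ∫⁻ x : Fin n → PathSpace d T, ENNReal.ofReal √(∑ i, b (x i)) ∂(Measure.pi fun _ => μ)
      ≤ ENNReal.ofReal √(n * ∫ x, b x ∂μ) := by
  rw [← integral_sum_pi hb]
  exact lintegral_ofReal_sqrt_le (integrable_sum_pi hb) fun x => Finset.sum_nonneg fun i _ => hb0 _

/-- The coefficients of the chaining bound. -/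
def chainCoeff (α β : ℝ) (k : ℕ) : ℝ :=
  √(2 * (k + 2)) * (√(((k : ℝ) + 1) ^ β) * ((2 : ℝ) ^ (-(α / 2))) ^ k)

lemma chainCoeff_nonneg (α β : ℝ) (k : ℕ) : 0 ≤ chainCoeff α β k := by
  unfold chainCoeff; positivity

/-- The coefficients are dominated by a polynomial times a geometric sequence of ratio 2^(-α/2) < 1.
-/
lemma summable_chainCoeff {α : ℝ} (hα : 0 < α) (β : ℝ) : Summable (chainCoeff α β) := by
  set r : ℝ := 2 ^ (-(α / 2)) with hr
  have hr0 : 0 < r := Real.rpow_pos_of_pos two_pos _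
  have hr1 : r < 1 := Real.rpow_lt_one_of_one_lt_of_neg one_lt_two (by linarith)
  obtain ⟨m, hm⟩ := exists_nat_ge β
  have h0 : Summable fun k : ℕ => (k : ℝ) ^ (m + 1) * r ^ k :=
    summable_pow_mul_geometric_of_norm_lt_one (m + 1) (by rwa [Real.norm_of_nonneg hr0.le])
  have h1 : Summable fun k : ℕ => 2 * r⁻¹ * (((k + 1 : ℕ) : ℝ) ^ (m + 1) * r ^ (k + 1)) :=
    ((summable_nat_add_iff (f := fun k : ℕ => (k : ℝ) ^ (m + 1) * r ^ k) 1).2 h0).mul_left _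
  refine Summable.of_nonneg_of_le (chainCoeff_nonneg α β) (fun k => ?_) h1
  have hk : (1 : ℝ) ≤ (k : ℝ) + 1 := by linarith [(Nat.cast_nonneg k : (0 : ℝ) ≤ k)]
  have h2 : ((k : ℝ) + 1) ^ β ≤ ((k : ℝ) + 1) ^ m := by
    rw [← Real.rpow_natCast]
    exact Real.rpow_le_rpow_of_exponent_le hk hm
  have h3 : √(2 * (k + 2)) * √(((k : ℝ) + 1) ^ β) ≤ 2 * ((k : ℝ) + 1) ^ (m + 1) := by
    rw [← Real.sqrt_mul (by positivity)]
    refine Real.sqrt_le_iff.2 ⟨by positivity, ?_⟩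
    have h4 : (1 : ℝ) ≤ ((k : ℝ) + 1) ^ (m + 1) := one_le_pow₀ hk
    calc 2 * ((k : ℝ) + 2) * ((k : ℝ) + 1) ^ β
        ≤ 2 * (2 * ((k : ℝ) + 1)) * ((k : ℝ) + 1) ^ m := by gcongr; linarith
      _ = 4 * ((k : ℝ) + 1) ^ (m + 1) := by ring
      _ ≤ (2 * ((k : ℝ) + 1) ^ (m + 1)) ^ 2 := by nlinarith
  rw [chainCoeff, ← mul_assoc, ← hr]
  calc √(2 * (k + 2)) * √(((k : ℝ) + 1) ^ β) * r ^ k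
      ≤ 2 * ((k : ℝ) + 1) ^ (m + 1) * r ^ k := by gcongr
    _ = _ := by rw [pow_succ r]; push_cast; field_simp

lemma tsum_chainCoeff_pos {α : ℝ} (hα : 0 < α) (β : ℝ) : 0 < ∑' k, chainCoeff α β k :=
  (summable_chainCoeff hα β).tsum_pos (chainCoeff_nonneg α β) 0 (by simp [chainCoeff])

/-- At mesh h = T/2^k, log(2T/h) = (k+1) log 2 ≤ k+1 and h^α = T^α·2^(-αk). -/
lemma sqrt_modulus_bound_le {α β Q : ℝ} (hβ : 0 < β) (hT : 0 < T) (hQ : 0 < Q) (n k : ℕ) :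
    √(2 * (k + 2)) * √(n * (Q * (T / 2 ^ k) ^ α * Real.log (2 * T / (T / 2 ^ k)) ^ β))
      ≤ √(n * (Q * T ^ α)) * chainCoeff α β k := by
  have h1 : Real.log (2 * T / (T / 2 ^ k)) ≤ k + 1 := by
    have : 2 * T / (T / 2 ^ k) = 2 ^ (k + 1) := by field_simp; ring
    rw [this, Real.log_pow]
    push_cast
    have := Real.log_two_lt_d9
    nlinarith [(Nat.cast_nonneg k : (0 : ℝ) ≤ k)]
  have h0 : 0 ≤ Real.log (2 * T / (T / 2 ^ k)) := by
    refine Real.log_nonneg ?_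
    rw [le_div_iff₀ (by positivity), one_mul]
    have : T / 2 ^ k ≤ T := div_le_self hT.le (one_le_pow₀ one_le_two)
    linarith
  have h2 : Real.log (2 * T / (T / 2 ^ k)) ^ β ≤ ((k : ℝ) + 1) ^ β :=
    Real.rpow_le_rpow h0 h1 hβ.le
  have h3 : (T / 2 ^ k) ^ α = T ^ α * (((2 : ℝ) ^ (-(α / 2))) ^ k) ^ 2 := by
    rw [Real.div_rpow hT.le (by positivity), div_eq_mul_inv]
    congr 1
    rw [← pow_mul, ← Real.rpow_natCast, ← Real.rpow_natCast, ← Real.rpow_mul zero_le_two,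
      ← Real.rpow_mul zero_le_two, ← Real.rpow_neg zero_le_two]
    congr 1
    push_cast
    ring
  have h4 : √(n * (Q * (T / 2 ^ k) ^ α * Real.log (2 * T / (T / 2 ^ k)) ^ β))
      ≤ √(n * (Q * T ^ α)) * (√(((k : ℝ) + 1) ^ β) * ((2 : ℝ) ^ (-(α / 2))) ^ k) := by
    refine Real.sqrt_le_iff.2 ⟨by positivity, ?_⟩
    rw [mul_pow, mul_pow, Real.sq_sqrt (by positivity), Real.sq_sqrt (by positivity), h3]
    calc n * (Q * (T ^ α * (((2 : ℝ) ^ (-(α / 2))) ^ k) ^ 2)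
          * Real.log (2 * T / (T / 2 ^ k)) ^ β)
        ≤ n * (Q * (T ^ α * (((2 : ℝ) ^ (-(α / 2))) ^ k) ^ 2) * ((k : ℝ) + 1) ^ β) := by gcongr
      _ = _ := by ring
  calc √(2 * (k + 2)) * √(n * (Q * (T / 2 ^ k) ^ α * Real.log (2 * T / (T / 2 ^ k)) ^ β))
      ≤ √(2 * (k + 2)) * (√(n * (Q * T ^ α))
        * (√(((k : ℝ) + 1) ^ β) * ((2 : ℝ) ^ (-(α / 2))) ^ k)) := by gcongr
    _ = _ := by rw [chainCoeff]; ring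

lemma lintegral_chainTail_le {α β Q : ℝ} (hα : 0 < α) (hβ : 0 < β) (hT : 0 < T) (hQ : 0 < Q)
    (hμ : Integrable (fun x : PathSpace d T => ‖x‖ ^ 2) μ)
    (hmod : ∀ h : ℝ, 0 < h → h ≤ T →
      ∫ x, pathModulus x h ^ 2 ∂μ ≤ Q * h ^ α * Real.log (2 * T / h) ^ β) :
    ∫⁻ x : Fin n → PathSpace d T, chainTail x ∂(Measure.pi fun _ => μ)
      ≤ ENNReal.ofReal (√(n * (Q * T ^ α)) * ∑' k, chainCoeff α β k) := by
  unfold chainTail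
  rw [lintegral_tsum, ENNReal.ofReal_mul (by positivity),
    ENNReal.ofReal_tsum_of_nonneg (chainCoeff_nonneg α β) (summable_chainCoeff hα β),
    ← ENNReal.tsum_mul_left]
  · refine ENNReal.tsum_le_tsum fun k => ?_
    simp only [ENNReal.ofReal_mul (Real.sqrt_nonneg (2 * ((k : ℝ) + 2)))]
    rw [lintegral_const_mul' _ _ ENNReal.ofReal_ne_top]
    refine (mul_le_mul_right (lintegral_sqrt_sum_pi_le (integrable_pathModulus_sq hμ _)
      fun x => sq_nonneg _) _).trans ?_
    rw [← ENNReal.ofReal_mul (by positivity), ← ENNReal.ofReal_mul (by positivity)]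
    refine ENNReal.ofReal_le_ofReal (le_trans ?_ (sqrt_modulus_bound_le hβ hT hQ n k))
    gcongr
    exact hmod _ (by positivity) (div_le_self hT.le (one_le_pow₀ one_le_two))
  · intro k
    refine (ENNReal.continuous_ofReal.comp (continuous_const.mul (Real.continuous_sqrt.comp
      (continuous_finsetSum _ fun i _ => ?_)))).measurable.aemeasurable
    exact ((lipschitz_pathModulus _).continuous.comp (continuous_apply i)).pow 2

/-- The uniform estimate for a function class whose Rademacher sums along paths are controlled by
the paths and their moduli of continuity. -/
lemma lintegral_supGmmd_le {α β Q : ℝ} (hα : 0 < α) (hβ : 0 < β) (hT : 0 < T) (hQ : 0 < Q)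
    (hμ : Integrable (fun x : PathSpace d T => ‖x‖ ^ 2) μ)
    (hmod : ∀ h : ℝ, 0 < h → h ≤ T →
      ∫ x, pathModulus x h ^ 2 ∂μ ≤ Q * h ^ α * Real.log (2 * T / h) ^ β)
    {Ω : Type*} [MeasurableSpace Ω] {P : Measure Ω} [IsProbabilityMeasure P] (hn : 0 < n)
    {X : Fin n → Ω → PathSpace d T} (hX : ∀ i, Measurable (X i)) (hind : iIndepFun X P)
    (hlaw : ∀ i, P.map (X i) = μ) {Φ : Set (Eucl d → ℝ)} (hΦ : IsGrowthClass Φ)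
    {b : PathSpace d T → ℝ} {K : ℝ} (hK : 0 ≤ K) (hb : Integrable b μ) (hb0 : ∀ x, 0 ≤ b x)
    (hrad : ∀ x : Fin n → PathSpace d T, radSum Φ x
      ≤ 2 ^ n * (ENNReal.ofReal √(∑ i, b (x i)) + ENNReal.ofReal K * chainTail x)) :
    Measurable (fun ω => supGmmd Φ μ (fun i => X i ω)) ∧
    ∫⁻ ω, supGmmd Φ μ (fun i => X i ω) ∂P ≤ ENNReal.ofReal
      (2 * √((∫ x, b x ∂μ) / n) + 2 * (∑' k, chainCoeff α β k) * K * √(Q * T ^ α / n)) := by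
  have hXm : Measurable fun ω i => X i ω := measurable_pi_lambda _ hX
  refine ⟨(measurable_supGmmd hΦ).comp hXm, ?_⟩
  have hmap : P.map (fun ω i => X i ω) = Measure.pi fun _ => μ := by
    rw [(iIndepFun_iff_map_fun_eq_pi_map fun i => (hX i).aemeasurable).1 hind]
    simp only [hlaw]
  have h1 : ∫⁻ ω, supGmmd Φ μ (fun i => X i ω) ∂P
      = ∫⁻ x : Fin n → PathSpace d T, supGmmd Φ μ x ∂(Measure.pi fun _ => μ) := by
    rw [← hmap, lintegral_map (measurable_supGmmd hΦ) hXm]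
  rw [h1]
  set A := ∑' k, chainCoeff α β k
  have hA : 0 ≤ A := tsum_nonneg (chainCoeff_nonneg α β)
  have hI : 0 ≤ ∫ x, b x ∂μ := integral_nonneg hb0
  have hn' : (0 : ℝ) < n := by exact_mod_cast hn
  have hrad' : ∫⁻ x : Fin n → PathSpace d T, radSum Φ x ∂(Measure.pi fun _ => μ)
      ≤ 2 ^ n * (ENNReal.ofReal √(n * ∫ x, b x ∂μ)
        + ENNReal.ofReal K * ENNReal.ofReal (√(n * (Q * T ^ α)) * A)) := by
    refine (lintegral_mono hrad).trans ?_
    rw [lintegral_const_mul' _ _ (by simp)]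
    gcongr
    have hmeas : AEMeasurable (fun x : Fin n → PathSpace d T =>
        ENNReal.ofReal √(∑ i, b (x i))) (Measure.pi fun _ => μ) :=
      (ENNReal.continuous_ofReal.comp Real.continuous_sqrt).measurable.comp_aemeasurable
        (integrable_sum_pi hb).aemeasurable
    rw [lintegral_add_left' hmeas, lintegral_const_mul' _ _ ENNReal.ofReal_ne_top]
    gcongr
    · exact lintegral_sqrt_sum_pi_le hb hb0
    · exact lintegral_chainTail_le hα hβ hT hQ hμ hmod
  have h2 := (two_pow_mul_lintegral_supGmmd_le hn hμ hΦ).trans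
    (mul_le_mul_right (mul_le_mul_right hrad' 2) _)
  have h3 : ENNReal.ofReal (n : ℝ)⁻¹ * (2 * (2 ^ n * (ENNReal.ofReal √(n * ∫ x, b x ∂μ)
        + ENNReal.ofReal K * ENNReal.ofReal (√(n * (Q * T ^ α)) * A))))
      = 2 ^ n * ENNReal.ofReal ((n : ℝ)⁻¹ * (2 * (√(n * ∫ x, b x ∂μ)
        + K * (√(n * (Q * T ^ α)) * A)))) := by
    rw [← ENNReal.ofReal_mul hK, ← ENNReal.ofReal_add (by positivity) (by positivity),
      ENNReal.ofReal_mul (p := (n : ℝ)⁻¹) (by positivity), ENNReal.ofReal_mul zero_le_two,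
      ENNReal.ofReal_ofNat]
    ring
  rw [h3] at h2
  have h4 := (ENNReal.mul_le_mul_iff_right (a := 2 ^ n) (by simp) (by simp)).1 h2
  refine h4.trans (ENNReal.ofReal_le_ofReal (le_of_eq ?_))
  have hs : ∀ a : ℝ, √(n * a) = n * √(a / n) := fun a => by
    have : (n : ℝ) * a = n ^ 2 * (a / n) := by field_simp
    rw [this, Real.sqrt_mul (by positivity), Real.sqrt_sq hn'.le]
  rw [hs, hs]
  field_simp

end Moments

section UnitBalls

variable {d : ℕ}

/-! ### Regularity of the functions in the unit balls -/

lemma isGrowthClass_rkhsUnitBall {H : Type*} [NormedAddCommGroup H] [InnerProductSpace ℝ H]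
    [RKHS ℝ H (Eucl d) ℝ] {k : Eucl d → Eucl d → ℝ} {K₁ K₂ : ℝ} (hk : IsReproducingKernel H k)
    (hK₁ : 0 < K₁) (hlip : ∀ x y, k x x + k y y - 2 * k x y ≤ K₁ ^ 2 * ‖x - y‖ ^ 2)
    (hK₂ : K₂ = √(k 0 0)) : IsGrowthClass (rkhsUnitBall (d := d) H) := by
  obtain ⟨φ, hφ, hdist, h0⟩ := hk.exists_feature hK₁ hlip hK₂
  have hcont : Continuous φ := by
    refine (LipschitzWith.of_dist_le' (K := K₁) fun a b => ?_).continuous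
    simpa [dist_eq_norm] using hdist a b
  refine ⟨fun f hf => ?_, K₁ + K₂, fun f hf x => ?_⟩
  · obtain ⟨g, -, hfg⟩ := hf
    rw [funext fun x => (hfg x).trans (hφ x g)]
    exact continuous_const.inner hcont
  · obtain ⟨g, hg, hfg⟩ := hf
    rw [hfg, hφ]
    refine (abs_real_inner_le_norm _ _).trans ((mul_le_of_le_one_left (norm_nonneg _) hg).trans ?_)
    have h1 := norm_le_norm_add_norm_sub' (φ x) (φ 0)
    have h2 := hdist x 0
    rw [sub_zero] at h2
    have h3 : 0 ≤ K₂ := h0 ▸ norm_nonneg _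
    nlinarith [norm_nonneg x, mul_nonneg h3 (norm_nonneg x)]

lemma sqrt_norm_sq_add_one_le (x : Eucl d) : √(‖x‖ ^ 2 + 1) ≤ 1 * (1 + ‖x‖) := by
  refine Real.sqrt_le_iff.2 ⟨by positivity, ?_⟩
  nlinarith [norm_nonneg x]

lemma isGrowthClass_barronUnitBall : IsGrowthClass (barronUnitBall d) := by
  refine ⟨fun f hf => ?_, 1, fun f hf x => ?_⟩
  · refine (LipschitzWith.of_dist_le' (K := 1) fun x y => ?_).continuous
    rw [one_mul, Real.dist_eq, dist_eq_norm]
    -- Two points with coefficients ±1 give f(x) - f(y).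
    have h := abs_sum_mul_barron_le hf (κ := Bool) sgn (fun b => if b then x else y)
      (norm_nonneg (x - y)) fun p => ?_
    · simpa [sgn, sub_eq_add_neg] using h
    · have h1 := abs_relu_sub_le (inner ℝ (p : WithLp 2 (Eucl d × ℝ)) (barronEmbed x))
        (inner ℝ (p : WithLp 2 (Eucl d × ℝ)) (barronEmbed y))
      rw [← inner_sub_right] at h1
      have h2 := abs_real_inner_le_norm (p : WithLp 2 (Eucl d × ℝ)) (barronEmbed x - barronEmbed y)
      rw [norm_barronEmbed_sub, show ‖(p : WithLp 2 (Eucl d × ℝ))‖ = 1 by simp, one_mul] at h2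
      simpa [sgn, sub_eq_add_neg] using h1.trans h2
  · refine le_trans ?_ (sqrt_norm_sq_add_one_le x)
    have h := abs_sum_mul_barron_le hf (κ := Unit) (fun _ => 1) (fun _ => x)
      (Real.sqrt_nonneg (‖x‖ ^ 2 + 1)) fun p => ?_
    · simpa using h
    · have h1 := abs_relu_sub_le (inner ℝ (p : WithLp 2 (Eucl d × ℝ)) (barronEmbed x)) 0
      have h2 := abs_real_inner_le_norm (p : WithLp 2 (Eucl d × ℝ)) (barronEmbed x)
      rw [show ‖(p : WithLp 2 (Eucl d × ℝ))‖ = 1 by simp, one_mul] at h2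
      rw [← norm_barronEmbed_sq, Real.sqrt_sq (norm_nonneg _)]
      simpa [relu] using h1.trans (by simpa using h2)

lemma isGrowthClass_flowUnitBall {D : ℕ} (hD : d + 1 ≤ D) : IsGrowthClass (flowUnitBall d D) := by
  refine ⟨fun f hf => hf.1.1, 1, fun f hf x => le_trans ?_ (sqrt_norm_sq_add_one_le x)⟩
  rw [← norm_flowEmbed_sq hD, Real.sqrt_sq (norm_nonneg _)]
  have h := abs_sum_mul_flow_le hf (ι := Unit) (κ := Unit) (fun _ => true) (fun _ _ => x)
    (norm_nonneg (flowEmbed D x)) (fun ℓ _ y hy => ?_) ()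
  · simpa [sgn] using h
  · have := FlowField.abs_le_of_mem_profiles (ζ := fun _ => ‖flowEmbed D x‖) (fun _ _ => le_rfl)
      hy ()
    simpa [signSum, sgn] using this

end UnitBalls

end

/-! ### The three estimates -/

theorem propositionA1 (α β : ℝ) (hα : 0 < α) (hβ : 0 < β) :
    ∃ C : ℝ, 0 < C ∧
      ∀ (d : ℕ) (T Q : ℝ), 0 < T → 0 < Q →
      ∀ (μ : Measure (PathSpace d T)) [IsProbabilityMeasure μ],
        Integrable (fun x : PathSpace d T => ⨆ t, ‖x t‖ ^ 2) μ →
        (∀ h : ℝ, 0 < h → h ≤ T →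
          ∫ x, pathModulus x h ^ 2 ∂μ ≤ Q * h ^ α * Real.log (2 * T / h) ^ β) →
      ∀ (Ω : Type*) [MeasurableSpace Ω] (P : Measure Ω) [IsProbabilityMeasure P]
        (n : ℕ) (X : Fin n → Ω → PathSpace d T),
        0 < n →
        (∀ i, Measurable (X i)) → iIndepFun X P → (∀ i, P.map (X i) = μ) →
        -- reproducing kernel Hilbert spaces
        (∀ (H : Type*) [NormedAddCommGroup H] [InnerProductSpace ℝ H] [CompleteSpace H]
            [RKHS ℝ H (Eucl d) ℝ] (k : Eucl d → Eucl d → ℝ) (K₁ K₂ : ℝ),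
            IsReproducingKernel H k →
            0 < K₁ → 0 < K₂ →
            (∀ x y, k x x + k y y - 2 * k x y ≤ K₁ ^ 2 * ‖x - y‖ ^ 2) →
            K₂ = √(k 0 0) →
            Measurable (fun ω => supGmmd (rkhsUnitBall H) μ (fun i => X i ω)) ∧
            ∫⁻ ω, supGmmd (rkhsUnitBall H) μ (fun i => X i ω) ∂P ≤
              ENNReal.ofReal
                (2 * √(2 / n * (K₁ ^ 2 * (∫ x, (⨆ t, ‖x t‖ ^ 2) ∂μ) + K₂ ^ 2))
                  + C * K₁ * √(Q * T ^ α / n))) ∧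
        -- the Barron space
        (Measurable (fun ω => supGmmd (barronUnitBall d) μ (fun i => X i ω)) ∧
          ∫⁻ ω, supGmmd (barronUnitBall d) μ (fun i => X i ω) ∂P ≤
            ENNReal.ofReal
              (4 * √(2 / n * ∫ x, (⨆ t, (‖x t‖ ^ 2 + 1)) ∂μ) + C * √(Q * T ^ α / n))) ∧
        -- flow-induced function spaces
        (∀ D : ℕ, d + 1 ≤ D →
          Measurable (fun ω => supGmmd (flowUnitBall d D) μ (fun i => X i ω)) ∧
          ∫⁻ ω, supGmmd (flowUnitBall d D) μ (fun i => X i ω) ∂P ≤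
            ENNReal.ofReal
              (2 * Real.exp 2 * √(2 / n * ∫ x, (⨆ t, (‖x t‖ ^ 2 + 1)) ∂μ)
                + C * √(Q * T ^ α / n))) := by
  -- The 2 comes from symmetrization; the three classes multiply it only by their Lipschitz
  -- constants K₁, 1 and 1.
  refine ⟨2 * ∑' k, chainCoeff α β k, mul_pos two_pos (tsum_chainCoeff_pos hα β), ?_⟩
  intro d T Q hT hQ μ _ hμ hmod Ω _ P _ n X hn hX hind hlaw
  simp only [iSup_norm_sq_eq hT] at hμ
  simp only [iSup_norm_sq_eq hT, iSup_norm_sq_add_one_eq hT]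
  set A := ∑' k, chainCoeff α β k
  have hμ1 : Integrable (fun x : PathSpace d T => ‖x‖ ^ 2 + 1) μ := hμ.add (integrable_const 1)
  set I := ∫ x : PathSpace d T, (‖x‖ ^ 2 + 1) ∂μ with hI
  have hI0 : 0 ≤ I := integral_nonneg fun x => by positivity
  have hsqrt : ∀ {a b : ℝ}, 0 ≤ a → 0 ≤ b → a ^ 2 ≤ 2 * b ^ 2 →
      √((∫ x : PathSpace d T, a ^ 2 * (‖x‖ ^ 2 + 1) ∂μ) / n) ≤ b * √(2 / n * I) := by
    intro a b _ hb hab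
    rw [integral_const_mul, ← hI]
    refine Real.sqrt_le_iff.2 ⟨by positivity, ?_⟩
    rw [mul_pow, Real.sq_sqrt (by positivity)]
    have h1 : 0 ≤ I / n := by positivity
    calc a ^ 2 * I / n = a ^ 2 * (I / n) := by ring
      _ ≤ 2 * b ^ 2 * (I / n) := by gcongr
      _ = b ^ 2 * (2 / n * I) := by ring
  have hsum : ∀ {a : ℝ}, 0 ≤ a → ∀ x : Fin n → PathSpace d T,
      a * √(∑ i, (‖x i‖ ^ 2 + 1)) = √(∑ i, a ^ 2 * (‖x i‖ ^ 2 + 1)) := by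
    intro a ha x
    rw [← Finset.mul_sum, Real.sqrt_mul (sq_nonneg a), Real.sqrt_sq ha]
  refine ⟨?_, ?_, ?_⟩
  · intro H _ _ _ _ k K₁ K₂ hk hK₁ hK₂ hlip hK₂'
    have h := lintegral_supGmmd_le hα hβ hT hQ hμ hmod hn hX hind hlaw
      (isGrowthClass_rkhsUnitBall hk hK₁ hlip hK₂') hK₁.le
      (b := fun x => 2 * (K₁ ^ 2 * ‖x‖ ^ 2 + K₂ ^ 2))
      (((hμ.const_mul _).add (integrable_const _)).const_mul 2) (fun x => by positivity)
      (radSum_rkhsUnitBall_le hT hk hK₁ hlip hK₂')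
    refine ⟨h.1, h.2.trans (ENNReal.ofReal_le_ofReal (le_of_eq ?_))⟩
    rw [integral_const_mul, integral_add (hμ.const_mul _) (integrable_const _),
      integral_const_mul]
    simp only [integral_const, probReal_univ, one_smul]
    rw [div_mul_eq_mul_div]
  · have h := lintegral_supGmmd_le hα hβ hT hQ hμ hmod hn hX hind hlaw
      isGrowthClass_barronUnitBall zero_le_one
      (b := fun x => (1 + √2) ^ 2 * (‖x‖ ^ 2 + 1)) (hμ1.const_mul _) (fun x => by positivity)
      (fun x => by
        rw [← hsum (by positivity), ENNReal.ofReal_one, one_mul]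
        exact radSum_barronUnitBall_le hn hT x)
    refine ⟨h.1, h.2.trans (ENNReal.ofReal_le_ofReal ?_)⟩
    rw [mul_one]
    have h2 : √2 ^ 2 = 2 := Real.sq_sqrt zero_le_two
    -- (1+√2)² ≤ 2·2².
    have h1 := hsqrt (a := 1 + √2) (b := 2) (by positivity) zero_le_two
      (by nlinarith [sq_nonneg (√2 - 1), Real.sqrt_nonneg 2])
    linarith
  · intro D hD
    have h := lintegral_supGmmd_le hα hβ hT hQ hμ hmod hn hX hind hlaw
      (isGrowthClass_flowUnitBall hD) zero_le_one
      (b := fun x => (1041 / 100) ^ 2 * (‖x‖ ^ 2 + 1)) (hμ1.const_mul _) (fun x => by positivity)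
      (fun x => by
        rw [← hsum (by positivity), ENNReal.ofReal_one, one_mul]
        exact radSum_flowUnitBall_le hn hT hD x)
    refine ⟨h.1, h.2.trans (ENNReal.ofReal_le_ofReal ?_)⟩
    rw [mul_one]
    -- 10.41² ≤ 2·7.38² ≤ 2e⁴: the narrow margin that fixes the constant 9.41.
    have h1 := hsqrt (a := 1041 / 100) (b := Real.exp 2) (by norm_num) (Real.exp_pos 2).le (by
      have h2 := Real.exp_one_gt_d9
      have h3 : Real.exp 2 = Real.exp 1 ^ 2 := by rw [← Real.exp_nat_mul]; norm_num
      have h4 : (738 / 100 : ℝ) ≤ Real.exp 2 := by rw [h3]; nlinarith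
      nlinarith)
    linarith
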